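/- Setting. Let $(X,d)$ be a locally compact, separable, complete metric space with at least two points, let $m$ be a Radon measure on $X$ with full topological support, and let $B(x,r)=\{y\in X : d(x,y)<r\}$. Let $p\in(1,\infty)$. For a linear space $V$, a function $E\colon V\to[0,\infty)$ is called a $p$-energy form if $E^{1/p}$ is a seminorm on $V$. Let $\mathcal F_p$ be a linear subspace of $L^p(X,m)$, let $\mathcal E_p\colon\mathcal F_p\to[0,\infty)$ be a $p$-energy form, and let $\{\Gamma_p\langle u\rangle\}_{u\in\mathcal F_p}$ be a family of finite Borel measures on $X$ such that: (1) for every $u\in\mathcal F_p$ and every $1$-Lipschitz $\varphi\colon\mathbb R\to\mathbb R$ with $\varphi(0)=0$ one has $\varphi(u)\in\mathcal F_p$ and $\mathcal E_p(\varphi(u))\le\mathcal E_p(u)$; and $\mathcal E_p(u)=0$ implies that $u$ is constant $m$-a.e.; (2) $\mathcal F_p$ with the norm $\|u\|_{L^p(X,m)}+\mathcal E_p(u)^{1/p}$ is a reflexive Banach space; (3) $\mathcal F_p\cap C_c(X)$ is dense in $\mathcal F_p$ for this norm, and in $C_c(X)$ for the uniform norm; (4) for every Borel set $A\subseteq X$,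 $u\mapsto\Gamma_p\langle u\rangle(A)$ is a $p$-energy form on $\mathcal F_p$; (5) $\mathcal E_p(u)=\Gamma_p\langle u\rangle(X)$ for every $u\in\mathcal F_p$; (6) if $u,v\in\mathcal F_p\cap C_c(X)$, $U\subseteq X$ is open and $u-v$ is constant on $U$, then $\Gamma_p\langle u\rangle|_U=\Gamma_p\langle v\rangle|_U$. Local spaces. For an open set $U\subseteq X$, $\mathcal F_{p,\mathrm{loc}}(U)$ is the set of $m$-classes of real Borel functions $u$ on $U$ such that for every relatively compact open subset $A$ of $U$ there is $u^\#\in\mathcal F_p$ with $u=u^\#$ $m$-a.e. on $A$. For $u\in\mathcal F_{p,\mathrm{loc}}(U)$, $\Gamma_p\langle u\rangle$ denotes the measure on $U$ given by $\Gamma_p\langle u\rangle(E)=\Gamma_p\langle u^\#\rangle(E)$ for Borel $E\subseteq A$, with $A$, $u^\#$ as above, and by $\Gamma_p\langle u\rangle(E)=\lim_n\Gamma_p\langle u\rangle(E\cap A_n)$ for general Borel $E\subseteq U$, where $A_n\uparrow U$ are relatively compact open subsets of $U$. Let $\mathcal F_p(U)$ be the set of $u\in\mathcal F_{p,\mathrm{loc}}(U)$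 with $\int_U|u|^p\,dm+\Gamma_p\langle u\rangle(U)<\infty$. An open set $\Omega\ne X$ has property (E) if for every $f\in\mathcal F_p(\Omega)$ there is $F\in\mathcal F_p$ with $F=f$ $m$-a.e. on $\Omega$ and $\Gamma_p\langle F\rangle(\partial\Omega)=0$. Theorem (BBM type characterization). Assume that for some $\theta_p\ge1$ the following hold. (VD) There is $c_D\in[1,\infty)$ with $m(B(x,2r))\le c_D\,m(B(x,r))$ for all $x\in X$, $r>0$. (PI$_p(p\theta_p)$) There are $C_P\in(0,\infty)$ and $A_P\in[1,\infty)$ such that for all $x\in X$, $r>0$ and $u\in\mathcal F_p$, with $u_{B(x,r)}=\frac1{m(B(x,r))}\int_{B(x,r)}u\,dm$, $$\int_{B(x,r)}|u-u_{B(x,r)}|^p\,dm\le C_P\,r^{p\theta_p}\,\Gamma_p\langle u\rangle(B(x,A_Pr)).$$ (cap$_p(p\theta_p)_\le$) There are $C_{\mathrm{cap}},A_1,A_2\in(1,\infty)$ such that for all $x\in X$ and $0<R<\operatorname{diam}(X)/A_2$, $$\inf\{\mathcal E_p(u) : u\in\mathcal F_p,\ u=1\ m\text{-a.e. on }B(x,R),\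 u=0\ m\text{-a.e. on }X\setminus B(x,A_1R)\}\le C_{\mathrm{cap}}\frac{m(B(x,R))}{R^{p\theta_p}}\qquad(\inf\emptyset=\infty).$$ Then there exists $C\in[1,\infty)$ such that for every open $\Omega\subsetneq X$ with property (E) and every $u\in\mathcal F_p(\Omega)$, $$C^{-1}\Gamma_p\langle u\rangle(\Omega)\le\liminf_{\theta\uparrow\theta_p}I_\theta(u)\le\limsup_{\theta\uparrow\theta_p}I_\theta(u)\le C\,\Gamma_p\langle u\rangle(\Omega),$$ where $$I_\theta(u)=(\theta_p-\theta)\int_\Omega\int_\Omega\frac{|u(x)-u(y)|^p}{d(x,y)^{p\theta}\,m(B(y,d(x,y)))}\,m(dx)\,m(dy)\in[0,\infty],$$ the integrand being read as $0$ for $x=y$. -/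

import Mathlib

open MeasureTheory Filter Topology Set
open scoped ENNReal NNReal

noncomputable section

/-- For an exponent `1 < p < ∞`, also `1 ≤ p` as an extended nonnegative real, so that Mathlib's
`Lp` carries its norm. -/
instance fact_one_le_ofReal {p : ℝ} [hp : Fact (1 < p)] : Fact (1 ≤ ENNReal.ofReal p) :=
  ⟨by rw [← ENNReal.ofReal_one]; exact ENNReal.ofReal_le_ofReal hp.out.le⟩

/-- `E` is a `p`-energy form on the linear space `V`: `E ≥ 0` and `E ^ (1/p)` is a seminorm. -/
def IsPEnergyForm (p : ℝ) {V : Type*} [AddCommGroup V] [Module ℝ V] (E : V → ℝ) : Prop :=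
  (∀ u, 0 ≤ E u) ∧ ∃ N : Seminorm ℝ V, ∀ u, N u = E u ^ (1 / p)

/-- A `p`-energy form `(𝓔, 𝓕)` on `(X, m)` with `𝓕 ⊆ L^p(X, m)`. -/
structure PEnergyForm {X : Type*} [MeasurableSpace X] (m : Measure X) (p : ℝ) where
  /-- the domain `𝓕` -/
  dom : Submodule ℝ (Lp ℝ (ENNReal.ofReal p) m)
  /-- the energy `𝓔 : 𝓕 → [0, ∞)` -/
  energy : dom → ℝ
  isPEnergyForm : IsPEnergyForm p energy

namespace PEnergyForm

variable {X : Type*} [MeasurableSpace X] {m : Measure X} {p : ℝ}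

/-- The domain `𝓕`, as a type of its own that is going to carry the norm
`‖u‖_{L^p} + 𝓔(u)^{1/p}` (and not the norm of `L^p`). -/
def Space (E : PEnergyForm m p) : Type _ := E.dom

instance (E : PEnergyForm m p) : AddCommGroup E.Space :=
  inferInstanceAs (AddCommGroup E.dom)

instance (E : PEnergyForm m p) : Module ℝ E.Space :=
  inferInstanceAs (Module ℝ E.dom)

/-- The underlying element of `L^p`. -/
def Space.toLp {E : PEnergyForm m p} (u : E.Space) : Lp ℝ (ENNReal.ofReal p) m :=
  Subtype.val (p := fun f => f ∈ E.dom) u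

/-- The energy of an element of the domain. -/
def Space.en {E : PEnergyForm m p} (u : E.Space) : ℝ := E.energy u

instance (E : PEnergyForm m p) : Norm E.Space :=
  ⟨fun u => ‖u.toLp‖ + u.en ^ (1 / p)⟩

theorem Space.norm_def {E : PEnergyForm m p} (u : E.Space) :
    ‖u‖ = ‖u.toLp‖ + u.en ^ (1 / p) := rfl

theorem Space.core [Fact (1 < p)] (E : PEnergyForm m p) : NormedSpace.Core ℝ E.Space := by
  obtain ⟨h0, N, hN⟩ := E.isPEnergyForm
  have key : ∀ u : E.Space, ‖u‖ = ‖u.toLp‖ + N (show E.dom from u) := by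
    intro u
    rw [hN]
    rfl
  refine { norm_nonneg := ?_, norm_smul := ?_, norm_triangle := ?_, norm_eq_zero_iff := ?_ }
  · intro u
    rw [key]
    exact add_nonneg (norm_nonneg _) (apply_nonneg N _)
  · intro c u
    rw [key, key]
    have h1 : (c • u).toLp = c • u.toLp := rfl
    have h2 : N (show E.dom from c • u) = ‖c‖ * N (show E.dom from u) :=
      map_smul_eq_mul N c (show E.dom from u)
    rw [h1, h2, norm_smul]
    ring
  · intro u v
    rw [key, key, key]
    have h1 : (u + v).toLp = u.toLp + v.toLp := rfl
    have h2 : N (show E.dom from u + v) ≤ N (show E.dom from u) + N (show E.dom from v) :=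
      map_add_le_add N (show E.dom from u) (show E.dom from v)
    have h3 := norm_add_le u.toLp v.toLp
    rw [h1]
    linarith
  · intro u
    rw [key]
    constructor
    · intro h
      have h1 : ‖u.toLp‖ = 0 :=
        le_antisymm (by linarith [apply_nonneg N (show E.dom from u)]) (norm_nonneg _)
      exact Subtype.ext (norm_eq_zero.mp h1)
    · rintro rfl
      have h1 : (0 : E.Space).toLp = 0 := rfl
      have h2 : N (show E.dom from (0 : E.Space)) = 0 := map_zero N
      rw [h1, h2]
      simp

instance [Fact (1 < p)] (E : PEnergyForm m p) : NormedAddCommGroup E.Space :=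
  NormedAddCommGroup.ofCore (Space.core E)

instance [Fact (1 < p)] (E : PEnergyForm m p) : NormedSpace ℝ E.Space :=
  NormedSpace.ofCore (Space.core E)

end PEnergyForm

/-- The setting: a `p`-energy form `(𝓔, 𝓕)` on `(X, m)` together with a family of `p`-energy
measures `Γ⟨u⟩`, `u ∈ 𝓕`. -/
structure PEnergyFramework {X : Type*} [MetricSpace X] [MeasurableSpace X]
    (m : Measure X) (p : ℝ) [Fact (1 < p)] extends PEnergyForm m p where
  /-- the `p`-energy measure `Γ⟨u⟩` of `u ∈ 𝓕` -/
  Γ : dom → Measure X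
  isFiniteMeasure_Γ : ∀ u, IsFiniteMeasure (Γ u)
  /-- Lipschitz contraction property -/
  lipschitz_contraction : ∀ (φ : ℝ → ℝ) (hφ : LipschitzWith 1 φ) (h0 : φ 0 = 0) (u : dom),
    ∃ h : hφ.compLp h0 u.1 ∈ dom, energy ⟨_, h⟩ ≤ energy u
  /-- functions of zero energy are constant -/
  const_of_energy_eq_zero : ∀ u : dom, energy u = 0 → ∃ c : ℝ, ∀ᵐ x ∂m, u.1 x = c
  /-- `𝓕` with the norm `‖u‖_{L^p} + 𝓔(u)^{1/p}` is a Banach space -/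
  complete : CompleteSpace toPEnergyForm.Space
  /-- `𝓕` with this norm is reflexive -/
  reflexive : Function.Surjective (NormedSpace.inclusionInDoubleDual ℝ toPEnergyForm.Space)
  /-- `𝓕 ∩ C_c(X)` is dense in `𝓕` -/
  dense_dom : Dense {u : toPEnergyForm.Space |
    ∃ g : X → ℝ, Continuous g ∧ HasCompactSupport g ∧ u.toLp =ᵐ[m] g}
  /-- `𝓕 ∩ C_c(X)` is dense in `C_c(X)` for the uniform norm -/
  dense_Cc : ∀ g : X → ℝ, Continuous g → HasCompactSupport g → ∀ ε > 0,
    ∃ (u : dom) (h : X → ℝ), Continuous h ∧ HasCompactSupport h ∧ u.1 =ᵐ[m] h ∧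
      ∀ x, |g x - h x| < ε
  /-- `u ↦ Γ⟨u⟩(A)` is a `p`-energy form for every Borel set `A` -/
  isPEnergyForm_Γ : ∀ A : Set X, MeasurableSet A → IsPEnergyForm p (fun u => (Γ u).real A)
  /-- `𝓔(u) = Γ⟨u⟩(X)` -/
  energy_eq : ∀ u, energy u = (Γ u).real univ
  /-- strong locality of the energy measures -/
  strongly_local : ∀ (u v : dom) (f g : X → ℝ), Continuous f → HasCompactSupport f →
    Continuous g → HasCompactSupport g → u.1 =ᵐ[m] f → v.1 =ᵐ[m] g →
    ∀ U : Set X, IsOpen U → (∃ c : ℝ, ∀ x ∈ U, f x - g x = c) →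
      (Γ u).restrict U = (Γ v).restrict U

/-- Volume doubling. -/
def VolumeDoubling {X : Type*} [MetricSpace X] [MeasurableSpace X] (m : Measure X) : Prop :=
  ∃ c : ℝ≥0, 1 ≤ c ∧ ∀ (x : X) (r : ℝ), 0 < r →
    m (Metric.ball x (2 * r)) ≤ c * m (Metric.ball x r)

namespace PEnergyFramework

variable {X : Type*} [MetricSpace X] [MeasurableSpace X] {m : Measure X} {p : ℝ} [Fact (1 < p)]

/-- The `(p,p)`-Poincaré inequality with scale function `Ψ`. -/
def Poincare (𝓔 : PEnergyFramework m p) (Ψ : ℝ → ℝ) : Prop :=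
  ∃ C A : ℝ, 0 < C ∧ 1 ≤ A ∧ ∀ (x : X) (r : ℝ), 0 < r → ∀ u : 𝓔.dom,
    ∫⁻ y in Metric.ball x r, ENNReal.ofReal (|u.1 y - ⨍ z in Metric.ball x r, u.1 z ∂m| ^ p) ∂m
      ≤ ENNReal.ofReal (C * Ψ r) * 𝓔.Γ u (Metric.ball x (A * r))

/-- `𝓕(E₁, E₀)`: elements of `𝓕` equal to `1` a.e. on `E₁` and to `0` a.e. on `E₀`. -/
def cutoffs (𝓔 : PEnergyFramework m p) (E₁ E₀ : Set X) : Set 𝓔.dom :=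
  {u | (∀ᵐ x ∂m, x ∈ E₁ → u.1 x = 1) ∧ (∀ᵐ x ∂m, x ∈ E₀ → u.1 x = 0)}

/-- The `p`-capacity upper estimate with scale function `Ψ` (an infimum over the empty set is
`∞`, and the diameter may be `∞`). -/
def CapUpper (𝓔 : PEnergyFramework m p) (Ψ : ℝ → ℝ) : Prop :=
  ∃ C A₁ A₂ : ℝ, 1 < C ∧ 1 < A₁ ∧ 1 < A₂ ∧ ∀ (x : X) (R : ℝ), 0 < R →
    ENNReal.ofReal R < Metric.ediam (univ : Set X) / ENNReal.ofReal A₂ →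
    ⨅ u ∈ 𝓔.cutoffs (Metric.ball x R) (Metric.ball x (A₁ * R))ᶜ, ENNReal.ofReal (𝓔.energy u)
      ≤ ENNReal.ofReal C * (m (Metric.ball x R) / ENNReal.ofReal (Ψ R))

/-- `A` is a relatively compact open subset of the open set `U` (in the topology of `U`, that is,
its closure in `X` is compact and contained in `U`). -/
def RelCompactOpen (U A : Set X) : Prop :=
  IsOpen A ∧ IsCompact (closure A) ∧ closure A ⊆ U

/-- `𝓕_loc(U)`, a set of `m`-equivalence classes of measurable functions on `U`. -/
def Floc (𝓔 : PEnergyFramework m p) (U : Set X) : Set (X →ₘ[m.restrict U] ℝ) :=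
  {u | ∀ A, RelCompactOpen U A → ∃ v : 𝓔.dom, ∀ᵐ x ∂(m.restrict A), u x = v.1 x}

/-- The energy measure `Γ_U⟨u⟩` on `U` of `u ∈ 𝓕_loc(U)`: for `E ⊆ U`, the value `Γ_U⟨u⟩(E)` is the
increasing limit (hence the supremum) of `Γ⟨v⟩(E ∩ A)` as the relatively compact open subset `A` of
`U` exhausts `U`, where `v ∈ 𝓕` agrees with `u` a.e. on `A`; by strong locality `Γ⟨v⟩(E ∩ A)` does
not depend on the choice of `v`. -/
def ΓOn (𝓔 : PEnergyFramework m p) (U : Set X) (u : X →ₘ[m.restrict U] ℝ) (E : Set X) : ℝ≥0∞ :=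
  ⨆ (A : Set X) (v : 𝓔.dom) (_ : RelCompactOpen U A)
    (_ : ∀ᵐ x ∂(m.restrict A), u x = v.1 x), 𝓔.Γ v (E ∩ A)

/-- `𝓕(U)`. -/
def FOn (𝓔 : PEnergyFramework m p) (U : Set X) : Set (X →ₘ[m.restrict U] ℝ) :=
  {u | u ∈ 𝓔.Floc U ∧ (∫⁻ x in U, ENNReal.ofReal (|u x| ^ p) ∂m) + 𝓔.ΓOn U u U < ∞}

/-- The extension property (E) of the open set `Ω ≠ X`. -/
def ExtensionProperty (𝓔 : PEnergyFramework m p) (Ω : Set X) : Prop :=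
  IsOpen Ω ∧ Ω ≠ univ ∧ ∀ f ∈ 𝓔.FOn Ω, ∃ F : 𝓔.dom,
    (∀ᵐ x ∂(m.restrict Ω), f x = F.1 x) ∧ 𝓔.Γ F (frontier Ω) = 0

end PEnergyFramework

/-- `(θ_p - θ) ∫_Ω ∫_Ω |u(x) - u(y)|^p / (d(x,y)^{pθ} m(B(y, d(x,y)))) m(dx) m(dy)`, with values in
`[0, ∞]`; on the diagonal the integrand is `0 / 0 = 0`. -/
def bbmEnergy {X : Type*} [MetricSpace X] [MeasurableSpace X] (m : Measure X) (p θp : ℝ)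
    (Ω : Set X) (u : X → ℝ) (θ : ℝ) : ℝ≥0∞ :=
  ENNReal.ofReal (θp - θ) * ∫⁻ y in Ω, ∫⁻ x in Ω,
    ENNReal.ofReal (|u x - u y| ^ p) /
      (ENNReal.ofReal (dist x y ^ (p * θ)) * m (Metric.ball y (dist x y))) ∂m ∂m

end

/-! Everything passes through the averaged `p`-oscillation of a function at scale `s`
(`pOscillation`), compared on one side with the energy measures and on the other with the double
integral.

From oscillation to energy and back. The Poincaré inequality on balls of radius `2 * s`, integrated
over all centres, bounds the oscillation at scale `s` by `s ^ (p * θp)` times the energy of a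
neighbourhood (`Poincare.pOscillation_le`). Conversely, the capacity bound provides cutoffs on the
balls of an `r`-net, and the resulting discrete convolutions approximate a continuous function at
scale `r` with energy measure controlled by its oscillation (`CapUpper.exists_approximation`).
Poincaré keeps these approximants bounded in energy, so reflexivity gives lower semicontinuity in
the limit: the energy of an open set is at most a constant times the lower limit of its normalized
oscillations over dyadic scales (`Γ_le_of_frequently`).

From oscillation to double integral. Splitting according to the dyadic size of `dist x y`, doubling
makes the double integral with exponent `p * θ` comparable to a sum over dyadic scales `s` of `s ^
(-(p * θ))` times the oscillation. If the oscillations are of order `s ^ (p * θp)`, the small scales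
produce a geometric series of ratio `2 ^ (-η)`, `η = p * (θp - θ)`, whose sum is of order `1 / η`;
the factor `θp - θ` compensates exactly this. Scales bounded below contribute a finite amount, which
that factor kills in the limit.

The upper bound sees the closure of `Ω`, through ever thinner neighbourhoods; property (E) supplies
an extension that does not charge the boundary. The lower bound is applied to each relatively
compact open subset of `Ω`, and needs no extension.

Locality is given only for continuous functions, while cutoffs of small capacity need not be
continuous. `Γ_eq_zero_of_ae_const` extends locality to the whole domain, using only Lipschitz
contractions and lower semicontinuity. -/

noncomputable section

/-! ### Weak limits in reflexive spaces and the energy seminorms -/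

/-- In a reflexive space, a closed convex set contains the limit, in a weaker norm, of each of its
bounded sequences. -/
theorem mem_of_isClosed_of_convex_of_bounded {F G : Type*} [NormedAddCommGroup F] [NormedSpace ℝ F]
    [NormedAddCommGroup G] [NormedSpace ℝ G]
    (hrefl : Function.Surjective (NormedSpace.inclusionInDoubleDual ℝ F))
    (T : F →L[ℝ] G) (hT : Function.Injective T) {S : Set F} (hS : Convex ℝ S) (hc : IsClosed S)
    {u : ℕ → F} {w : F} {K : ℝ} (hu : ∀ n, u n ∈ S) (hb : ∀ n, ‖u n‖ ≤ K)
    (hlim : Tendsto (fun n => T (u n)) atTop (𝓝 (T w))) : w ∈ S := by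
  have hU : ((hyperfilter ℕ : Ultrafilter ℕ) : Filter ℕ) ≤ atTop := by
    rw [← Nat.cofinite_eq_atTop]; exact hyperfilter_le_cofinite
  have hex : ∀ l : StrongDual ℝ F, ∃ L ∈ Icc (-(K * ‖l‖)) (K * ‖l‖),
      Tendsto (fun n => l (u n)) (hyperfilter ℕ : Filter ℕ) (𝓝 L) := by
    intro l
    have := (isCompact_Icc (a := -(K * ‖l‖)) (b := K * ‖l‖)).ultrafilter_le_nhds
      ((hyperfilter ℕ).map (fun n => l (u n))) (by
        rw [le_principal_iff]
        refine Filter.mem_map.mpr (Filter.Eventually.of_forall fun n => ?_)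
        have h1 := l.le_opNorm (u n)
        have h2 : ‖l‖ * ‖u n‖ ≤ K * ‖l‖ := by
          rw [mul_comm]; exact mul_le_mul_of_nonneg_right (hb n) (norm_nonneg _)
        exact abs_le.mp (h1.trans h2))
    simpa [Tendsto] using this
  -- Limits along an ultrafilter exist for all functionals at once and depend linearly on them, so
  -- no subsequence is extracted. They form a bounded element of the bidual, which reflexivity turns
  -- into a weak limit `z`; testing with functionals pulled back through `T` gives `z = w`.
  choose Λ hΛ hlimΛ using hex
  let Φ : StrongDual ℝ F →ₗ[ℝ] ℝ :=
    { toFun := Λ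
      map_add' := fun a b => tendsto_nhds_unique (hlimΛ (a + b)) (by
        simpa using (hlimΛ a).add (hlimΛ b))
      map_smul' := fun c a => tendsto_nhds_unique (hlimΛ (c • a)) (by
        simpa using (hlimΛ a).const_mul c) }
  obtain ⟨z, hz⟩ := hrefl (Φ.mkContinuous K fun l => abs_le.mpr (hΛ l))
  have hz' : ∀ l : StrongDual ℝ F, Λ l = l z := fun l => by
    rw [← NormedSpace.dual_def, hz]; rfl
  have hzw : z = w := by
    apply hT
    rw [SeparatingDual.eq_iff_forall_dual_eq (R := ℝ)]
    intro g
    have h1 := hlimΛ (g.comp T)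
    rw [hz'] at h1
    exact tendsto_nhds_unique h1 ((g.continuous.tendsto _).comp (hlim.mono_left hU))
  -- Mazur's argument: a hyperplane separating `w` from `S` would contradict convergence of its
  -- functional along the ultrafilter.
  by_contra hw
  obtain ⟨l, s, hl1, hl2⟩ := geometric_hahn_banach_point_closed hS hc hw
  have h1 := hlimΛ l
  rw [hz', hzw] at h1
  exact absurd (ge_of_tendsto' h1 fun n => (hl2 _ (hu n)).le) (not_le.mpr hl1)

theorem Real.rpow_one_div_rpow {a p : ℝ} (ha : 0 ≤ a) (hp : 1 < p) :
    (a ^ (1 / p)) ^ p = a := by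
  rw [← Real.rpow_mul ha, one_div_mul_cancel (by linarith), Real.rpow_one]

namespace PEnergyFramework

variable {X : Type*} [MetricSpace X] [MeasurableSpace X] {m : Measure X} {p : ℝ} [Fact (1 < p)]
  (𝓔 : PEnergyFramework m p)

theorem exponent_gt_one (p : ℝ) [h : Fact (1 < p)] : 1 < p := h.out

/-- The seminorm `u ↦ Γ⟨u⟩(A)^{1/p}`. -/
def gammaSeminorm {A : Set X} (hA : MeasurableSet A) : Seminorm ℝ 𝓔.dom :=
  (𝓔.isPEnergyForm_Γ A hA).2.choose

theorem gammaSeminorm_apply {A : Set X} (hA : MeasurableSet A) (u : 𝓔.dom) :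
    𝓔.gammaSeminorm hA u = (𝓔.Γ u).real A ^ (1 / p) :=
  (𝓔.isPEnergyForm_Γ A hA).2.choose_spec u

instance (u : 𝓔.dom) : IsFiniteMeasure (𝓔.Γ u) := 𝓔.isFiniteMeasure_Γ u

theorem real_Γ_eq {A : Set X} (hA : MeasurableSet A) (u : 𝓔.dom) :
    (𝓔.Γ u).real A = 𝓔.gammaSeminorm hA u ^ p := by
  rw [gammaSeminorm_apply, Real.rpow_one_div_rpow measureReal_nonneg (exponent_gt_one p)]

theorem Γ_eq {A : Set X} (hA : MeasurableSet A) (u : 𝓔.dom) :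
    𝓔.Γ u A = ENNReal.ofReal (𝓔.gammaSeminorm hA u ^ p) := by
  rw [← real_Γ_eq, ofReal_measureReal]

theorem gammaSeminorm_mono {A B : Set X} (hA : MeasurableSet A) (hB : MeasurableSet B)
    (h : A ⊆ B) (u : 𝓔.dom) : 𝓔.gammaSeminorm hA u ≤ 𝓔.gammaSeminorm hB u := by
  have := exponent_gt_one p
  rw [gammaSeminorm_apply, gammaSeminorm_apply]
  exact Real.rpow_le_rpow measureReal_nonneg (measureReal_mono h) (by positivity)

theorem gammaSeminorm_eq_zero_iff {A : Set X} (hA : MeasurableSet A) (u : 𝓔.dom) :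
    𝓔.gammaSeminorm hA u = 0 ↔ 𝓔.Γ u A = 0 := by
  have := exponent_gt_one p
  rw [gammaSeminorm_apply, Real.rpow_eq_zero measureReal_nonneg (by positivity),
    measureReal_eq_zero_iff]

theorem gammaSeminorm_univ (u : 𝓔.dom) :
    𝓔.gammaSeminorm MeasurableSet.univ u = 𝓔.energy u ^ (1 / p) := by
  rw [energy_eq, gammaSeminorm_apply]

/-- The inclusion of the Banach space `𝓕` in `L^p`. -/
def inclusion : 𝓔.toPEnergyForm.Space →L[ℝ] Lp ℝ (ENNReal.ofReal p) m :=
  LinearMap.mkContinuous (⟨⟨fun u => u.toLp, fun _ _ => rfl⟩, fun _ _ => rfl⟩) 1 (fun u => by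
    rw [one_mul, PEnergyForm.Space.norm_def]
    exact le_add_of_nonneg_right (Real.rpow_nonneg (𝓔.isPEnergyForm.1 u) _))

theorem space_norm_eq (u : 𝓔.toPEnergyForm.Space) :
    ‖u‖ = ‖u.toLp‖ + 𝓔.gammaSeminorm MeasurableSet.univ (show 𝓔.dom from u) := by
  rw [gammaSeminorm_univ]; rfl

/-- Lower semicontinuity of the energy measures along energy bounded sequences converging in
`L^p`. -/
theorem gammaSeminorm_le_of_tendsto {A : Set X} (hA : MeasurableSet A) {u : ℕ → 𝓔.dom} {w : 𝓔.dom}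
    {K c : ℝ} (hK : ∀ n, 𝓔.gammaSeminorm MeasurableSet.univ (u n) ≤ K)
    (hlim : Tendsto (fun n => (u n).1) atTop (𝓝 w.1)) (hc : ∀ n, 𝓔.gammaSeminorm hA (u n) ≤ c) :
    𝓔.gammaSeminorm hA w ≤ c := by
  obtain ⟨L, hL⟩ := hlim.norm.bddAbove_range
  let N : Seminorm ℝ 𝓔.toPEnergyForm.Space := 𝓔.gammaSeminorm hA
  have hN : ∀ v : 𝓔.toPEnergyForm.Space, N v ≤ ‖v‖ := fun v => by
    rw [space_norm_eq]
    exact (𝓔.gammaSeminorm_mono hA .univ (subset_univ _) _).trans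
      (le_add_of_nonneg_left (norm_nonneg _))
  have hNc : Continuous N := by
    refine Seminorm.continuous_of_le (q := normSeminorm ℝ _) ?_ hN
    exact continuous_norm
  refine mem_of_isClosed_of_convex_of_bounded (F := 𝓔.toPEnergyForm.Space)
    𝓔.reflexive 𝓔.inclusion Subtype.val_injective (S := {v | N v ≤ c}) (K := L + K)
    (by simpa [Seminorm.closedBall] using N.convex_closedBall 0 c) (isClosed_le hNc continuous_const)
    (u := u) (w := w) hc (fun n => ?_) hlim
  exact (𝓔.space_norm_eq (u n)).le.trans (add_le_add (hL ⟨n, rfl⟩) (hK n))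

/-- The image of an element of the domain under a `1`-Lipschitz function. -/
def lip {φ : ℝ → ℝ} (hφ : LipschitzWith 1 φ) (h0 : φ 0 = 0) (u : 𝓔.dom) : 𝓔.dom :=
  ⟨hφ.compLp h0 u.1, (𝓔.lipschitz_contraction φ hφ h0 u).choose⟩

theorem lip_ae {φ : ℝ → ℝ} (hφ : LipschitzWith 1 φ) (h0 : φ 0 = 0) (u : 𝓔.dom) :
    ∀ᵐ x ∂m, (𝓔.lip hφ h0 u).1 x = φ (u.1 x) :=
  hφ.coeFn_compLp h0 u.1

theorem gammaSeminorm_lip_le {φ : ℝ → ℝ} (hφ : LipschitzWith 1 φ) (h0 : φ 0 = 0) (u : 𝓔.dom) :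
    𝓔.gammaSeminorm MeasurableSet.univ (𝓔.lip hφ h0 u) ≤ 𝓔.gammaSeminorm MeasurableSet.univ u := by
  have := exponent_gt_one p
  rw [gammaSeminorm_univ, gammaSeminorm_univ]
  exact Real.rpow_le_rpow (𝓔.isPEnergyForm.1 _) (𝓔.lipschitz_contraction φ hφ h0 u).choose_spec
    (by positivity)

theorem norm_lip_sub_le {φ : ℝ → ℝ} (hφ : LipschitzWith 1 φ) (h0 : φ 0 = 0) (u v : 𝓔.dom) :
    ‖(𝓔.lip hφ h0 u).1 - (𝓔.lip hφ h0 v).1‖ ≤ ‖u.1 - v.1‖ := by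
  have := hφ.norm_compLp_sub_le h0 u.1 v.1
  rwa [NNReal.coe_one, one_mul] at this

theorem add_ae (u v : 𝓔.dom) : ∀ᵐ x ∂m, (u + v).1 x = u.1 x + v.1 x := Lp.coeFn_add u.1 v.1

theorem sub_ae (u v : 𝓔.dom) : ∀ᵐ x ∂m, (u - v).1 x = u.1 x - v.1 x := Lp.coeFn_sub u.1 v.1

theorem neg_ae (u : 𝓔.dom) : ∀ᵐ x ∂m, (-u).1 x = -u.1 x := Lp.coeFn_neg u.1

theorem smul_ae (c : ℝ) (u : 𝓔.dom) : ∀ᵐ x ∂m, (c • u).1 x = c * u.1 x := Lp.coeFn_smul c u.1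

theorem zero_ae : ∀ᵐ x ∂m, (0 : 𝓔.dom).1 x = 0 := Lp.coeFn_zero ℝ _ m

theorem sum_ae {ι : Type*} (s : Finset ι) (u : ι → 𝓔.dom) :
    ∀ᵐ x ∂m, (∑ i ∈ s, u i).1 x = ∑ i ∈ s, (u i).1 x := by
  classical
  induction s using Finset.induction_on with
  | empty => simpa using 𝓔.zero_ae
  | insert a s ha ih =>
    filter_upwards [ih, 𝓔.add_ae (u a) (∑ i ∈ s, u i)] with x h1 h2
    rw [Finset.sum_insert ha, Finset.sum_insert ha, h2, h1]

theorem ext_ae {u v : 𝓔.dom} (h : ∀ᵐ x ∂m, u.1 x = v.1 x) : u = v := Subtype.ext (Lp.ext h)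

end PEnergyFramework

theorem lipschitzWith_max_sub_zero (M : ℝ) : LipschitzWith 1 fun t : ℝ => max (t - M) 0 := by
  have h : LipschitzWith 1 fun t : ℝ => t - M :=
    LipschitzWith.of_dist_le_mul fun x y => by simp [Real.dist_eq]
  exact h.max_const 0

theorem lipschitzWith_clamp (M a b : ℝ) : LipschitzWith 1 fun t : ℝ => max (min (t - M) a) b := by
  have h : LipschitzWith 1 fun t : ℝ => t - M :=
    LipschitzWith.of_dist_le_mul fun x y => by simp [Real.dist_eq]
  exact (h.min_const a).max_const b

/-! ### Cutoffs and strong locality beyond continuous functions -/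

namespace PEnergyFramework

variable {X : Type*} [MetricSpace X] [MeasurableSpace X] {m : Measure X} {p : ℝ} [Fact (1 < p)]
  (𝓔 : PEnergyFramework m p)

theorem exists_seq_continuous (w : 𝓔.dom) : ∃ (u : ℕ → 𝓔.dom) (f : ℕ → X → ℝ),
    (∀ n, Continuous (f n) ∧ HasCompactSupport (f n) ∧ (u n).1 =ᵐ[m] f n) ∧
    Tendsto (fun n => ‖(u n).1 - w.1‖) atTop (𝓝 0) ∧
    Tendsto (fun n => 𝓔.gammaSeminorm MeasurableSet.univ (u n - w)) atTop (𝓝 0) := by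
  obtain ⟨u, hu, hlim⟩ := mem_closure_iff_seq_limit.mp (𝓔.dense_dom w)
  choose f hf using hu
  have h0 := tendsto_iff_norm_sub_tendsto_zero.mp hlim
  refine ⟨fun n => (show 𝓔.dom from u n), f, hf, squeeze_zero (fun _ => norm_nonneg _) (fun n => ?_) h0,
    squeeze_zero (fun _ => apply_nonneg _ _) (fun n => ?_) h0⟩
  · refine le_trans ?_ (𝓔.space_norm_eq ((show 𝓔.dom from u n) - w)).ge
    exact le_add_of_nonneg_right (apply_nonneg _ _)
  · refine le_trans ?_ (𝓔.space_norm_eq ((show 𝓔.dom from u n) - w)).ge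
    exact le_add_of_nonneg_left (norm_nonneg _)

theorem bddAbove_gammaSeminorm {u : ℕ → 𝓔.dom} {w : 𝓔.dom}
    (h : Tendsto (fun n => 𝓔.gammaSeminorm MeasurableSet.univ (u n - w)) atTop (𝓝 0)) :
    ∃ K, ∀ n, 𝓔.gammaSeminorm MeasurableSet.univ (u n) ≤ K := by
  obtain ⟨K, hK⟩ := h.bddAbove_range
  refine ⟨K + 𝓔.gammaSeminorm MeasurableSet.univ w, fun n => ?_⟩
  have h1 := map_add_le_add (𝓔.gammaSeminorm MeasurableSet.univ) (u n - w) w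
  rw [sub_add_cancel] at h1
  exact h1.trans (add_le_add (hK ⟨n, rfl⟩) le_rfl)

/-- A Urysohn function is approximated within `1/4` by an `h` in the domain, and `2 * h - 1/2` is
clamped to the unit interval. On `K` this quantity is at least `2 * (3/4) - 1/2 = 1`, off `U` at
most `2 * (1/4) - 1/2 = 0`, so the approximate values become exact. -/
theorem exists_continuous_cutoff [LocallyCompactSpace X] {K U : Set X}
    (hK : IsCompact K) (hU : IsOpen U) (hKU : K ⊆ U) :
    ∃ (u : 𝓔.dom) (f : X → ℝ), Continuous f ∧ HasCompactSupport f ∧ u.1 =ᵐ[m] f ∧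
      (∀ x ∈ K, f x = 1) ∧ (∀ x ∉ U, f x = 0) ∧ ∀ x, f x ∈ Icc (0 : ℝ) 1 := by
  obtain ⟨b, hb1, hb0, hbc, hb⟩ := exists_continuous_one_zero_of_isCompact hK hU.isClosed_compl
    (disjoint_compl_right_iff_subset.mpr hKU)
  obtain ⟨u, h, hh, hhc, hu, hbh⟩ := 𝓔.dense_Cc b b.continuous hbc (1 / 4) (by norm_num)
  have hφ := lipschitzWith_clamp (1 / 2) 1 0
  refine ⟨𝓔.lip hφ (by norm_num) ((2 : ℝ) • u), fun x => max (min (2 * h x - 1 / 2) 1) 0,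
    by fun_prop, ?_, ?_, ?_, ?_, ?_⟩
  · exact hhc.comp_left (g := fun t : ℝ => max (min (2 * t - 1 / 2) 1) 0) (by norm_num)
  · filter_upwards [𝓔.lip_ae hφ (by norm_num) ((2 : ℝ) • u), 𝓔.smul_ae 2 u, hu] with x h1 h2 h3
    rw [h1, h2, h3]
  · intro x hx
    have h1 := abs_lt.mp (hbh x)
    have h2 : b x = 1 := hb1 hx
    change max (min (2 * h x - 1 / 2) 1) 0 = 1
    rw [min_eq_right (by linarith)]
    norm_num
  · intro x hx
    have h1 := abs_lt.mp (hbh x)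
    have h2 : b x = 0 := hb0 hx
    exact max_eq_right ((min_le_left _ _).trans (by linarith))
  · intro x
    exact ⟨le_max_right _ _, max_le (min_le_right _ _) zero_le_one⟩

theorem gammaSeminorm_le_of_le_of_tendsto {A : Set X} (hA : MeasurableSet A) {u : ℕ → 𝓔.dom}
    {w : 𝓔.dom} {K c : ℝ} (hK : ∀ n, 𝓔.gammaSeminorm MeasurableSet.univ (u n) ≤ K)
    (hlim : Tendsto (fun n => ‖(u n).1 - w.1‖) atTop (𝓝 0))
    (hc : ∀ n, 𝓔.gammaSeminorm hA (u n) ≤ c) : 𝓔.gammaSeminorm hA w ≤ c :=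
  𝓔.gammaSeminorm_le_of_tendsto hA hK (tendsto_iff_norm_sub_tendsto_zero.mpr hlim) hc

variable [BorelSpace X]

theorem Γ_eq_zero_of_continuous {u : 𝓔.dom} {f : X → ℝ} (hf : Continuous f)
    (hfc : HasCompactSupport f) (hu : u.1 =ᵐ[m] f) {U : Set X} (hU : IsOpen U) {c : ℝ}
    (hc : ∀ x ∈ U, f x = c) : 𝓔.Γ u U = 0 := by
  have h1 := 𝓔.strongly_local u 0 f 0 hf hfc continuous_const HasCompactSupport.zero hu 𝓔.zero_ae U
    hU ⟨c, fun x hx => by simpa using hc x hx⟩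
  have h2 := congrArg (fun μ : Measure X => μ U) h1
  simp only [Measure.restrict_apply_self] at h2
  rw [h2, ← 𝓔.gammaSeminorm_eq_zero_iff hU.measurableSet, map_zero]

/-- Continuous approximants of `w` need not vanish anywhere in `U`, so they are corrected by a
nonlinear map `G` built from sums and Lipschitz images alone. With a cutoff `f` equal to `1` on a
compact `K ⊆ U` and to `0` off `U`, `G` sends `z` to `z - (z + M f - M)⁺ + (-z + M f - M)⁺`. On `K`
this is `z - z⁺ + z⁻ = 0` for every `z`, whereas `G w = w` because `w` vanishes on `U` and is
bounded by `M` elsewhere. Locality applies to the images of the approximants, and lower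
semicontinuity carries the conclusion to `w`. -/
theorem Γ_eq_zero_of_bounded [LocallyCompactSpace X] [SecondCountableTopology X] {w : 𝓔.dom}
    {U : Set X} (hU : IsOpen U) {M : ℝ} (hM0 : 0 ≤ M) (hM : ∀ᵐ x ∂m, |w.1 x| ≤ M)
    (hw : ∀ᵐ x ∂m, x ∈ U → w.1 x = 0) : 𝓔.Γ w U = 0 := by
  apply measure_null_of_locally_null
  intro x hx
  obtain ⟨K, hKc, hxK, hKU⟩ := exists_compact_subset hU hx
  refine ⟨interior K, mem_nhdsWithin_of_mem_nhds (isOpen_interior.mem_nhds hxK), ?_⟩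
  obtain ⟨v, f, hf, hfc, hv, hf1, hf0, hf01⟩ := 𝓔.exists_continuous_cutoff hKc hU hKU
  obtain ⟨u, g, hg, hlim, hlimE⟩ := 𝓔.exists_seq_continuous w
  obtain ⟨B, hB⟩ := 𝓔.bddAbove_gammaSeminorm hlimE
  have hφ := lipschitzWith_max_sub_zero M
  have hφ0 : max ((0 : ℝ) - M) 0 = 0 := max_eq_right (by linarith)
  let G : 𝓔.dom → 𝓔.dom := fun z => z - 𝓔.lip hφ hφ0 (z + M • v) + 𝓔.lip hφ hφ0 (-z + M • v)
  have hG : ∀ z, ∀ᵐ x ∂m, (G z).1 x =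
      z.1 x - max (z.1 x + M * f x - M) 0 + max (-z.1 x + M * f x - M) 0 := by
    intro z
    filter_upwards [𝓔.add_ae (z - 𝓔.lip hφ hφ0 (z + M • v)) (𝓔.lip hφ hφ0 (-z + M • v)),
      𝓔.sub_ae z (𝓔.lip hφ hφ0 (z + M • v)), 𝓔.lip_ae hφ hφ0 (z + M • v),
      𝓔.lip_ae hφ hφ0 (-z + M • v), 𝓔.add_ae z (M • v), 𝓔.add_ae (-z) (M • v), 𝓔.neg_ae z,
      𝓔.smul_ae M v, hv] with x h1 h2 h3 h4 h5 h6 h7 h8 h9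
    rw [h1, h2, h3, h4, h5, h6, h7, h8, h9]
  have hGw : G w = w := by
    refine 𝓔.ext_ae ?_
    filter_upwards [hG w, hM, hw] with x h1 h2 h3
    rw [h1]
    have h4 := abs_le.mp h2
    by_cases hxU : x ∈ U
    · rw [h3 hxU]; simp
    · rw [hf0 x hxU, max_eq_right (by linarith), max_eq_right (by linarith)]; ring
  have key : 𝓔.gammaSeminorm (isOpen_interior (s := K)).measurableSet (G w) ≤ 0 := by
    refine 𝓔.gammaSeminorm_le_of_le_of_tendsto _ (u := fun n => G (u n)) (K := B + (B + M *
      𝓔.gammaSeminorm MeasurableSet.univ v) + (B + M * 𝓔.gammaSeminorm MeasurableSet.univ v))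
      (fun n => ?_) ?_ (fun n => ?_)
    · have hMv : 𝓔.gammaSeminorm MeasurableSet.univ (M • v) =
          M * 𝓔.gammaSeminorm MeasurableSet.univ v := by
        rw [map_smul_eq_mul, Real.norm_of_nonneg hM0]
      refine (map_add_le_add _ _ _).trans (add_le_add ((map_sub_le_add _ _ _).trans
        (add_le_add (hB n) ?_)) ?_)
      · refine (𝓔.gammaSeminorm_lip_le _ _ _).trans ((map_add_le_add _ _ _).trans ?_)
        exact add_le_add (hB n) hMv.le
      · refine (𝓔.gammaSeminorm_lip_le _ _ _).trans ((map_add_le_add _ _ _).trans ?_)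
        rw [map_neg_eq_map]
        exact add_le_add (hB n) hMv.le
    -- `G` is 3-Lipschitz in `L^p`: the identity and each of the two truncations contribute one.
    · have h3 : Tendsto (fun n => 3 * ‖(u n).1 - w.1‖) atTop (𝓝 0) := by
        simpa using hlim.const_mul 3
      refine squeeze_zero (fun _ => norm_nonneg _) (fun n => ?_) h3
      have e1 := 𝓔.norm_lip_sub_le hφ hφ0 (u n + M • v) (w + M • v)
      have e2 := 𝓔.norm_lip_sub_le hφ hφ0 (-u n + M • v) (-w + M • v)
      have e3 : (u n + M • v).1 - (w + M • v).1 = (u n).1 - w.1 := by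
        simp only [Submodule.coe_add]; abel
      have e4 : (-u n + M • v).1 - (-w + M • v).1 = -((u n).1 - w.1) := by
        simp only [Submodule.coe_add, Submodule.coe_neg]; abel
      rw [e3] at e1
      rw [e4, norm_neg] at e2
      have e5 : (G (u n)).1 - (G w).1 = ((u n).1 - w.1) -
          ((𝓔.lip hφ hφ0 (u n + M • v)).1 - (𝓔.lip hφ hφ0 (w + M • v)).1) +
          ((𝓔.lip hφ hφ0 (-u n + M • v)).1 - (𝓔.lip hφ hφ0 (-w + M • v)).1) := by
        simp only [G, Submodule.coe_add, Submodule.coe_sub]; abel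
      rw [e5]
      refine (norm_add_le _ _).trans ((add_le_add (norm_sub_le _ _) le_rfl).trans ?_)
      linarith
    · refine le_of_eq ((𝓔.gammaSeminorm_eq_zero_iff _ _).mpr ?_)
      obtain ⟨hgc, hgs, hug⟩ := hg n
      have hcont : Continuous fun x => g n x - max (g n x + M * f x - M) 0
          + max (-g n x + M * f x - M) 0 := by fun_prop
      refine 𝓔.Γ_eq_zero_of_continuous hcont ?_ ?_ isOpen_interior (c := 0) fun y hy => ?_
      · refine (hgs.comp₂_left hfc
            (m := fun s t : ℝ => s - max (s + M * t - M) 0 + max (-s + M * t - M) 0) ?_)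
        simp [hM0]
      · filter_upwards [hG (u n), hug] with y h1 h2
        rw [h1, h2]
      · rw [hf1 y (interior_subset hy), mul_one, add_sub_cancel_right, add_sub_cancel_right]
        rcases le_total (g n y) 0 with h | h
        · rw [max_eq_right h, max_eq_left (by linarith)]; ring
        · rw [max_eq_left h, max_eq_right (by linarith)]; ring
  rw [hGw] at key
  exact (𝓔.gammaSeminorm_eq_zero_iff (isOpen_interior (s := K)).measurableSet w).mp
    (le_antisymm key (apply_nonneg _ _))

/-- Strong locality of the energy measures on the whole domain. -/
theorem Γ_eq_zero_of_ae_const [LocallyCompactSpace X] [SecondCountableTopology X] {w : 𝓔.dom}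
    {U : Set X} (hU : IsOpen U) {c : ℝ} (hw : ∀ᵐ x ∂m, x ∈ U → w.1 x = c) : 𝓔.Γ w U = 0 := by
  have zero_case : ∀ (w : 𝓔.dom) (U : Set X), IsOpen U → (∀ᵐ x ∂m, x ∈ U → w.1 x = 0) →
      𝓔.Γ w U = 0 := by
    intro w U hU hw
    obtain ⟨u, g, hg, hlim, -⟩ := 𝓔.exists_seq_continuous w
    -- The truncation level for step `n` is a bound of the approximant `u n`. Truncation then fixes
    -- `u n`, and being a contraction in `L^p` it moves `w` by at most twice `‖u n - w‖`.
    have hbd : ∀ n, ∃ M : ℝ, 0 ≤ M ∧ ∀ x, |g n x| ≤ M := by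
      intro n
      obtain ⟨M, hM⟩ := (hg n).1.bounded_above_of_compact_support (hg n).2.1
      exact ⟨|M|, abs_nonneg _, fun x => (hM x).trans (le_abs_self _)⟩
    choose M hM0 hM using hbd
    have hφ := fun n => lipschitzWith_clamp 0 (M n) (-M n)
    have hφ0 : ∀ n, max (min ((0 : ℝ) - 0) (M n)) (-M n) = 0 := fun n => by
      have := hM0 n
      rw [sub_zero, min_eq_left this, max_eq_left (by linarith)]
    refine (𝓔.gammaSeminorm_eq_zero_iff hU.measurableSet w).mp
      (le_antisymm ?_ (apply_nonneg _ _))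
    refine 𝓔.gammaSeminorm_le_of_le_of_tendsto _ (u := fun n => 𝓔.lip (hφ n) (hφ0 n) w)
      (fun n => 𝓔.gammaSeminorm_lip_le _ _ _) ?_ (fun n => ?_)
    · have h2 : Tendsto (fun n => 2 * ‖(u n).1 - w.1‖) atTop (𝓝 0) := by
        simpa using hlim.const_mul 2
      refine squeeze_zero (fun _ => norm_nonneg _) (fun n => ?_) h2
      have e1 : 𝓔.lip (hφ n) (hφ0 n) (u n) = u n := by
        refine 𝓔.ext_ae ?_
        filter_upwards [𝓔.lip_ae (hφ n) (hφ0 n) (u n), (hg n).2.2] with x h1 h2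
        have h3 := abs_le.mp (hM n x)
        rw [h1, h2, sub_zero, min_eq_left h3.2, max_eq_left h3.1]
      have e2 := 𝓔.norm_lip_sub_le (hφ n) (hφ0 n) w (u n)
      rw [e1, norm_sub_rev w.1] at e2
      have e3 := norm_add_le ((𝓔.lip (hφ n) (hφ0 n) w).1 - (u n).1) ((u n).1 - w.1)
      rw [sub_add_sub_cancel] at e3
      linarith
    · refine ((𝓔.gammaSeminorm_eq_zero_iff _ _).mpr
        (𝓔.Γ_eq_zero_of_bounded hU (hM0 n) ?_ ?_)).le
      · filter_upwards [𝓔.lip_ae (hφ n) (hφ0 n) w] with x h1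
        rw [h1, abs_le]
        exact ⟨le_max_right _ _, max_le (min_le_right _ _) (by linarith [hM0 n])⟩
      · filter_upwards [𝓔.lip_ae (hφ n) (hφ0 n) w, hw] with x h1 h2 hx
        rw [h1, h2 hx, hφ0]
  apply measure_null_of_locally_null
  intro x hx
  obtain ⟨K, hKc, hxK, hKU⟩ := exists_compact_subset hU hx
  refine ⟨interior K, mem_nhdsWithin_of_mem_nhds (isOpen_interior.mem_nhds hxK), ?_⟩
  -- A nonzero constant need not belong to the domain; locally it is replaced by `c • v`, with `v` a
  -- cutoff equal to one near the point.
  obtain ⟨v, f, hf, hfc, hv, hf1, -, -⟩ := 𝓔.exists_continuous_cutoff hKc hU hKU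
  have h1 : 𝓔.Γ (w - c • v) (interior K) = 0 := by
    refine zero_case _ _ isOpen_interior ?_
    filter_upwards [hw, 𝓔.sub_ae w (c • v), 𝓔.smul_ae c v, hv] with y h1 h2 h3 h4 hy
    rw [h2, h3, h4, h1 (hKU (interior_subset hy)), hf1 y (interior_subset hy)]; ring
  have h2 : 𝓔.Γ v (interior K) = 0 :=
    𝓔.Γ_eq_zero_of_continuous hf hfc hv isOpen_interior fun y hy => hf1 y (interior_subset hy)
  rw [← 𝓔.gammaSeminorm_eq_zero_iff (isOpen_interior (s := K)).measurableSet] at h1 h2 ⊢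
  refine le_antisymm ?_ (apply_nonneg _ _)
  have h3 := map_add_le_add (𝓔.gammaSeminorm (isOpen_interior (s := K)).measurableSet) (w - c • v) (c • v)
  rwa [sub_add_cancel, h1, map_smul_eq_mul, h2, mul_zero, add_zero] at h3

end PEnergyFramework

/-! ### Volume doubling, the averaging kernel and oscillations -/

theorem ofReal_rpow_abs_sub_le {p : ℝ} (hp : 0 ≤ p) (a b c : ℝ) :
    ENNReal.ofReal (|a - b| ^ p) ≤ ENNReal.ofReal (2 ^ p) *
      (ENNReal.ofReal (|a - c| ^ p) + ENNReal.ofReal (|b - c| ^ p)) := by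
  rw [← ENNReal.ofReal_add (by positivity) (by positivity), ← ENNReal.ofReal_mul (by positivity)]
  refine ENNReal.ofReal_le_ofReal ?_
  have h1 : |a - b| ≤ 2 * max |a - c| |b - c| := by
    have := abs_sub_le a c b
    rw [abs_sub_comm c b] at this
    linarith [le_max_left |a - c| |b - c|, le_max_right |a - c| |b - c|]
  refine (Real.rpow_le_rpow (abs_nonneg _) h1 hp).trans ?_
  rw [Real.mul_rpow (by norm_num) (by positivity)]
  gcongr
  rcases max_cases |a - c| |b - c| with ⟨h, -⟩ | ⟨h, -⟩ <;> rw [h]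
  · exact le_add_of_nonneg_right (by positivity)
  · exact le_add_of_nonneg_left (by positivity)

theorem ENNReal.inv_le_coe_mul_inv {a b : ℝ≥0∞} {C : ℝ≥0} (hC : C ≠ 0) (h : a ≤ C * b) :
    b⁻¹ ≤ C * a⁻¹ := by
  have hC' : (C : ℝ≥0∞) ≠ 0 := by simpa using hC
  rw [← ENNReal.inv_le_inv, ENNReal.mul_inv (Or.inl hC') (Or.inl (by simp))] at h
  rw [mul_comm, ← ENNReal.div_le_iff_le_mul (by simp [hC]) (by simp), ENNReal.div_eq_inv_mul]
  exact h

theorem lintegral_lintegral_sub_le {X : Type*} [MeasurableSpace X] {m : Measure X} {p : ℝ} (hp : 0 ≤ p) {f : X → ℝ} (hf : Measurable f)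
    (B : Set X) (c : ℝ) :
    ∫⁻ y in B, ∫⁻ x in B, ENNReal.ofReal (|f x - f y| ^ p) ∂m ∂m ≤
      ENNReal.ofReal (2 ^ p) * (2 * m B * ∫⁻ x in B, ENNReal.ofReal (|f x - c| ^ p) ∂m) := by
  have hm : Measurable fun x => ENNReal.ofReal (|f x - c| ^ p) := by fun_prop
  calc ∫⁻ y in B, ∫⁻ x in B, ENNReal.ofReal (|f x - f y| ^ p) ∂m ∂m
      ≤ ∫⁻ y in B, ∫⁻ x in B, ENNReal.ofReal (2 ^ p) *
          (ENNReal.ofReal (|f x - c| ^ p) + ENNReal.ofReal (|f y - c| ^ p)) ∂m ∂m :=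
        lintegral_mono fun y => lintegral_mono fun x => ofReal_rpow_abs_sub_le hp _ _ _
    _ = ∫⁻ y in B, ENNReal.ofReal (2 ^ p) * (∫⁻ x in B, ENNReal.ofReal (|f x - c| ^ p) ∂m +
          ENNReal.ofReal (|f y - c| ^ p) * m B) ∂m := by
        congr 1 with y
        rw [lintegral_const_mul _ (by fun_prop), lintegral_add_left hm, setLIntegral_const]
    _ = _ := by
        rw [lintegral_const_mul _ (by fun_prop), lintegral_add_left measurable_const,
          setLIntegral_const, lintegral_mul_const _ hm]
        ring

section Doubling

variable {X : Type*} [MetricSpace X] [MeasurableSpace X] {m : Measure X}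

theorem VolumeDoubling.exists_comparison (hD : VolumeDoubling m) (L : ℝ) :
    ∃ C : ℝ≥0, 1 ≤ C ∧ ∀ (x y : X) (r : ℝ), 0 < r → dist x y ≤ L * r →
      m (Metric.ball x (L * r)) ≤ C * m (Metric.ball y r) := by
  obtain ⟨c, hc, h⟩ := hD
  have hpow : ∀ (n : ℕ) (y : X) (r : ℝ), 0 < r →
      m (Metric.ball y (2 ^ n * r)) ≤ (c ^ n : ℝ≥0) * m (Metric.ball y r) := by
    intro n y r hr
    induction n with
    | zero => simp
    | succ n ih =>
      have h1 := h y (2 ^ n * r) (by positivity)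
      rw [← mul_assoc, ← pow_succ'] at h1
      refine h1.trans ((mul_le_mul_right ih _).trans_eq ?_)
      rw [← mul_assoc, pow_succ' c n, ENNReal.coe_mul]
  -- The factor is `2 * L` because the ball of radius `L * r` at `x` lies in the ball of radius `2 *
  -- L * r` at `y`.
  obtain ⟨n, hn⟩ := pow_unbounded_of_one_lt (2 * L) (one_lt_two)
  refine ⟨c ^ n, one_le_pow₀ hc, fun x y r hr hxy => ?_⟩
  refine (measure_mono (Metric.ball_subset_ball' ?_)).trans (hpow n y r hr)
  nlinarith

variable [IsLocallyFiniteMeasure m]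

theorem VolumeDoubling.measure_ball_lt_top (hD : VolumeDoubling m) (x : X) (r : ℝ) :
    m (Metric.ball x r) < ∞ := by
  obtain ⟨s, hs, hfin⟩ := m.finiteAt_nhds x
  obtain ⟨ε, hε, hb⟩ := Metric.mem_nhds_iff.mp hs
  have h1 : m (Metric.ball x ε) < ∞ := (measure_mono hb).trans_lt hfin
  rcases le_or_gt r 0 with hr | hr
  · simp [Metric.ball_eq_empty.mpr hr]
  obtain ⟨C, -, hC⟩ := hD.exists_comparison (r / ε)
  have h2 := hC x x ε hε (by rw [dist_self]; positivity)
  rw [div_mul_cancel₀ _ hε.ne'] at h2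
  exact h2.trans_lt (ENNReal.mul_lt_top ENNReal.coe_lt_top h1)

end Doubling

section Oscillation

variable {X : Type*} [MetricSpace X] [MeasurableSpace X]

open Classical in
/-- The averaging kernel of the balls of radius `s`. -/
def ballKernel (m : Measure X) (s : ℝ) (x y : X) : ℝ≥0∞ :=
  if dist x y < s then (m (Metric.ball y s))⁻¹ else 0

/-- The averaged `p`-oscillation of `f` at scale `s` in `S`. -/
def pOscillation (m : Measure X) (p s : ℝ) (f : X → ℝ) (S : Set X) : ℝ≥0∞ :=
  ∫⁻ y in S, ∫⁻ x in S, ENNReal.ofReal (|f x - f y| ^ p) * ballKernel m s x y ∂m ∂m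

variable {m : Measure X}

theorem pOscillation_mono {p s : ℝ} {f : X → ℝ} {S T : Set X} (h : S ⊆ T) :
    pOscillation m p s f S ≤ pOscillation m p s f T :=
  (lintegral_mono_set h).trans (lintegral_mono fun _ => lintegral_mono_set h)

theorem pOscillation_congr {p s : ℝ} {f g : X → ℝ} {S : Set X}
    (h : ∀ᵐ x ∂(m.restrict S), f x = g x) : pOscillation m p s f S = pOscillation m p s g S := by
  refine lintegral_congr_ae ?_
  filter_upwards [h] with y hy
  refine lintegral_congr_ae ?_
  filter_upwards [h] with x hx
  rw [hx, hy]

variable [BorelSpace X]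

theorem lintegral_ballKernel_left [m.IsOpenPosMeasure] [IsLocallyFiniteMeasure m]
    (hD : VolumeDoubling m) {s : ℝ} (hs : 0 < s) (y : X) : ∫⁻ x, ballKernel m s x y ∂m = 1 := by
  classical
  have h : (fun x => ballKernel m s x y) =
      (Metric.ball y s).indicator fun _ => (m (Metric.ball y s))⁻¹ := by
    ext x; simp [ballKernel, indicator]
  rw [h, lintegral_indicator_const Metric.isOpen_ball.measurableSet, ENNReal.inv_mul_cancel
    (Metric.measure_ball_pos m y hs).ne' (hD.measure_ball_lt_top y s).ne]

/-- The kernel is normalized by the volume around its second argument, so it is a probability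
density in the first; in the second, doubling makes the volumes around `x` and `y` interchangeable
up to a constant. -/
theorem lintegral_ballKernel_right_le [m.IsOpenPosMeasure] [IsLocallyFiniteMeasure m]
    (hD : VolumeDoubling m) :
    ∃ C : ℝ≥0, ∀ (s : ℝ), 0 < s → ∀ x : X, ∫⁻ y, ballKernel m s x y ∂m ≤ C := by
  classical
  obtain ⟨C, hC1, hC⟩ := hD.exists_comparison 1
  refine ⟨C, fun s hs x => ?_⟩
  have h : ∀ y, ballKernel m s x y ≤
      (Metric.ball x s).indicator (fun _ => C * (m (Metric.ball x s))⁻¹) y := by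
    intro y
    by_cases hxy : dist x y < s
    · have hy : y ∈ Metric.ball x s := by rwa [Metric.mem_ball']
      rw [ballKernel, if_pos hxy, indicator_of_mem hy]
      refine ENNReal.inv_le_coe_mul_inv (zero_lt_one.trans_le hC1).ne' ?_
      simpa using hC x y s hs (by simpa using hxy.le)
    · simp [ballKernel, hxy]
  refine (lintegral_mono h).trans ?_
  rw [lintegral_indicator_const Metric.isOpen_ball.measurableSet, mul_assoc, ENNReal.inv_mul_cancel
    (Metric.measure_ball_pos m x hs).ne' (hD.measure_ball_lt_top x s).ne, mul_one]

variable [SecondCountableTopology X]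

theorem measurable_measure_ball [SFinite m] (s : ℝ) :
    Measurable fun y : X => m (Metric.ball y s) := by
  have h : MeasurableSet {z : X × X | dist z.2 z.1 < s} :=
    (isOpen_lt (by fun_prop) continuous_const).measurableSet
  exact measurable_measure_prodMk_left h

theorem measurable_ballKernel [SFinite m] (s : ℝ) :
    Measurable fun z : X × X => ballKernel m s z.1 z.2 := by
  classical
  have h : MeasurableSet {z : X × X | dist z.1 z.2 < s} :=
    (isOpen_lt (by fun_prop) continuous_const).measurableSet
  exact Measurable.ite h (((measurable_measure_ball s).comp measurable_snd).inv) measurable_const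

theorem measurable_ballKernel_left [SFinite m] (s : ℝ) (y : X) :
    Measurable fun x : X => ballKernel m s x y :=
  (measurable_ballKernel s).comp measurable_prodMk_right

theorem measurable_ballKernel_right [SFinite m] (s : ℝ) (x : X) :
    Measurable fun y : X => ballKernel m s x y :=
  (measurable_ballKernel s).comp measurable_prodMk_left

theorem measurable_pOscillation_integrand [SFinite m] {f : X → ℝ} (hf : Measurable f) (p s : ℝ) :
    Measurable fun z : X × X => ENNReal.ofReal (|f z.1 - f z.2| ^ p) * ballKernel m s z.1 z.2 :=
  Measurable.mul (by fun_prop) (measurable_ballKernel s)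

theorem measurable_inner [SFinite m] {f : X → ℝ} (hf : Measurable f) (p s : ℝ) (S : Set X) :
    Measurable fun y =>
      ∫⁻ x in S, ENNReal.ofReal (|f x - f y| ^ p) * ballKernel m s x y ∂m :=
  (measurable_pOscillation_integrand hf p s).lintegral_prod_left'

/-- A crude bound uniform in the scale, from the two marginals of the kernel; it serves for the
large scales, where the decay comes from the weight alone. -/
theorem pOscillation_le_lintegral [m.IsOpenPosMeasure] [IsLocallyFiniteMeasure m]
    (hD : VolumeDoubling m) {p : ℝ} (hp : 0 ≤ p) :
    ∃ C : ℝ≥0, ∀ s : ℝ, 0 < s → ∀ f : X → ℝ, Measurable f → ∀ S : Set X,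
      pOscillation m p s f S ≤ C * ∫⁻ x in S, ENNReal.ofReal (|f x| ^ p) ∂m := by
  obtain ⟨C, hC⟩ := lintegral_ballKernel_right_le hD
  refine ⟨(2 ^ p : ℝ).toNNReal * (C + 1), fun s hs f hf S => ?_⟩
  have hm : Measurable fun z : X × X => ENNReal.ofReal (|f z.1| ^ p) * ballKernel m s z.1 z.2 :=
    Measurable.mul (by fun_prop) (measurable_ballKernel s)
  have hm' : Measurable fun z : X × X => ENNReal.ofReal (|f z.2| ^ p) * ballKernel m s z.1 z.2 :=
    Measurable.mul (by fun_prop) (measurable_ballKernel s)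
  calc pOscillation m p s f S
      ≤ ∫⁻ y in S, ∫⁻ x in S, ENNReal.ofReal (2 ^ p) *
          (ENNReal.ofReal (|f x| ^ p) * ballKernel m s x y +
            ENNReal.ofReal (|f y| ^ p) * ballKernel m s x y) ∂m ∂m := by
        refine lintegral_mono fun y => lintegral_mono fun x => ?_
        rw [← add_mul, ← mul_assoc]
        gcongr
        simpa using ofReal_rpow_abs_sub_le hp (f x) (f y) 0
    _ = ENNReal.ofReal (2 ^ p) * (∫⁻ y in S, ∫⁻ x in S,
          ENNReal.ofReal (|f x| ^ p) * ballKernel m s x y ∂m ∂m +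
          ∫⁻ y in S, ∫⁻ x in S, ENNReal.ofReal (|f y| ^ p) * ballKernel m s x y ∂m ∂m) := by
        rw [← lintegral_add_left hm.lintegral_prod_left', ← lintegral_const_mul]
        · congr 1 with y
          have h1 : Measurable fun x => ENNReal.ofReal (|f x| ^ p) * ballKernel m s x y :=
            Measurable.mul (by fun_prop) (measurable_ballKernel_left s y)
          have h2 : Measurable fun x => ENNReal.ofReal (|f y| ^ p) * ballKernel m s x y :=
            (measurable_ballKernel_left s y).const_mul _
          rw [← lintegral_add_left h1]
          exact lintegral_const_mul _ (h1.add h2)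
        · exact hm.lintegral_prod_left'.add hm'.lintegral_prod_left'
    _ ≤ ENNReal.ofReal (2 ^ p) * (C * ∫⁻ x in S, ENNReal.ofReal (|f x| ^ p) ∂m +
          ∫⁻ x in S, ENNReal.ofReal (|f x| ^ p) ∂m) := by
        gcongr
        · have h0 : AEMeasurable (Function.uncurry fun y x =>
              ENNReal.ofReal (|f x| ^ p) * ballKernel m s x y)
              ((m.restrict S).prod (m.restrict S)) := (hm.comp measurable_swap).aemeasurable
          rw [lintegral_lintegral_swap h0,
            ← lintegral_const_mul _ (by fun_prop)]
          refine lintegral_mono fun x => ?_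
          rw [lintegral_const_mul _ (measurable_ballKernel_right s x), mul_comm]
          gcongr
          exact (setLIntegral_le_lintegral _ _).trans (hC s hs x)
        · rename_i y
          rw [lintegral_const_mul _ (measurable_ballKernel_left s y)]
          refine (mul_le_mul_right ((setLIntegral_le_lintegral _ _).trans
            (lintegral_ballKernel_left hD hs _).le) _).trans_eq (mul_one _)
    _ = _ := by
        rw [ENNReal.coe_mul, ENNReal.coe_add, ENNReal.coe_one]
        change _ = ENNReal.ofReal (2 ^ p) * _ * _
        ring

end Oscillation

/-! ### The Poincaré inequality bounds oscillations by energy -/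

namespace PEnergyFramework

variable {X : Type*} [MetricSpace X] [MeasurableSpace X] {m : Measure X} {p : ℝ} [Fact (1 < p)]
  {𝓔 : PEnergyFramework m p}

theorem measurable_coe (u : 𝓔.dom) : Measurable (u.1 : X → ℝ) :=
  (Lp.stronglyMeasurable u.1).measurable

/-- An average over all centres `z` replaces a covering by balls. Once a centre within `s` of `y` is
inserted, both `x` and `y` lie in the ball of radius `2 * s` at `z`, where the Poincaré inequality
applies and both kernels are at most a constant over the volume `V z`. What remains is the integral
of `(V z)⁻¹` times the energy of the ball of radius `2 * A * s` at `z`, which Fubini and doubling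
bound by the energy of a neighbourhood. Since `z` is within `s` of `S`, that neighbourhood has width
`(2 * A + 1) * s`. -/
theorem Poincare.pOscillation_le [BorelSpace X] [SecondCountableTopology X] [m.IsOpenPosMeasure]
    [IsLocallyFiniteMeasure m] (hD : VolumeDoubling m) {θ : ℝ}
    (hPI : 𝓔.Poincare fun r => r ^ θ) :
    ∃ (C : ℝ≥0) (L : ℝ), ∀ s : ℝ, 0 < s → ∀ (u : 𝓔.dom) (S : Set X), MeasurableSet S →
      pOscillation m p s u.1 S ≤
        C * ENNReal.ofReal (s ^ θ) * 𝓔.Γ u (Metric.thickening (L * s) S) := by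
  classical
  obtain ⟨CP, A, hCP, hA, hPI⟩ := hPI
  obtain ⟨C₁, hC₁, hD₁⟩ := hD.exists_comparison 2
  obtain ⟨C₂, hC₂, hD₂⟩ := hD.exists_comparison A
  have hp := exponent_gt_one p
  set D : ℝ≥0 := C₁ * C₁ * ((2 ^ p : ℝ).toNNReal * (2 * (CP * 2 ^ θ).toNNReal)) with hDdef
  refine ⟨D * C₂, 2 * A + 1, fun s hs u S hS => ?_⟩
  have hu := measurable_coe u
  set V : X → ℝ≥0∞ := fun z => m (Metric.ball z (2 * s)) with hV
  have hV0 : ∀ z, V z ≠ 0 := fun z => (Metric.measure_ball_pos m z (by positivity)).ne'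
  have hVt : ∀ z, V z ≠ ∞ := fun z => (hD.measure_ball_lt_top z _).ne
  have hVm : Measurable V := measurable_measure_ball _
  set T := Metric.thickening s S with hT
  set w : X → X → ℝ≥0∞ := fun x y => ENNReal.ofReal (|u.1 x - u.1 y| ^ p) with hw
  set G : X → ℝ≥0∞ := fun y => ∫⁻ x in S, w x y * ballKernel m s x y ∂m with hG
  have hGm : Measurable G := measurable_inner hu p s S
  have hk : Measurable fun z : X × X => ballKernel m s z.1 z.2 := measurable_ballKernel s
  have hwm : ∀ y, Measurable fun x => w x y := fun y => by fun_prop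
  have kbound : ∀ z x y, dist z y < s →
      ballKernel m s x y ≤ (Metric.ball z (2 * s)).indicator (fun _ => C₁ * (V z)⁻¹) x := by
    intro z x y hzy
    by_cases hxy : dist x y < s
    · have hx : x ∈ Metric.ball z (2 * s) := by
        rw [Metric.mem_ball]
        have := dist_triangle_right x z y
        linarith
      rw [indicator_of_mem hx, ballKernel, if_pos hxy]
      exact ENNReal.inv_le_coe_mul_inv (zero_lt_one.trans_le hC₁).ne'
        (hD₁ z y s hs (by linarith))
    · rw [ballKernel, if_neg hxy]; exact zero_le
  -- The total mass of the kernel in its first argument is one, so a centre `z` can be inserted for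
  -- free.
  have step1 : pOscillation m p s u.1 S = ∫⁻ z, ∫⁻ y in S, G y * ballKernel m s z y ∂m ∂m := by
    have h1 : pOscillation m p s u.1 S =
        ∫⁻ y in S, ∫⁻ z, G y * ballKernel m s z y ∂m ∂m := by
      refine lintegral_congr fun y => ?_
      rw [lintegral_const_mul _ (measurable_ballKernel_left s y), lintegral_ballKernel_left hD hs, mul_one]
    rw [h1, lintegral_lintegral_swap]
    exact ((hGm.comp measurable_fst).mul (hk.comp measurable_swap)).aemeasurable
  have step2 : ∀ z, ∫⁻ y in S, G y * ballKernel m s z y ∂m ≤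
      D * ENNReal.ofReal (s ^ θ) *
        T.indicator (fun z => (V z)⁻¹ * 𝓔.Γ u (Metric.ball z (A * (2 * s)))) z := by
    intro z
    by_cases hz : z ∈ T
    · set B := Metric.ball z (2 * s) with hB
      have h1 : ∀ y, G y * ballKernel m s z y ≤
          B.indicator (fun y => C₁ * (V z)⁻¹ * (C₁ * (V z)⁻¹) * ∫⁻ x in B, w x y ∂m) y := by
        intro y
        by_cases hzy : dist z y < s
        · have hy : y ∈ B := by
            rw [hB, Metric.mem_ball']; linarith
          rw [indicator_of_mem hy]
          have h2 : G y ≤ C₁ * (V z)⁻¹ * ∫⁻ x in B, w x y ∂m := by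
            calc G y ≤ ∫⁻ x, B.indicator (fun x => C₁ * (V z)⁻¹ * w x y) x ∂m := by
                  refine (setLIntegral_le_lintegral _ _).trans (lintegral_mono fun x => ?_)
                  have h3 := kbound z x y hzy
                  by_cases hx : x ∈ B
                  · rw [indicator_of_mem hx] at h3 ⊢
                    rw [mul_comm]; gcongr
                  · rw [indicator_of_notMem hx] at h3 ⊢
                    rw [nonpos_iff_eq_zero.mp h3, mul_zero]
              _ = _ := by
                  rw [lintegral_indicator Metric.isOpen_ball.measurableSet,
                    lintegral_const_mul _ (hwm y)]
          have h3 : ballKernel m s z y ≤ C₁ * (V z)⁻¹ := by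
            have h4 := kbound z z y hzy
            rwa [indicator_of_mem (Metric.mem_ball_self (by positivity))] at h4
          calc G y * ballKernel m s z y
              ≤ (C₁ * (V z)⁻¹ * ∫⁻ x in B, w x y ∂m) * (C₁ * (V z)⁻¹) := mul_le_mul' h2 h3
            _ = _ := by ring
        · rw [ballKernel, if_neg hzy, mul_zero]; exact zero_le
      have h5 : Measurable fun y => ∫⁻ x in B, w x y ∂m := by
        have h6 : Measurable fun z : X × X => w z.1 z.2 := by fun_prop
        exact h6.lintegral_prod_left'
      calc ∫⁻ y in S, G y * ballKernel m s z y ∂m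
          ≤ ∫⁻ y, B.indicator
              (fun y => C₁ * (V z)⁻¹ * (C₁ * (V z)⁻¹) * ∫⁻ x in B, w x y ∂m) y ∂m :=
            (setLIntegral_le_lintegral _ _).trans (lintegral_mono h1)
        _ = C₁ * (V z)⁻¹ * (C₁ * (V z)⁻¹) * ∫⁻ y in B, ∫⁻ x in B, w x y ∂m ∂m := by
            rw [lintegral_indicator Metric.isOpen_ball.measurableSet, lintegral_const_mul _ h5]
        _ ≤ C₁ * (V z)⁻¹ * (C₁ * (V z)⁻¹) * (ENNReal.ofReal (2 ^ p) * (2 * V z *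
              (ENNReal.ofReal (CP * (2 * s) ^ θ) * 𝓔.Γ u (Metric.ball z (A * (2 * s)))))) := by
            gcongr
            refine (lintegral_lintegral_sub_le (by linarith) hu B
              (⨍ x in B, u.1 x ∂m)).trans ?_
            gcongr
            exact hPI z (2 * s) (by positivity) u
        _ = C₁ * C₁ * (ENNReal.ofReal (2 ^ p) * (2 * ENNReal.ofReal (CP * 2 ^ θ))) *
              ENNReal.ofReal (s ^ θ) * (((V z)⁻¹ * V z) *
                ((V z)⁻¹ * 𝓔.Γ u (Metric.ball z (A * (2 * s))))) := by
            rw [Real.mul_rpow (by norm_num) hs.le, ← mul_assoc CP, ENNReal.ofReal_mul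
              (by positivity : 0 ≤ CP * 2 ^ θ)]
            ring
        _ = _ := by
            rw [indicator_of_mem hz, ENNReal.inv_mul_cancel (hV0 z) (hVt z), one_mul, hDdef]
            push_cast
            rfl
    · rw [indicator_of_notMem hz, mul_zero, nonpos_iff_eq_zero]
      refine setLIntegral_eq_zero hS fun y hy => ?_
      have hzy : ¬ dist z y < s := fun h => hz (Metric.mem_thickening_iff.mpr ⟨y, hy, h⟩)
      simp [ballKernel, hzy]
  have hTm : MeasurableSet T := Metric.isOpen_thickening.measurableSet
  set W := Metric.thickening ((2 * A + 1) * s) S with hW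
  have hWm : MeasurableSet W := Metric.isOpen_thickening.measurableSet
  set R := A * (2 * s) with hR
  let J : X → X → ℝ≥0∞ := fun z v =>
    T.indicator (fun z => (V z)⁻¹) z * {q : X × X | dist q.2 q.1 < R}.indicator 1 (z, v)
  have hJm : Measurable (Function.uncurry J) := by
    refine Measurable.mul ((hVm.inv.indicator hTm).comp measurable_fst) ?_
    refine Measurable.indicator measurable_const ?_
    exact (isOpen_lt (by fun_prop) continuous_const).measurableSet
  have step3 : ∀ z, T.indicator (fun z => (V z)⁻¹ * 𝓔.Γ u (Metric.ball z R)) z =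
      ∫⁻ v, J z v ∂(𝓔.Γ u) := by
    intro z
    have h1 : Measurable fun v => {q : X × X | dist q.2 q.1 < R}.indicator (1 : X × X → ℝ≥0∞)
        (z, v) :=
      (Measurable.indicator measurable_const
        (isOpen_lt (by fun_prop) continuous_const).measurableSet).comp measurable_prodMk_left
    rw [lintegral_const_mul _ h1]
    have h2 : (fun v => {q : X × X | dist q.2 q.1 < R}.indicator (1 : X × X → ℝ≥0∞) (z, v)) =
        (Metric.ball z R).indicator 1 := by
      ext v; simp [indicator, Metric.mem_ball]
    rw [h2, lintegral_indicator_one Metric.isOpen_ball.measurableSet]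
    by_cases hz : z ∈ T <;> simp [hz]
  -- The continuous form of bounded overlap: each `v` is seen by the centres within `R` of it, with
  -- weights of bounded total mass.
  have step4 : ∀ v, ∫⁻ z, J z v ∂m ≤ W.indicator (fun _ => (C₂ : ℝ≥0∞)) v := by
    intro v
    have h1 : ∀ z, J z v ≤ W.indicator (fun _ => (C₂ : ℝ≥0∞)) v *
        (Metric.ball v R).indicator (fun _ => (m (Metric.ball v R))⁻¹) z := by
      intro z
      by_cases hz : z ∈ T
      · by_cases hzv : dist v z < R
        · have hv : v ∈ W := by
            obtain ⟨y, hy, hzy⟩ := Metric.mem_thickening_iff.mp hz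
            refine Metric.mem_thickening_iff.mpr ⟨y, hy, ?_⟩
            have := dist_triangle v z y
            rw [hR] at hzv
            linarith
          have h2 : z ∈ Metric.ball v R := by rwa [Metric.mem_ball']
          rw [indicator_of_mem hv, indicator_of_mem h2]
          simp only [J, indicator_of_mem hz]
          rw [indicator_of_mem (by exact hzv), Pi.one_apply, mul_one]
          exact ENNReal.inv_le_coe_mul_inv (zero_lt_one.trans_le hC₂).ne'
            (hD₂ v z (2 * s) (by positivity) hzv.le)
        · simp [J, hzv]
      · simp [J, hz]
    refine (lintegral_mono h1).trans ?_
    have hR0 : 0 < R := by positivity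
    rw [lintegral_const_mul _ (measurable_const.indicator Metric.isOpen_ball.measurableSet),
      lintegral_indicator_const Metric.isOpen_ball.measurableSet, ENNReal.inv_mul_cancel
      (Metric.measure_ball_pos m v hR0).ne' (hD.measure_ball_lt_top v R).ne, mul_one]
  calc pOscillation m p s u.1 S
      ≤ ∫⁻ z, D * ENNReal.ofReal (s ^ θ) * ∫⁻ v, J z v ∂(𝓔.Γ u) ∂m := by
        rw [step1]
        refine lintegral_mono fun z => ?_
        rw [← step3]
        exact step2 z
    _ = D * ENNReal.ofReal (s ^ θ) * ∫⁻ v, ∫⁻ z, J z v ∂m ∂(𝓔.Γ u) := by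
        have h1 : Measurable fun z => ∫⁻ v, J z v ∂(𝓔.Γ u) := hJm.lintegral_prod_right'
        rw [lintegral_const_mul _ h1, lintegral_lintegral_swap
          hJm.aemeasurable]
    _ ≤ D * ENNReal.ofReal (s ^ θ) * (C₂ * 𝓔.Γ u W) := by
        gcongr
        refine (lintegral_mono step4).trans_eq ?_
        rw [lintegral_indicator_const hWm]
    _ = _ := by push_cast; ring

end PEnergyFramework

/-! ### Packing bounds and finite nets -/

section Nets

variable {X : Type*} [MetricSpace X] [MeasurableSpace X] [BorelSpace X] {m : Measure X}
  [IsLocallyFiniteMeasure m] [m.IsOpenPosMeasure]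

/-- The balls of radius `r / 2` around the points are disjoint, lie in one ball of radius `(L + 1) *
r`, and each carries a fixed fraction of its mass. -/
theorem VolumeDoubling.card_le_of_separated (hD : VolumeDoubling m) {L : ℝ} (hL : 0 ≤ L) :
    ∃ M : ℕ, ∀ (ι : Type) (I : Finset ι) (z : ι → X) (x : X) (r : ℝ), 0 < r →
      (∀ i ∈ I, ∀ j ∈ I, i ≠ j → r ≤ dist (z i) (z j)) → (∀ i ∈ I, dist x (z i) ≤ L * r) →
      I.card ≤ M := by
  obtain ⟨C, -, hC⟩ := hD.exists_comparison (2 * L + 2)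
  refine ⟨⌊C⌋₊, fun ι I z x r hr hsep hdist => ?_⟩
  apply Nat.le_floor
  set B := Metric.ball x ((2 * L + 2) * (r / 2)) with hB
  have hB0 : m B ≠ 0 := (Metric.measure_ball_pos m x (by positivity)).ne'
  have hBt : m B ≠ ∞ := (hD.measure_ball_lt_top _ _).ne
  have hdisj : (I : Set ι).PairwiseDisjoint fun i => Metric.ball (z i) (r / 2) := by
    intro i hi j hj hij
    exact Metric.ball_disjoint_ball (by linarith [hsep i hi j hj hij])
  have h1 : (I.card : ℝ≥0∞) * m B ≤ C * m B := by
    calc (I.card : ℝ≥0∞) * m B = ∑ i ∈ I, m B := by simp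
      _ ≤ ∑ i ∈ I, C * m (Metric.ball (z i) (r / 2)) := by
          refine Finset.sum_le_sum fun i hi => hC x (z i) (r / 2) (by positivity) ?_
          linarith [hdist i hi]
      _ = C * m (⋃ i ∈ I, Metric.ball (z i) (r / 2)) := by
          rw [← Finset.mul_sum, measure_biUnion_finset hdisj
            fun _ _ => Metric.isOpen_ball.measurableSet]
      _ ≤ C * m B := by
          gcongr
          refine iUnion₂_subset fun i hi => Metric.ball_subset_ball' ?_
          rw [dist_comm]
          linarith [hdist i hi]
  have h2 := (ENNReal.mul_le_mul_iff_left hB0 hBt).mp h1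
  exact_mod_cast h2

/-- The packing bound limits the size of separated families in the ball, so one of maximal size
exists; a point it missed could be added to it. The net is indexed by an initial segment of `ℕ`
because the partition of unity depends on an order. -/
theorem VolumeDoubling.exists_net (hD : VolumeDoubling m) (x : X) {R r : ℝ} (hR : 0 ≤ R)
    (hr : 0 < r) : ∃ (n : ℕ) (z : ℕ → X),
      (∀ i < n, ∀ j < n, i ≠ j → r ≤ dist (z i) (z j)) ∧
      ∀ y ∈ Metric.ball x R, ∃ i < n, dist y (z i) < r := by
  obtain ⟨M, hM⟩ := hD.card_le_of_separated (m := m) (L := R / r) (by positivity)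
  let Q : Set ℕ := {n | ∃ z : ℕ → X, (∀ i < n, z i ∈ Metric.ball x R) ∧
    ∀ i < n, ∀ j < n, i ≠ j → r ≤ dist (z i) (z j)}
  have hQ0 : Q.Nonempty := ⟨0, fun _ => x, by simp, by simp⟩
  have hQb : BddAbove Q := by
    refine ⟨M, ?_⟩
    rintro n ⟨z, hz, hsep⟩
    have := hM ℕ (Finset.range n) z x r hr
      (fun i hi j hj => hsep i (Finset.mem_range.mp hi) j (Finset.mem_range.mp hj))
      (fun i hi => by
        rw [div_mul_cancel₀ _ hr.ne']
        exact (Metric.mem_ball'.mp (hz i (Finset.mem_range.mp hi))).le)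
    simpa using this
  obtain ⟨z, hz, hsep⟩ := Nat.sSup_mem hQ0 hQb
  set n := sSup Q
  refine ⟨n, z, hsep, fun y hy => ?_⟩
  by_contra! hcon
  have hlt : n + 1 ∈ Q := by
    refine ⟨fun i => if i < n then z i else y, fun i hi => ?_, fun i hi j hj hij => ?_⟩
    · by_cases h : i < n
      · simpa [h] using hz i h
      · simpa [h] using hy
    · by_cases h : i < n <;> by_cases h' : j < n
      · simpa [h, h'] using hsep i h j h' hij
      · simpa [h, h', dist_comm] using hcon i h
      · simpa [h, h'] using hcon j h'
      · omega
  exact absurd (le_csSup hQb hlt) (by omega)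

end Nets

/-! ### Telescoping partitions of unity -/

/-- The retraction of the line onto the unit interval. -/
def unitClamp (t : ℝ) : ℝ := max (min (t - 0) 1) 0

theorem unitClamp_of_one_le {t : ℝ} (h : 1 ≤ t) : unitClamp t = 1 := by
  rw [unitClamp, sub_zero, min_eq_right h, max_eq_left zero_le_one]

theorem unitClamp_zero : unitClamp 0 = 0 := by norm_num [unitClamp]

theorem unitClamp_mono : Monotone unitClamp := fun a b h => by
  unfold unitClamp; gcongr

theorem lipschitzWith_unitClamp : LipschitzWith 1 unitClamp := lipschitzWith_clamp 0 1 0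

theorem unitClamp_mem (t : ℝ) : unitClamp t ∈ Icc (0 : ℝ) 1 :=
  ⟨le_max_right _ _, max_le (min_le_right _ _) zero_le_one⟩

theorem unitClamp_increment_eq_zero {q : ℕ → ℝ} {i : ℕ} (h : q i = 0) :
    unitClamp (∑ j ∈ Finset.range (i + 1), q j) - unitClamp (∑ j ∈ Finset.range i, q j) = 0 := by
  rw [Finset.sum_range_succ, h, add_zero, sub_self]

/-- Increments of clamped partial sums telescope to one wherever the cutoffs add up to at least one.
Unlike the usual quotients, they need only sums and a Lipschitz contraction, the operations whose
energy is controlled here. -/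
theorem sum_mul_unitClamp_increment {q a : ℕ → ℝ} {n : ℕ} (hq : 1 ≤ ∑ j ∈ Finset.range n, q j)
    (c : ℝ) :
    ∑ i ∈ Finset.range n, a i * (unitClamp (∑ j ∈ Finset.range (i + 1), q j) -
        unitClamp (∑ j ∈ Finset.range i, q j)) =
      ∑ i ∈ Finset.range n, (a i - c) * (unitClamp (∑ j ∈ Finset.range (i + 1), q j) -
        unitClamp (∑ j ∈ Finset.range i, q j)) + c := by
  have h := Finset.sum_range_sub (fun i => unitClamp (∑ j ∈ Finset.range i, q j)) n
  simp only [Finset.range_zero, Finset.sum_empty, unitClamp_zero, unitClamp_of_one_le hq,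
    sub_zero] at h
  have h2 : ∑ i ∈ Finset.range n, c * (unitClamp (∑ j ∈ Finset.range (i + 1), q j) -
        unitClamp (∑ j ∈ Finset.range i, q j)) = c := by rw [← Finset.mul_sum, h, mul_one]
  calc _ = ∑ i ∈ Finset.range n, (a i - c) * (unitClamp (∑ j ∈ Finset.range (i + 1), q j) -
        unitClamp (∑ j ∈ Finset.range i, q j)) + ∑ i ∈ Finset.range n,
        c * (unitClamp (∑ j ∈ Finset.range (i + 1), q j) -
        unitClamp (∑ j ∈ Finset.range i, q j)) := by
        rw [← Finset.sum_add_distrib]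
        exact Finset.sum_congr rfl fun i _ => by ring
    _ = _ := by rw [h2]

/-- Cutoffs vanishing at a point do not affect the partial sums there, so near a given ball the
partition can be rebuilt from the few nearby cutoffs only. This is what makes its energy bound
local. -/
theorem sum_mul_unitClamp_increment_filter {q a : ℕ → ℝ} {n : ℕ} {I : Finset ℕ}
    (hI : I ⊆ Finset.range n) (hqI : ∀ i ∈ Finset.range n, i ∉ I → q i = 0) :
    ∑ i ∈ Finset.range n, a i * (unitClamp (∑ j ∈ Finset.range (i + 1), q j) -
        unitClamp (∑ j ∈ Finset.range i, q j)) =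
      ∑ i ∈ I, a i * (unitClamp (∑ j ∈ Finset.range (i + 1) ∩ I, q j) -
        unitClamp (∑ j ∈ Finset.range i ∩ I, q j)) := by
  have h1 : ∀ k ≤ n, ∑ j ∈ Finset.range k ∩ I, q j = ∑ j ∈ Finset.range k, q j := by
    intro k hk
    refine Finset.sum_subset Finset.inter_subset_left fun j hj hj' => hqI j ?_ fun h => ?_
    · exact Finset.range_mono hk hj
    · exact hj' (Finset.mem_inter.mpr ⟨hj, h⟩)
  rw [← Finset.sum_subset hI]
  · refine Finset.sum_congr rfl fun i hi => ?_
    have := Finset.mem_range.mp (hI hi)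
    rw [h1 _ (by omega), h1 _ (by omega)]
  · intro i hi hi'
    rw [unitClamp_increment_eq_zero (hqI i hi hi'), mul_zero]

section Jensen

variable {X : Type*} [MetricSpace X] [MeasurableSpace X] [BorelSpace X] {m : Measure X}
  [IsFiniteMeasureOnCompacts m]

theorem ofReal_rpow_average_sub_le {p : ℝ} (hp : 1 ≤ p) {f : X → ℝ} (hf : Continuous f)
    (hfc : HasCompactSupport f) {B : Set X} (h0 : m B ≠ 0) (hB : m B ≠ ∞) (c : ℝ) :
    ENNReal.ofReal (|(⨍ x in B, f x ∂m) - c| ^ p) * m B ≤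
      ∫⁻ x in B, ENNReal.ofReal (|f x - c| ^ p) ∂m := by
  have hg : ConvexOn ℝ univ fun t : ℝ => |t - c| ^ p := by
    have h1 : ConvexOn ℝ univ fun t : ℝ => |t - c| := by
      simpa [Real.dist_eq] using convexOn_univ_dist c
    have himg : (fun t : ℝ => |t - c|) '' univ = Ici 0 := by
      ext s
      refine ⟨?_, fun hs => ⟨s + c, mem_univ _, ?_⟩⟩
      · rintro ⟨t, -, rfl⟩; exact abs_nonneg (t - c)
      · simpa using mem_Ici.mp hs
    refine ConvexOn.comp (g := fun t : ℝ => t ^ p) (by rw [himg]; exact convexOn_rpow hp) h1 ?_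
    · rintro _ ⟨s, -, rfl⟩ _ ⟨t, -, rfl⟩ hst
      exact Real.rpow_le_rpow (abs_nonneg _) hst (by linarith)
  have hgc : Continuous fun t : ℝ => |t - c| ^ p :=
    Continuous.rpow_const (by fun_prop) fun _ => Or.inr (by linarith)
  obtain ⟨K, hK⟩ := hf.bounded_above_of_compact_support hfc
  have hint : IntegrableOn (fun x => |f x - c| ^ p) B m := by
    refine Measure.integrableOn_of_bounded hB (hgc.comp hf).aestronglyMeasurable
      (M := (K + ‖c‖) ^ p) (ae_of_all _ fun x => ?_)
    rw [Real.norm_of_nonneg (by positivity)]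
    refine Real.rpow_le_rpow (abs_nonneg _) ((norm_sub_le (f x) c).trans ?_) (by linarith)
    exact add_le_add (hK x) le_rfl
  have h2 := hg.map_set_average_le hgc.continuousOn isClosed_univ h0 hB (ae_of_all _ fun _ =>
    mem_univ _) (hf.integrable_of_hasCompactSupport hfc).integrableOn hint
  have h3 : ENNReal.ofReal (⨍ x in B, |f x - c| ^ p ∂m) * m B =
      ∫⁻ x in B, ENNReal.ofReal (|f x - c| ^ p) ∂m := by
    rw [← ofReal_integral_eq_lintegral_ofReal hint (ae_of_all _ fun x => by positivity),
      setAverage_eq, smul_eq_mul, ← ENNReal.ofReal_toReal hB, ← ENNReal.ofReal_mul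
      (by have := integral_nonneg (μ := m.restrict B) (f := fun x => |f x - c| ^ p)
            fun x => by positivity
          positivity)]
    congr 1
    rw [measureReal_def]
    have : (m B).toReal ≠ 0 := (ENNReal.toReal_pos h0 hB).ne'
    field_simp
  rw [← h3]
  gcongr

end Jensen

theorem Seminorm.sum_le {E ι : Type*} [AddCommGroup E] [Module ℝ E] (N : Seminorm ℝ E)
    (s : Finset ι) (f : ι → E) : N (∑ i ∈ s, f i) ≤ ∑ i ∈ s, N (f i) :=
  Finset.le_sum_of_subadditive N (map_zero N).le (map_add_le_add N) s f

namespace PEnergyFramework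

variable {X : Type*} [MetricSpace X] [MeasurableSpace X] {m : Measure X} {p : ℝ} [Fact (1 < p)]
  {𝓔 : PEnergyFramework m p}

/-- Since the infimum need not be attained, the constant is doubled and a competitor is clamped to
the unit interval. The diameter may be infinite; nontriviality of `X` makes it positive, which
leaves room for a finite `R₀ > 0`. -/
theorem CapUpper.exists_cutoff [Nontrivial X] [IsLocallyFiniteMeasure m] [m.IsOpenPosMeasure]
    (hD : VolumeDoubling m) {θ : ℝ} (hcap : 𝓔.CapUpper fun r => r ^ θ) :
    ∃ (C : ℝ≥0) (A R₀ : ℝ), 1 < A ∧ 0 < R₀ ∧ ∀ (x : X) (r : ℝ), 0 < r → r < R₀ →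
      ∃ ψ : 𝓔.dom, (∀ᵐ y ∂m, 0 ≤ ψ.1 y) ∧ (∀ᵐ y ∂m, y ∈ Metric.ball x r → ψ.1 y = 1) ∧
        (∀ᵐ y ∂m, y ∉ Metric.ball x (A * r) → ψ.1 y = 0) ∧
        𝓔.Γ ψ univ ≤ C * (ENNReal.ofReal (r ^ θ))⁻¹ * m (Metric.ball x r) := by
  obtain ⟨C, A₁, A₂, hC, hA₁, hA₂, hcap⟩ := hcap
  have hdiam : 0 < Metric.ediam (univ : Set X) / ENNReal.ofReal A₂ := by
    refine ENNReal.div_pos ?_ ENNReal.ofReal_ne_top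
    rw [← pos_iff_ne_zero, Metric.ediam_pos_iff]
    exact nontrivial_univ
  obtain ⟨R₀, hR₀, hR₀'⟩ := ENNReal.lt_iff_exists_nnreal_btwn.mp hdiam
  refine ⟨(2 * C).toNNReal, A₁, R₀, hA₁, by simpa using hR₀, fun x r hr hrR => ?_⟩
  have h1 := hcap x r hr (lt_of_le_of_lt (by
    rw [← ENNReal.ofReal_coe_nnreal]; exact ENNReal.ofReal_le_ofReal hrR.le) hR₀')
  have hv0 : m (Metric.ball x r) ≠ 0 := (Metric.measure_ball_pos m x hr).ne'
  have hvt : m (Metric.ball x r) ≠ ∞ := (hD.measure_ball_lt_top x r).ne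
  have hr' : 0 < r ^ θ := by positivity
  set Q := ENNReal.ofReal C * (m (Metric.ball x r) / ENNReal.ofReal (r ^ θ)) with hQ
  have hQ0 : Q ≠ 0 := mul_ne_zero (by simp; linarith) (ENNReal.div_pos hv0 (by simp)).ne'
  have hQt : Q ≠ ∞ := ENNReal.mul_ne_top (by simp) (ENNReal.div_ne_top hvt (by simpa using hr'))
  have h2 : Q < 2 * Q := by
    rw [two_mul]; exact ENNReal.lt_add_right hQt hQ0
  obtain ⟨u, hu⟩ := iInf_lt_iff.mp (h1.trans_lt h2)
  obtain ⟨⟨hu1, hu0⟩, huE⟩ := iInf_lt_iff.mp hu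
  have hl := 𝓔.lip_ae lipschitzWith_unitClamp unitClamp_zero u
  refine ⟨𝓔.lip lipschitzWith_unitClamp unitClamp_zero u, ?_, ?_, ?_, ?_⟩
  · filter_upwards [hl] with y hy
    rw [hy]; exact (unitClamp_mem _).1
  · filter_upwards [hl, hu1] with y hy h1 hyb
    rw [hy, h1 hyb, unitClamp_of_one_le le_rfl]
  · filter_upwards [hl, hu0] with y hy h1 hyb
    rw [hy, h1 hyb, unitClamp_zero]
  · calc 𝓔.Γ _ univ = ENNReal.ofReal (𝓔.energy (𝓔.lip lipschitzWith_unitClamp unitClamp_zero u)) := by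
          rw [𝓔.energy_eq, ofReal_measureReal]
      _ ≤ ENNReal.ofReal (𝓔.energy u) :=
          ENNReal.ofReal_le_ofReal (𝓔.lipschitz_contraction _ _ _ u).choose_spec
      _ ≤ 2 * Q := huE.le
      _ = _ := by
          have : ((2 * C).toNNReal : ℝ≥0∞) = 2 * ENNReal.ofReal C := by
            change ENNReal.ofReal (2 * C) = _
            rw [ENNReal.ofReal_mul (by norm_num)]; norm_num
          rw [this, hQ, ENNReal.div_eq_inv_mul]; ring

variable (𝓔) in
/-- The telescoping partition of unity of a sequence of cutoff functions, with the cutoffs outside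
`I` removed. -/
def partition (ψ : ℕ → 𝓔.dom) (I : Finset ℕ) (i : ℕ) : 𝓔.dom :=
  𝓔.lip lipschitzWith_unitClamp unitClamp_zero (∑ j ∈ Finset.range (i + 1) ∩ I, ψ j) -
    𝓔.lip lipschitzWith_unitClamp unitClamp_zero (∑ j ∈ Finset.range i ∩ I, ψ j)

theorem partition_ae (ψ : ℕ → 𝓔.dom) (I : Finset ℕ) (i : ℕ) : ∀ᵐ x ∂m, (𝓔.partition ψ I i).1 x =
    unitClamp (∑ j ∈ Finset.range (i + 1) ∩ I, (ψ j).1 x) -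
      unitClamp (∑ j ∈ Finset.range i ∩ I, (ψ j).1 x) := by
  have h := lipschitzWith_unitClamp
  have h0 := unitClamp_zero
  filter_upwards [𝓔.sub_ae (𝓔.lip h h0 (∑ j ∈ Finset.range (i + 1) ∩ I, ψ j))
    (𝓔.lip h h0 (∑ j ∈ Finset.range i ∩ I, ψ j)),
    𝓔.lip_ae h h0 (∑ j ∈ Finset.range (i + 1) ∩ I, ψ j),
    𝓔.lip_ae h h0 (∑ j ∈ Finset.range i ∩ I, ψ j), 𝓔.sum_ae (Finset.range (i + 1) ∩ I) ψ,
    𝓔.sum_ae (Finset.range i ∩ I) ψ] with x h1 h2 h3 h4 h5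
  rw [partition, h1, h2, h3, h4, h5]

theorem sum_partition_ae (ψ : ℕ → 𝓔.dom) (a : ℕ → ℝ) (I J : Finset ℕ) :
    ∀ᵐ x ∂m, (∑ i ∈ J, a i • 𝓔.partition ψ I i).1 x =
    ∑ i ∈ J, a i * (unitClamp (∑ j ∈ Finset.range (i + 1) ∩ I, (ψ j).1 x) -
      unitClamp (∑ j ∈ Finset.range i ∩ I, (ψ j).1 x)) := by
  filter_upwards [𝓔.sum_ae J fun i => a i • 𝓔.partition ψ I i,
    ae_all_iff.mpr fun i => 𝓔.smul_ae (a i) (𝓔.partition ψ I i),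
    ae_all_iff.mpr fun i => partition_ae ψ I i] with x h1 h2 h3
  rw [h1]
  exact Finset.sum_congr rfl fun i _ => by rw [h2, h3]

theorem gammaSeminorm_partition_le {ψ : ℕ → 𝓔.dom} {I : Finset ℕ} {Q : ℝ}
    (hQ : ∀ j ∈ I, 𝓔.gammaSeminorm MeasurableSet.univ (ψ j) ≤ Q) (i : ℕ) :
    𝓔.gammaSeminorm MeasurableSet.univ (𝓔.partition ψ I i) ≤ 2 * (I.card * Q) := by
  have hsum : ∀ J : Finset ℕ, 𝓔.gammaSeminorm MeasurableSet.univ (𝓔.lip lipschitzWith_unitClamp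
      unitClamp_zero (∑ j ∈ J ∩ I, ψ j)) ≤ I.card * Q := by
    intro J
    calc _ ≤ _ := 𝓔.gammaSeminorm_lip_le _ _ _
      _ ≤ ∑ j ∈ J ∩ I, 𝓔.gammaSeminorm MeasurableSet.univ (ψ j) := Seminorm.sum_le _ _ _
      _ ≤ ∑ j ∈ I, 𝓔.gammaSeminorm MeasurableSet.univ (ψ j) :=
          Finset.sum_le_sum_of_subset_of_nonneg Finset.inter_subset_right
            fun _ _ _ => apply_nonneg _ _
      _ ≤ _ := by
          rw [← nsmul_eq_mul]
          exact Finset.sum_le_card_nsmul _ _ _ hQ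
  rw [two_mul]
  exact (map_sub_le_add _ _ _).trans (add_le_add (hsum _) (hsum _))

/-- Each member of the partition is a difference of two clamped sums of at most `M` cutoffs, which
costs `(2 * M) ^ p`; the `p`-th power of a sum of at most `M` coefficients costs `M ^ (p - 1)`. -/
theorem Γ_sum_partition_le {ψ : ℕ → 𝓔.dom} {I : Finset ℕ} {Q : ℝ≥0∞}
    (hQ : ∀ j ∈ I, 𝓔.Γ (ψ j) univ ≤ Q) (hQt : Q ≠ ∞) (b : ℕ → ℝ) {M : ℕ} (hM : I.card ≤ M) :
    𝓔.Γ (∑ i ∈ I, b i • 𝓔.partition ψ I i) univ ≤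
      ((2 * M) ^ p * M ^ (p - 1) : ℝ).toNNReal * Q * ∑ i ∈ I, ENNReal.ofReal (|b i| ^ p) := by
  have hp := exponent_gt_one p
  set N := 𝓔.gammaSeminorm MeasurableSet.univ with hN
  set q := Q.toReal ^ (1 / p) with hq
  have hq0 : 0 ≤ q := by positivity
  have h1 : ∀ j ∈ I, N (ψ j) ≤ q := fun j hj => by
    rw [hN, gammaSeminorm_apply, hq]
    refine Real.rpow_le_rpow measureReal_nonneg ?_ (by positivity)
    exact ENNReal.toReal_mono hQt (hQ j hj)
  have hM' : (I.card : ℝ) ≤ M := by exact_mod_cast hM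
  have h2 : N (∑ i ∈ I, b i • 𝓔.partition ψ I i) ≤ (2 * M) * q * ∑ i ∈ I, |b i| := by
    refine (Seminorm.sum_le _ _ _).trans ?_
    rw [Finset.mul_sum]
    refine Finset.sum_le_sum fun i _ => ?_
    rw [map_smul_eq_mul, Real.norm_eq_abs, mul_comm]
    gcongr
    refine (gammaSeminorm_partition_le h1 i).trans ?_
    rw [← mul_assoc]
    gcongr
  rw [𝓔.Γ_eq MeasurableSet.univ, ← ENNReal.ofReal_sum_of_nonneg fun _ _ => by positivity, ← ENNReal.ofReal_toReal hQt,
    ← ENNReal.ofReal_coe_nnreal, Real.coe_toNNReal _ (by positivity),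
    ← ENNReal.ofReal_mul (by positivity), ← ENNReal.ofReal_mul (by positivity)]
  refine ENNReal.ofReal_le_ofReal ?_
  have h3 : (∑ i ∈ I, |b i|) ^ p ≤ M ^ (p - 1) * ∑ i ∈ I, |b i| ^ p := by
    refine (Real.rpow_sum_le_const_mul_sum_rpow I b hp.le).trans ?_
    gcongr
  calc _ ≤ ((2 * M) * q * ∑ i ∈ I, |b i|) ^ p :=
        Real.rpow_le_rpow (apply_nonneg _ _) h2 (by linarith)
    _ = (2 * M) ^ p * Q.toReal * (∑ i ∈ I, |b i|) ^ p := by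
        rw [Real.mul_rpow (by positivity) (Finset.sum_nonneg fun _ _ => abs_nonneg _),
          Real.mul_rpow (by positivity) hq0, hq, Real.rpow_one_div_rpow ENNReal.toReal_nonneg hp]
    _ ≤ (2 * M) ^ p * Q.toReal * (M ^ (p - 1) * ∑ i ∈ I, |b i| ^ p) := by gcongr
    _ = _ := by ring

end PEnergyFramework

/-! ### Discrete convolutions -/

namespace PEnergyFramework

variable {X : Type*} [MetricSpace X] [MeasurableSpace X] {m : Measure X} {p : ℝ} [Fact (1 < p)]
  {𝓔 : PEnergyFramework m p}

theorem sum_partition_range_ae (ψ : ℕ → 𝓔.dom) (a : ℕ → ℝ) (n : ℕ) :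
    ∀ᵐ x ∂m, (∑ i ∈ Finset.range n, a i • 𝓔.partition ψ (Finset.range n) i).1 x =
    ∑ i ∈ Finset.range n, a i * (unitClamp (∑ j ∈ Finset.range (i + 1), (ψ j).1 x) -
      unitClamp (∑ j ∈ Finset.range i, (ψ j).1 x)) := by
  filter_upwards [sum_partition_ae ψ a (Finset.range n) (Finset.range n)] with x hx
  rw [hx, sum_mul_unitClamp_increment_filter subset_rfl fun i hi hi' => absurd hi hi']

variable [BorelSpace X] [LocallyCompactSpace X] [SecondCountableTopology X]

/-- Cutoffs with index outside `I` vanish on the ball around `z k`, and the partition sums to one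
there. Hence on that ball `w` is the constant `a k` plus a sum `w'` over `I` with coefficients `a i
- a k`. Strong locality removes the constant, and `w'` has few enough terms for its global energy to
be an acceptable bound. -/
theorem Γ_ball_sum_partition_le {ψ : ℕ → 𝓔.dom} {z : ℕ → X} {r A : ℝ}
    (hψ : ∀ j, ∀ᵐ y ∂m, 0 ≤ (ψ j).1 y)
    (hψ1 : ∀ j, ∀ᵐ y ∂m, y ∈ Metric.ball (z j) r → (ψ j).1 y = 1)
    (hψ0 : ∀ j, ∀ᵐ y ∂m, y ∉ Metric.ball (z j) (A * r) → (ψ j).1 y = 0)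
    (a : ℕ → ℝ) {n k : ℕ} (hk : k < n) {I : Finset ℕ} (hI : I ⊆ Finset.range n)
    (hI' : ∀ j ∈ Finset.range n, j ∉ I → (1 + A) * r ≤ dist (z j) (z k))
    {M : ℕ} (hM : I.card ≤ M) {Q : ℝ≥0∞} (hQ : ∀ j ∈ I, 𝓔.Γ (ψ j) univ ≤ Q) (hQt : Q ≠ ∞) :
    𝓔.Γ (∑ i ∈ Finset.range n, a i • 𝓔.partition ψ (Finset.range n) i) (Metric.ball (z k) r) ≤
      ((2 * M) ^ p * M ^ (p - 1) : ℝ).toNNReal * Q *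
        ∑ i ∈ I, ENNReal.ofReal (|a i - a k| ^ p) := by
  set w := ∑ i ∈ Finset.range n, a i • 𝓔.partition ψ (Finset.range n) i with hw
  set w' := ∑ i ∈ I, (a i - a k) • 𝓔.partition ψ I i with hw'
  set B := Metric.ball (z k) r
  have hB : MeasurableSet B := Metric.isOpen_ball.measurableSet
  have h0 : 𝓔.Γ (w - w') B = 0 := by
    refine 𝓔.Γ_eq_zero_of_ae_const Metric.isOpen_ball (c := a k) ?_
    filter_upwards [𝓔.sub_ae w w', sum_partition_range_ae ψ a n,
      sum_partition_ae ψ (fun i => a i - a k) I I, ae_all_iff.mpr hψ, ae_all_iff.mpr hψ1,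
      ae_all_iff.mpr hψ0] with x h1 h2 h3 h4 h5 h6 hx
    have hq : 1 ≤ ∑ j ∈ Finset.range n, (ψ j).1 x := by
      rw [← h5 k hx]
      exact Finset.single_le_sum (f := fun j => (ψ j).1 x) (fun j _ => h4 j)
        (Finset.mem_range.mpr hk)
    rw [h1, h2, h3, sum_mul_unitClamp_increment hq (a k),
      sum_mul_unitClamp_increment_filter hI, add_sub_cancel_left]
    intro i hi hiI
    refine h6 i fun hxi => ?_
    have h7 := hI' i hi hiI
    have h8 := dist_triangle_left (z i) (z k) x
    rw [Metric.mem_ball] at hxi hx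
    linarith
  have h1 : 𝓔.gammaSeminorm hB w ≤ 𝓔.gammaSeminorm hB w' := by
    have h2 := map_add_le_add (𝓔.gammaSeminorm hB) (w - w') w'
    rwa [sub_add_cancel, (𝓔.gammaSeminorm_eq_zero_iff hB _).mpr h0, zero_add] at h2
  calc 𝓔.Γ w B ≤ 𝓔.Γ w' B := by
        rw [𝓔.Γ_eq hB, 𝓔.Γ_eq hB]
        exact ENNReal.ofReal_le_ofReal (Real.rpow_le_rpow (apply_nonneg _ _) h1
          (by linarith [exponent_gt_one p]))
    _ ≤ 𝓔.Γ w' univ := measure_mono (subset_univ _)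
    _ ≤ _ := Γ_sum_partition_le hQ hQt (fun i => a i - a k) hM

/-- Jensen's inequality in each of the two balls. The distance condition puts every pair of points
of the two balls within `L * r`, where the kernel is at least a constant over the volume of the ball
at `x`. -/
theorem _root_.VolumeDoubling.average_sub_average_le [IsLocallyFiniteMeasure m] [m.IsOpenPosMeasure]
    (hD : VolumeDoubling m) (L : ℝ) : ∃ C : ℝ≥0, ∀ (f : X → ℝ), Continuous f →
      HasCompactSupport f → ∀ (x y : X) (r : ℝ), 0 < r → dist x y + 2 * r ≤ L * r →
      ENNReal.ofReal (|(⨍ u in Metric.ball x r, f u ∂m) - ⨍ v in Metric.ball y r, f v ∂m| ^ p) *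
        m (Metric.ball y r) ≤ C * ∫⁻ v in Metric.ball y r, ∫⁻ u in Metric.ball x r,
          ENNReal.ofReal (|f u - f v| ^ p) * ballKernel m (L * r) u v ∂m ∂m := by
  obtain ⟨C, hC1, hC⟩ := hD.exists_comparison L
  refine ⟨C, fun f hf hfc x y r hr hxy => ?_⟩
  have hp := exponent_gt_one p
  have h0 : ∀ z : X, m (Metric.ball z r) ≠ 0 := fun z => (Metric.measure_ball_pos m z hr).ne'
  have ht : ∀ z : X, m (Metric.ball z r) ≠ ∞ := fun z => (hD.measure_ball_lt_top z r).ne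
  set a := ⨍ u in Metric.ball x r, f u ∂m
  calc _ = ENNReal.ofReal (|(⨍ v in Metric.ball y r, f v ∂m) - a| ^ p) * m (Metric.ball y r) := by
        rw [abs_sub_comm]
    _ ≤ ∫⁻ v in Metric.ball y r, ENNReal.ofReal (|f v - a| ^ p) ∂m :=
        ofReal_rpow_average_sub_le hp.le hf hfc (h0 y) (ht y) a
    _ ≤ ∫⁻ v in Metric.ball y r, C * ∫⁻ u in Metric.ball x r,
          ENNReal.ofReal (|f u - f v| ^ p) * ballKernel m (L * r) u v ∂m ∂m := by
        refine setLIntegral_mono' Metric.isOpen_ball.measurableSet fun v hv => ?_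
        have h1 := ofReal_rpow_average_sub_le hp.le hf hfc (h0 x) (ht x) (f v)
        have h2 : ENNReal.ofReal (|f v - a| ^ p) ≤ (∫⁻ u in Metric.ball x r,
            ENNReal.ofReal (|f u - f v| ^ p) ∂m) * (m (Metric.ball x r))⁻¹ := by
          rw [abs_sub_comm, ← ENNReal.div_eq_inv_mul.trans (mul_comm _ _)]
          exact (ENNReal.le_div_iff_mul_le (Or.inl (h0 x)) (Or.inl (ht x))).mpr h1
        refine h2.trans ?_
        have hw : Measurable fun u => ENNReal.ofReal (|f u - f v| ^ p) := by fun_prop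
        have hwk : Measurable fun u => ENNReal.ofReal (|f u - f v| ^ p) *
            ballKernel m (L * r) u v := hw.mul (measurable_ballKernel_left _ v)
        rw [← lintegral_mul_const _ hw, ← lintegral_const_mul _ hwk]
        refine setLIntegral_mono' Metric.isOpen_ball.measurableSet fun u hu => ?_
        rw [mul_left_comm]
        gcongr
        rw [Metric.mem_ball] at hu hv
        have huv : dist u v < L * r := by
          have h3 := dist_triangle4_right u v x y
          linarith
        have hvx : dist v x ≤ L * r := by
          have h3 := dist_triangle_right v x y
          linarith
        rw [ballKernel, if_pos huv]
        exact ENNReal.inv_le_coe_mul_inv (zero_lt_one.trans_le hC1).ne' (hC v x r hr hvx)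
    _ = _ := by
        rw [lintegral_const_mul]
        have h6 : Measurable fun q : X × X => ENNReal.ofReal (|f q.1 - f q.2| ^ p) *
            ballKernel m (L * r) q.1 q.2 := measurable_pOscillation_integrand hf.measurable p _
        exact h6.lintegral_prod_left'

/-- Discrete convolutions: approximation of continuous functions at scale `r` by elements of the
domain whose energy measures are controlled by the `p`-oscillation at scale `r`. -/
theorem CapUpper.exists_approximation [Nontrivial X] [IsLocallyFiniteMeasure m]
    [m.IsOpenPosMeasure] (hD : VolumeDoubling m) {θ : ℝ} (hcap : 𝓔.CapUpper fun r => r ^ θ) :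
    ∃ (C : ℝ≥0) (L R₀ : ℝ), 1 ≤ L ∧ 0 < R₀ ∧ ∀ f : X → ℝ, Continuous f → HasCompactSupport f →
      ∀ (x₀ : X) (ρ : ℝ), 0 ≤ ρ → (∀ x ∉ Metric.ball x₀ ρ, f x = 0) → ∀ r, 0 < r → r < R₀ →
      ∃ w : 𝓔.dom, (∀ S : Set X, 𝓔.Γ w S ≤ C * (ENNReal.ofReal (r ^ θ))⁻¹ *
          pOscillation m p (L * r) f (Metric.thickening (L * r) S)) ∧
        (∀ᵐ x ∂m, x ∉ Metric.ball x₀ (ρ + L * r) → w.1 x = 0) ∧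
        ∀ ε : ℝ, 0 ≤ ε → (∀ x y, dist x y < L * r → |f x - f y| ≤ ε) →
          ∀ᵐ x ∂m, |w.1 x - f x| ≤ ε := by
  classical
  obtain ⟨C₁, A, R₀, hA, hR₀, hcut⟩ := hcap.exists_cutoff hD
  -- Cutoffs that interact with the ball at `z k` are centred within `(1 + A) * r` of it; adding one
  -- radius at each end gives `(3 + A) * r`, within the range `L * r`.
  set L := 4 + A with hL
  obtain ⟨C₂, hC₂, hD₂⟩ := hD.exists_comparison L
  obtain ⟨M, hM⟩ := hD.card_le_of_separated (m := m) (L := 1 + A) (by linarith)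
  obtain ⟨C₃, hC₃⟩ := VolumeDoubling.average_sub_average_le (p := p) hD L
  set D := ((2 * M) ^ p * M ^ (p - 1) : ℝ).toNNReal with hDdef
  refine ⟨D * (C₁ * C₂) * C₃ * M * M, L, R₀, by linarith, hR₀,
    fun f hf hfc x₀ ρ hρ hfρ r hr hrR => ?_⟩
  obtain ⟨n, z, hsep, hnet⟩ := hD.exists_net (m := m) x₀ (R := ρ + L * r) (r := r)
    (by rw [hL]; positivity) hr
  choose ψ hψ hψ1 hψ0 hψE using fun j => hcut (z j) r hr hrR
  set a : ℕ → ℝ := fun i => ⨍ u in Metric.ball (z i) r, f u ∂m with ha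
  set w := ∑ i ∈ Finset.range n, a i • 𝓔.partition ψ (Finset.range n) i with hw
  have hAr : 0 < A * r := by positivity
  have hLr : L * r = 4 * r + A * r := by rw [hL]; ring
  have ha0 : ∀ i, a i ≠ 0 → dist (z i) x₀ < ρ + r := by
    intro i hi
    by_contra! hcon
    refine hi ?_
    change (⨍ u in Metric.ball (z i) r, f u ∂m) = 0
    rw [setAverage_eq]
    refine smul_eq_zero_of_right _ (setIntegral_eq_zero_of_forall_eq_zero fun u hu => ?_)
    refine hfρ u fun hu' => ?_
    rw [Metric.mem_ball] at hu hu'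
    have := dist_triangle_left (z i) x₀ u
    linarith
  -- Coefficients with centre beyond `ρ + r` vanish, and cutoffs reach only `A * r` further. So `w`
  -- is zero already where the net may fail to cover, and points outside the net's range need no
  -- separate estimate.
  have hwout : ∀ᵐ x ∂m, ρ + (1 + A) * r ≤ dist x x₀ → w.1 x = 0 := by
    filter_upwards [sum_partition_range_ae ψ a n, ae_all_iff.mpr hψ0] with x h1 h2 hx
    rw [h1]
    refine Finset.sum_eq_zero fun i _ => ?_
    by_cases hi : a i = 0
    · rw [hi, zero_mul]
    · rw [unitClamp_increment_eq_zero (q := fun j => (ψ j).1 x), mul_zero]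
      refine h2 i fun hxi => ?_
      rw [Metric.mem_ball] at hxi
      have h3 := ha0 i hi
      have h4 := dist_triangle x (z i) x₀
      linarith
  refine ⟨w, fun S => ?_, ?_, fun ε hε hfε => ?_⟩
  · set S' := Metric.thickening (L * r) S with hS'
    have hS'm : MeasurableSet S' := Metric.isOpen_thickening.measurableSet
    set K := (Finset.range n).filter fun k => (Metric.ball (z k) r ∩ S).Nonempty with hK
    let H : X → X → ℝ≥0∞ := fun u v =>
      ENNReal.ofReal (|f u - f v| ^ p) * ballKernel m (L * r) u v
    let G : X → ℝ≥0∞ := fun v => ∫⁻ u in S', H u v ∂m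
    have hGm : Measurable G := measurable_inner hf.measurable p (L * r) S'
    let I : ℕ → Finset ℕ := fun k =>
      (Finset.range n).filter fun i => dist (z i) (z k) < (1 + A) * r
    have hIcard : ∀ k, (I k).card ≤ M := fun k => by
      refine hM ℕ (I k) z (z k) r hr (fun i hi j hj => hsep i ?_ j ?_) fun i hi => ?_
      · exact Finset.mem_range.mp (Finset.mem_filter.mp hi).1
      · exact Finset.mem_range.mp (Finset.mem_filter.mp hj).1
      · rw [dist_comm]; exact (Finset.mem_filter.mp hi).2.le
    have hball : ∀ k ∈ K, ∀ i ∈ I k, Metric.ball (z i) r ⊆ S' := by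
      intro k hk i hi u hu
      obtain ⟨s, hs, hsS⟩ := (Finset.mem_filter.mp hk).2
      have h1 := (Finset.mem_filter.mp hi).2
      refine Metric.mem_thickening_iff.mpr ⟨s, hsS, ?_⟩
      rw [Metric.mem_ball] at hu hs
      have h2 := dist_triangle4 u (z i) (z k) s
      rw [dist_comm (z k) s] at h2
      linarith
    have hkI : ∀ k ∈ K, k ∈ I k := fun k hk => Finset.mem_filter.mpr
      ⟨(Finset.mem_filter.mp hk).1, by rw [dist_self]; positivity⟩
    have hrθ : (ENNReal.ofReal (r ^ θ))⁻¹ ≠ ∞ := by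
      have : 0 < r ^ θ := by positivity
      simpa using this
    have hball_le : ∀ k ∈ K, 𝓔.Γ w (Metric.ball (z k) r) ≤
        D * (C₁ * C₂) * C₃ * M * (ENNReal.ofReal (r ^ θ))⁻¹ * ∫⁻ v in Metric.ball (z k) r, G v ∂m := by
      intro k hk
      have hkn : k < n := Finset.mem_range.mp (Finset.mem_filter.mp hk).1
      set V := m (Metric.ball (z k) r) with hV
      have h1 := Γ_ball_sum_partition_le hψ hψ1 hψ0 a hkn (I := I k) (Finset.filter_subset _ _)
        (fun j hj hj' => by
          by_contra! hlt
          exact hj' (Finset.mem_filter.mpr ⟨hj, hlt⟩)) (hIcard k)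
        (Q := C₁ * C₂ * (ENNReal.ofReal (r ^ θ))⁻¹ * V) (fun j hj => by
          have h2 := (Finset.mem_filter.mp hj).2
          calc _ ≤ C₁ * (ENNReal.ofReal (r ^ θ))⁻¹ * m (Metric.ball (z j) r) := hψE j
            _ ≤ C₁ * (ENNReal.ofReal (r ^ θ))⁻¹ * (C₂ * V) := by
                gcongr
                refine (measure_mono (Metric.ball_subset_ball ?_)).trans
                  (hD₂ (z j) (z k) r hr ?_)
                · linarith
                · linarith
            _ = _ := by ring)
        (ENNReal.mul_ne_top (ENNReal.mul_ne_top (by simp [ENNReal.mul_eq_top]) hrθ)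
          (hD.measure_ball_lt_top _ _).ne)
      refine h1.trans ?_
      calc D * (C₁ * C₂ * (ENNReal.ofReal (r ^ θ))⁻¹ * V) *
            ∑ i ∈ I k, ENNReal.ofReal (|a i - a k| ^ p)
          = D * (C₁ * C₂) * (ENNReal.ofReal (r ^ θ))⁻¹ *
            ∑ i ∈ I k, ENNReal.ofReal (|a i - a k| ^ p) * V := by
            rw [← Finset.sum_mul]; ring
        _ ≤ D * (C₁ * C₂) * (ENNReal.ofReal (r ^ θ))⁻¹ *
            ∑ i ∈ I k, C₃ * ∫⁻ v in Metric.ball (z k) r, G v ∂m := by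
            refine mul_le_mul_right (Finset.sum_le_sum fun i hi => ?_) _
            have h2 := (Finset.mem_filter.mp hi).2
            refine (hC₃ f hf hfc (z i) (z k) r hr (by linarith)).trans ?_
            gcongr with v
            exact lintegral_mono_set (hball k hk i hi)
        _ ≤ D * (C₁ * C₂) * (ENNReal.ofReal (r ^ θ))⁻¹ *
            (M * (C₃ * ∫⁻ v in Metric.ball (z k) r, G v ∂m)) := by
            rw [Finset.sum_const, nsmul_eq_mul]
            gcongr
            exact hIcard k
        _ = _ := by ring
    have hcover : S ⊆ (⋃ k ∈ K, Metric.ball (z k) r) ∪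
        (Metric.closedBall x₀ (ρ + (1 + A) * r))ᶜ := by
      intro s hs
      by_cases hsb : s ∈ Metric.closedBall x₀ (ρ + (1 + A) * r)
      · left
        rw [Metric.mem_closedBall] at hsb
        obtain ⟨k, hk, hsk⟩ := hnet s (by rw [Metric.mem_ball]; linarith)
        exact mem_biUnion (Finset.mem_filter.mpr ⟨Finset.mem_range.mpr hk, s, hsk, hs⟩) hsk
      · exact Or.inr hsb
    have hout : 𝓔.Γ w (Metric.closedBall x₀ (ρ + (1 + A) * r))ᶜ = 0 := by
      refine 𝓔.Γ_eq_zero_of_ae_const Metric.isClosed_closedBall.isOpen_compl (c := 0) ?_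
      filter_upwards [hwout] with x hx hxU
      refine hx (not_lt.mp fun h => hxU ?_)
      exact Metric.mem_closedBall.mpr h.le
    -- By separation of the net, a point lies in at most `M` of the balls.
    have hoverlap : ∑ k ∈ K, ∫⁻ v in Metric.ball (z k) r, G v ∂m ≤ M * ∫⁻ v in S', G v ∂m := by
      calc ∑ k ∈ K, ∫⁻ v in Metric.ball (z k) r, G v ∂m
          = ∫⁻ v, ∑ k ∈ K, (Metric.ball (z k) r).indicator G v ∂m := by
            rw [lintegral_finsetSum _ fun k _ => hGm.indicator Metric.isOpen_ball.measurableSet]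
            exact Finset.sum_congr rfl fun k _ =>
              (lintegral_indicator Metric.isOpen_ball.measurableSet _).symm
        _ ≤ ∫⁻ v, S'.indicator (fun v => M * G v) v ∂m := by
            refine lintegral_mono fun v => ?_
            by_cases hv : v ∈ S'
            · rw [indicator_of_mem hv]
              simp only [indicator_apply]
              rw [← Finset.sum_filter, Finset.sum_const, nsmul_eq_mul]
              gcongr
              refine hM ℕ _ z v r hr (fun i hi j hj => hsep i ?_ j ?_) fun i hi => ?_
              · exact Finset.mem_range.mp (Finset.mem_filter.mp (Finset.mem_filter.mp hi).1).1
              · exact Finset.mem_range.mp (Finset.mem_filter.mp (Finset.mem_filter.mp hj).1).1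
              · have := Metric.mem_ball.mp (Finset.mem_filter.mp hi).2
                linarith
            · refine (Finset.sum_eq_zero fun k hk => indicator_of_notMem (fun hvk => hv ?_) _).trans_le
                zero_le
              exact hball k hk k (hkI k hk) hvk
        _ = M * ∫⁻ v in S', G v ∂m := by
            rw [lintegral_indicator hS'm, lintegral_const_mul _ hGm]
    calc 𝓔.Γ w S ≤ ∑ k ∈ K, 𝓔.Γ w (Metric.ball (z k) r) + 0 := by
          rw [← hout]
          refine (measure_mono hcover).trans ((measure_union_le _ _).trans ?_)
          gcongr
          exact measure_biUnion_finset_le _ _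
      _ ≤ ∑ k ∈ K, D * (C₁ * C₂) * C₃ * M * (ENNReal.ofReal (r ^ θ))⁻¹ *
            ∫⁻ v in Metric.ball (z k) r, G v ∂m := by
          rw [add_zero]
          exact Finset.sum_le_sum hball_le
      _ ≤ D * (C₁ * C₂) * C₃ * M * (ENNReal.ofReal (r ^ θ))⁻¹ * (M * ∫⁻ v in S', G v ∂m) := by
          rw [← Finset.mul_sum]
          gcongr
      _ = _ := by
          push_cast
          change _ = _ * ∫⁻ v in S', G v ∂m
          ring
  · filter_upwards [hwout] with x hx hxb
    rw [Metric.mem_ball, not_lt] at hxb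
    exact hx (by linarith)
  · filter_upwards [hwout, sum_partition_range_ae ψ a n, ae_all_iff.mpr hψ, ae_all_iff.mpr hψ1,
      ae_all_iff.mpr hψ0] with x hx h1 h2 h3 h4
    by_cases hxb : x ∈ Metric.ball x₀ (ρ + L * r)
    · obtain ⟨k, hk, hxk⟩ := hnet x hxb
      have hq : 1 ≤ ∑ j ∈ Finset.range n, (ψ j).1 x := by
        rw [← h3 k hxk]
        exact Finset.single_le_sum (f := fun j => (ψ j).1 x) (fun j _ => h2 j)
          (Finset.mem_range.mpr hk)
      have hsum := Finset.sum_range_sub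
        (fun i => unitClamp (∑ j ∈ Finset.range i, (ψ j).1 x)) n
      simp only [Finset.range_zero, Finset.sum_empty, unitClamp_zero, unitClamp_of_one_le hq,
        sub_zero] at hsum
      -- The error is a convex combination of the differences `a i - f x`. Only indices whose cutoff
      -- reaches `x` count, and for those `a i` averages values of `f` within `(1 + A) * r` of `x`.
      rw [h1, sum_mul_unitClamp_increment hq (f x), add_sub_cancel_right]
      refine (Finset.abs_sum_le_sum_abs _ _).trans ?_
      rw [← mul_one ε, ← hsum, Finset.mul_sum]
      refine Finset.sum_le_sum fun i _ => ?_
      have hinc : 0 ≤ unitClamp (∑ j ∈ Finset.range (i + 1), (ψ j).1 x) -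
          unitClamp (∑ j ∈ Finset.range i, (ψ j).1 x) := by
        rw [sub_nonneg, Finset.sum_range_succ]
        exact unitClamp_mono (le_add_of_nonneg_right (h2 i))
      rw [abs_mul, abs_of_nonneg hinc]
      by_cases hxi : x ∈ Metric.ball (z i) (A * r)
      · refine mul_le_mul_of_nonneg_right ?_ hinc
        have hmem : a i ∈ Metric.closedBall (f x) ε := by
          refine (convex_closedBall (f x) ε).set_average_mem Metric.isClosed_closedBall
            (Metric.measure_ball_pos m _ hr).ne' (hD.measure_ball_lt_top _ _).ne ?_
            (hf.integrable_of_hasCompactSupport hfc).integrableOn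
          filter_upwards [ae_restrict_mem Metric.isOpen_ball.measurableSet] with u hu
          rw [Metric.mem_closedBall, Real.dist_eq]
          refine hfε u x ?_
          rw [Metric.mem_ball] at hu hxi
          have := dist_triangle_right u x (z i)
          linarith
        rwa [Metric.mem_closedBall, Real.dist_eq] at hmem
      · rw [unitClamp_increment_eq_zero (q := fun j => (ψ j).1 x) (h4 i hxi), mul_zero, mul_zero]
    · have hxb' : ρ + L * r ≤ dist x x₀ := by simpa using hxb
      rw [hx (by linarith), hfρ x fun h => hxb (Metric.ball_subset_ball (by linarith) h), sub_zero,
        abs_zero]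
      exact hε

end PEnergyFramework

/-! ### Energy is bounded by oscillations at small scales -/

theorem pOscillation_add_le {X : Type*} [MetricSpace X] [MeasurableSpace X] [BorelSpace X]
    [SecondCountableTopology X] {m : Measure X} [SFinite m] {p : ℝ} (hp : 0 ≤ p) (s : ℝ)
    {g h : X → ℝ} (hg : Measurable g) (hh : Measurable h) (S : Set X) :
    pOscillation m p s (fun x => g x + h x) S ≤
      ENNReal.ofReal (2 ^ p) * (pOscillation m p s g S + pOscillation m p s h S) := by
  have hgm : ∀ y, Measurable fun x => ENNReal.ofReal (|g x - g y| ^ p) * ballKernel m s x y :=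
    fun y => Measurable.mul (by fun_prop) (measurable_ballKernel_left s y)
  have hhm : ∀ y, Measurable fun x => ENNReal.ofReal (|h x - h y| ^ p) * ballKernel m s x y :=
    fun y => Measurable.mul (by fun_prop) (measurable_ballKernel_left s y)
  have h1 := measurable_inner (m := m) hg p s S
  have h2 := measurable_inner (m := m) hh p s S
  unfold pOscillation
  rw [← lintegral_add_left h1]
  refine le_trans (lintegral_mono fun y => ?_) (lintegral_const_mul _ (h1.add h2)).le
  rw [Pi.add_apply, ← lintegral_add_left (hgm y)]
  refine le_trans (lintegral_mono fun x => ?_)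
    (lintegral_const_mul _ ((hgm y).add (hhm y))).le
  rw [Pi.add_apply, ← add_mul, ← mul_assoc]
  gcongr
  have h3 := ofReal_rpow_abs_sub_le hp (g x - g y) (-(h x - h y)) 0
  rw [sub_zero, sub_zero, abs_neg] at h3
  have h4 : g x + h x - (g y + h y) = g x - g y - -(h x - h y) := by ring
  rw [h4]
  exact h3

namespace PEnergyFramework

variable {X : Type*} [MetricSpace X] [MeasurableSpace X] {m : Measure X} {p : ℝ} [Fact (1 < p)]
  {𝓔 : PEnergyFramework m p}

theorem Γ_add_le {A : Set X} (hA : MeasurableSet A) (u v : 𝓔.dom) :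
    𝓔.Γ (u + v) A ≤ ENNReal.ofReal (2 ^ p) * (𝓔.Γ u A + 𝓔.Γ v A) := by
  have hp := exponent_gt_one p
  set N := 𝓔.gammaSeminorm hA
  rw [𝓔.Γ_eq hA, 𝓔.Γ_eq hA, 𝓔.Γ_eq hA]
  have h1 := ofReal_rpow_abs_sub_le (p := p) (by linarith) (N u) (-N v) 0
  rw [sub_zero, sub_zero, abs_neg, abs_of_nonneg (apply_nonneg N u),
    abs_of_nonneg (apply_nonneg N v), sub_neg_eq_add,
    abs_of_nonneg (add_nonneg (apply_nonneg N u) (apply_nonneg N v))] at h1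
  refine le_trans (ENNReal.ofReal_le_ofReal ?_) h1
  exact Real.rpow_le_rpow (apply_nonneg _ _) (map_add_le_add _ _ _) (by linarith)

theorem Γ_le_of_tendsto {A : Set X} (hA : MeasurableSet A) {u : ℕ → 𝓔.dom} {w : 𝓔.dom}
    {K c : ℝ≥0∞} (hK : ∀ n, 𝓔.Γ (u n) univ ≤ K) (hKt : K ≠ ∞)
    (hlim : Tendsto (fun n => ‖(u n).1 - w.1‖) atTop (𝓝 0)) (hc : ∀ n, 𝓔.Γ (u n) A ≤ c) :
    𝓔.Γ w A ≤ c := by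
  have hp := exponent_gt_one p
  by_cases hct : c = ∞
  · rw [hct]; exact le_top
  have key : ∀ {B : Set X} (hB : MeasurableSet B) {b : ℝ≥0∞}, b ≠ ∞ → ∀ v, 𝓔.Γ v B ≤ b →
      𝓔.gammaSeminorm hB v ≤ b.toReal ^ (1 / p) := fun hB b hb v hv => by
    rw [gammaSeminorm_apply]
    exact Real.rpow_le_rpow measureReal_nonneg (ENNReal.toReal_mono hb hv) (by positivity)
  have h1 := 𝓔.gammaSeminorm_le_of_le_of_tendsto hA (fun n => key .univ hKt _ (hK n)) hlim
    (fun n => key hA hct _ (hc n))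
  rw [𝓔.Γ_eq hA, ← ENNReal.ofReal_toReal hct]
  refine ENNReal.ofReal_le_ofReal ?_
  rw [← Real.rpow_one_div_rpow (a := c.toReal) ENNReal.toReal_nonneg hp]
  exact Real.rpow_le_rpow (apply_nonneg _ _) h1 (by linarith)

theorem norm_sub_le_of_ae {u v : 𝓔.dom} {B : Set X} (hB : MeasurableSet B) {ε : ℝ} (hε : 0 ≤ ε)
    (h : ∀ᵐ x ∂m, |u.1 x - v.1 x| ≤ ε) (h0 : ∀ᵐ x ∂m, x ∉ B → u.1 x - v.1 x = 0)
    (hBt : m B ≠ ∞) : ‖u.1 - v.1‖ ≤ ε * (m B).toReal ^ (1 / p) := by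
  have hp := exponent_gt_one p
  have hp' : ENNReal.ofReal p ≠ 0 := by simpa using by linarith
  rw [Lp.norm_def]
  have h1 : eLpNorm (u.1 - v.1 : Lp ℝ (ENNReal.ofReal p) m) (ENNReal.ofReal p) m ≤
      eLpNorm (B.indicator fun _ => ε) (ENNReal.ofReal p) m := by
    refine eLpNorm_mono_ae ?_
    filter_upwards [h, h0, 𝓔.sub_ae u v] with x h1 h2 h3
    have h4 : (u.1 - v.1 : Lp ℝ (ENNReal.ofReal p) m) x = u.1 x - v.1 x := h3
    rw [h4]
    by_cases hx : x ∈ B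
    · rw [indicator_of_mem hx, Real.norm_of_nonneg hε]; exact h1
    · rw [h2 hx, indicator_of_notMem hx]
  rw [eLpNorm_indicator_const hB hp' ENNReal.ofReal_ne_top] at h1
  refine (ENNReal.toReal_mono ?_ h1).trans_eq ?_
  · exact ENNReal.mul_ne_top (by simp) (ENNReal.rpow_ne_top_of_nonneg (by positivity) hBt)
  · rw [ENNReal.toReal_mul, ENNReal.toReal_rpow, ENNReal.toReal_ofReal (by linarith)]
    simp [abs_of_nonneg hε]

variable [BorelSpace X] [LocallyCompactSpace X] [SecondCountableTopology X]
  [Nontrivial X] [IsLocallyFiniteMeasure m] [m.IsOpenPosMeasure]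

/-- Along the good scales, the discrete convolutions of `f` have energy on `S` bounded by a multiple
of `c`; the margin `δ` absorbs the neighbourhood of `S` in that estimate. They converge uniformly
with supports in a fixed ball, hence in `L^p`, and lower semicontinuity applies once their total
energies are bounded, which the Poincaré inequality for `v` ensures. -/
theorem Γ_le_of_frequently_of_continuous (hD : VolumeDoubling m) {θ : ℝ}
    (hPI : 𝓔.Poincare fun r => r ^ θ) (hcap : 𝓔.CapUpper fun r => r ^ θ) :
    ∃ C : ℝ≥0, ∀ (v : 𝓔.dom) (f : X → ℝ), Continuous f → HasCompactSupport f → v.1 =ᵐ[m] f →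
      ∀ (S T : Set X), MeasurableSet S → ∀ δ > 0, Metric.thickening δ S ⊆ T → ∀ c : ℝ≥0∞,
      (∃ᶠ k : ℕ in atTop, (ENNReal.ofReal (((1 / 2 : ℝ) ^ k) ^ θ))⁻¹ *
        pOscillation m p ((1 / 2 : ℝ) ^ k) f T ≤ c) → 𝓔.Γ v S ≤ C * c := by
  obtain ⟨C, L, R₀, hL, hR₀, happ⟩ := hcap.exists_approximation hD
  obtain ⟨C', L', hPI'⟩ := hPI.pOscillation_le hD
  refine ⟨C * (L ^ θ).toNNReal, fun v f hf hfc hvf S T hS δ hδ hST c hfreq => ?_⟩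
  obtain ⟨x₀⟩ : Nonempty X := inferInstance
  obtain ⟨ρ, hρ0, hρ⟩ := hfc.isCompact.isBounded.subset_ball_lt 0 x₀
  have hfρ : ∀ x ∉ Metric.ball x₀ ρ, f x = 0 := fun x hx =>
    image_eq_zero_of_notMem_tsupport fun h => hx (hρ h)
  have hs0 : ∀ k : ℕ, 0 < (1 / 2 : ℝ) ^ k := fun k => by positivity
  have hslim : Tendsto (fun k : ℕ => (1 / 2 : ℝ) ^ k) atTop (𝓝 0) :=
    tendsto_pow_atTop_nhds_zero_of_lt_one (by norm_num) (by norm_num)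
  have hev : ∀ᶠ k : ℕ in atTop, (1 / 2 : ℝ) ^ k < min (L * R₀) δ :=
    hslim.eventually_lt_const (lt_min (by positivity) hδ)
  obtain ⟨κ, hκ, hκP⟩ := extraction_of_frequently_atTop (hfreq.and_eventually hev)
  set s : ℕ → ℝ := fun j => (1 / 2 : ℝ) ^ κ j with hs
  have hsj0 : ∀ j, 0 < s j := fun j => hs0 _
  have hsj1 : ∀ j, s j ≤ 1 := fun j => pow_le_one₀ (by norm_num) (by norm_num)
  have hL0 : 0 < L := by linarith
  have hLs : ∀ j, L * (s j / L) = s j := fun j => mul_div_cancel₀ _ hL0.ne'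
  -- The net has scale `s j / L`, so that the oscillation in the estimate is taken exactly at the
  -- dyadic scale `s j`.
  choose w hw1 hw2 hw3 using fun j => happ f hf hfc x₀ ρ hρ0.le hfρ (s j / L)
    (div_pos (hsj0 j) hL0)
    ((div_lt_iff₀' hL0).mpr ((hκP j).2.trans_le (min_le_left _ _)))
  simp only [hLs] at hw1 hw2 hw3
  have hscale : ∀ j, (ENNReal.ofReal ((s j / L) ^ θ))⁻¹ =
      ENNReal.ofReal (L ^ θ) * (ENNReal.ofReal ((s j) ^ θ))⁻¹ := by
    intro j
    have h1 : 0 < s j ^ θ := Real.rpow_pos_of_pos (hsj0 j) _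
    have h2 : 0 < L ^ θ := Real.rpow_pos_of_pos hL0 _
    rw [Real.div_rpow (hsj0 j).le hL0.le, ENNReal.ofReal_div_of_pos h2, ENNReal.inv_div
      (Or.inl (by simp)) (Or.inl (by simpa using h2)), ENNReal.div_eq_inv_mul, mul_comm]
  have hbound : ∀ j S, 𝓔.Γ (w j) S ≤ (C * (L ^ θ).toNNReal : ℝ≥0) *
      ((ENNReal.ofReal ((s j) ^ θ))⁻¹ * pOscillation m p (s j) f (Metric.thickening (s j) S)) := by
    intro j S
    refine (hw1 j S).trans_eq ?_
    rw [hscale, ENNReal.coe_mul]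
    change _ = _ * ENNReal.ofReal (L ^ θ) * _
    ring
  refine Γ_le_of_tendsto hS (u := w)
    (K := (C * (L ^ θ).toNNReal : ℝ≥0) * (C' * 𝓔.Γ v univ)) (fun j => ?_) ?_ ?_ (fun j => ?_)
  · refine (hbound j univ).trans (mul_le_mul_right ?_ _)
    have h1 := hPI' (s j) (hsj0 j) v univ .univ
    rw [pOscillation_congr (g := f) (by rw [Measure.restrict_univ]; exact hvf)] at h1
    have h2 : ENNReal.ofReal (s j ^ θ) ≠ 0 := by
      have := Real.rpow_pos_of_pos (hsj0 j) θ
      simpa using this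
    calc _ ≤ (ENNReal.ofReal (s j ^ θ))⁻¹ * (C' * ENNReal.ofReal (s j ^ θ) * 𝓔.Γ v univ) := by
          gcongr
          refine (pOscillation_mono (subset_univ _)).trans (h1.trans ?_)
          gcongr
          exact subset_univ _
      _ = ((ENNReal.ofReal (s j ^ θ))⁻¹ * ENNReal.ofReal (s j ^ θ)) * (C' * 𝓔.Γ v univ) := by ring
      _ = _ := by rw [ENNReal.inv_mul_cancel h2 ENNReal.ofReal_ne_top, one_mul]
  · exact ENNReal.mul_ne_top ENNReal.coe_ne_top
      (ENNReal.mul_ne_top ENNReal.coe_ne_top (measure_ne_top _ _))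
  · have hu := hfc.uniformContinuous_of_continuous hf
    set V := (m (Metric.ball x₀ (ρ + 1))).toReal ^ (1 / p) with hV
    have hV0 : 0 ≤ V := by positivity
    rw [Metric.tendsto_atTop]
    intro ε hε
    obtain ⟨η, hη, hηf⟩ := Metric.uniformContinuous_iff.mp hu (ε / (V + 1)) (by positivity)
    have hslim' : Tendsto s atTop (𝓝 0) := hslim.comp hκ.tendsto_atTop
    obtain ⟨N, hN⟩ := eventually_atTop.mp (hslim'.eventually_lt_const hη)
    refine ⟨N, fun j hj => ?_⟩
    have h1 := hw3 j (ε / (V + 1)) (by positivity) fun x y hxy =>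
      (Real.dist_eq (f x) (f y) ▸ (hηf (hxy.trans (hN j hj))).le)
    have h2 : ‖(w j).1 - v.1‖ ≤ ε / (V + 1) * V := by
      refine norm_sub_le_of_ae (B := Metric.ball x₀ (ρ + 1)) Metric.isOpen_ball.measurableSet
        (by positivity) ?_ ?_ (hD.measure_ball_lt_top _ _).ne
      · filter_upwards [h1, hvf] with x hx hx'
        rwa [hx']
      · filter_upwards [hw2 j, hvf] with x hx hx' hxB
        rw [hx', hx fun h => hxB (Metric.ball_subset_ball (by linarith [hsj1 j]) h),
          hfρ x fun h => hxB (Metric.ball_subset_ball (by linarith) h), sub_zero]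
    rw [dist_zero_right, norm_norm]
    refine h2.trans_lt ?_
    rw [div_mul_eq_mul_div, div_lt_iff₀ (by positivity)]
    nlinarith
  · refine (hbound j S).trans (mul_le_mul_right ?_ _)
    refine le_trans ?_ (hκP j).1
    gcongr
    exact pOscillation_mono
      ((Metric.thickening_mono ((hκP j).2.trans_le (min_le_right _ _)).le S).trans hST)

/-- The energy measure of an open set is controlled by the lower limit of the normalized
`p`-oscillations in that set. -/
theorem Γ_le_of_frequently (hD : VolumeDoubling m) {θ : ℝ}
    (hPI : 𝓔.Poincare fun r => r ^ θ) (hcap : 𝓔.CapUpper fun r => r ^ θ) :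
    ∃ C : ℝ≥0, ∀ (v : 𝓔.dom) (A : Set X), IsOpen A → ∀ c : ℝ≥0∞,
      (∃ᶠ k : ℕ in atTop, (ENNReal.ofReal (((1 / 2 : ℝ) ^ k) ^ θ))⁻¹ *
        pOscillation m p ((1 / 2 : ℝ) ^ k) v.1 A ≤ c) → 𝓔.Γ v A ≤ C * c := by
  have hp := exponent_gt_one p
  obtain ⟨C, hC⟩ := Γ_le_of_frequently_of_continuous hD hPI hcap
  obtain ⟨C', L', hPI'⟩ := hPI.pOscillation_le hD
  set t : ℝ≥0 := (2 ^ p : ℝ).toNNReal with ht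
  refine ⟨t * (C * t), fun v A hA c hfreq => ?_⟩
  -- An exhaustion of `A` by sets with a positive margin. The extended distance is infinite when the
  -- complement is empty, which covers `A = univ`.
  let S : ℕ → Set X := fun n => {x | ENNReal.ofReal (1 / (n + 1)) ≤ Metric.infEDist x Aᶜ}
  have hSm : ∀ n, MeasurableSet (S n) := fun n =>
    (isClosed_le continuous_const Metric.continuous_infEDist).measurableSet
  have hSthick : ∀ n : ℕ, Metric.thickening (1 / ((n : ℝ) + 1)) (S n) ⊆ A := by
    intro n y hy
    obtain ⟨x, hx, hxy⟩ := Metric.mem_thickening_iff.mp hy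
    by_contra hyA
    have h1 : Metric.infEDist x Aᶜ ≤ edist x y := Metric.infEDist_le_edist_of_mem hyA
    have h2 := le_trans hx h1
    rw [edist_dist, ENNReal.ofReal_le_ofReal_iff dist_nonneg, dist_comm] at h2
    linarith
  have hSmono : Monotone S := by
    intro a b hab x hx
    refine le_trans (ENNReal.ofReal_le_ofReal ?_) hx
    exact Nat.one_div_le_one_div hab
  have hSunion : ⋃ n, S n = A := by
    refine Subset.antisymm (iUnion_subset fun n x hx => ?_) fun x hx => ?_
    · exact hSthick n (Metric.self_subset_thickening (by positivity) _ hx)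
    · have h1 : 0 < Metric.infEDist x Aᶜ := by
        rw [Metric.infEDist_pos_iff_notMem_closure, hA.isClosed_compl.closure_eq]
        exact fun h => h hx
      obtain ⟨q, hq0, hq⟩ := ENNReal.lt_iff_exists_nnreal_btwn.mp h1
      obtain ⟨n, hn⟩ := exists_nat_one_div_lt (K := ℝ) (show (0 : ℝ) < q by simpa using hq0)
      refine mem_iUnion.mpr ⟨n, (ENNReal.ofReal_le_ofReal hn.le).trans ?_⟩
      rw [ENNReal.ofReal_coe_nnreal]
      exact hq.le
  rw [← hSunion, hSmono.measure_iUnion]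
  refine iSup_le fun n => ?_
  obtain ⟨u, f, hf, hlim, hlimE⟩ := 𝓔.exists_seq_continuous v
  have hE : Tendsto (fun j => 𝓔.Γ (u j - v) univ) atTop (𝓝 0) := by
    have h1 := (ENNReal.continuous_ofReal.tendsto _).comp
      (hlimE.rpow_const (p := p) (Or.inr (by linarith)))
    rw [Real.zero_rpow (by linarith), ENNReal.ofReal_zero] at h1
    exact h1.congr fun j => (𝓔.Γ_eq MeasurableSet.univ _).symm
  -- The continuous case is applied to the approximant `u j`. By Poincaré its normalized oscillation
  -- differs from that of `v` by an error bounded by the energy of `u j - v`, uniformly in the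
  -- scale, so the same scales serve for all `j`.
  have hbound : ∀ j, 𝓔.Γ v (S n) ≤ t * (C * (t * (c + C' * 𝓔.Γ (u j - v) univ)) +
      𝓔.Γ (u j - v) univ) := by
    intro j
    obtain ⟨hfc, hfs, huf⟩ := hf j
    have h1 : 𝓔.Γ v (S n) ≤ t * (𝓔.Γ (u j) (S n) + 𝓔.Γ (u j - v) univ) := by
      have h2 := Γ_add_le (hSm n) (u j) (-(u j - v))
      have h3 : 𝓔.Γ (-(u j - v)) (S n) = 𝓔.Γ (u j - v) (S n) := by
        rw [𝓔.Γ_eq (hSm n), 𝓔.Γ_eq (hSm n), map_neg_eq_map]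
      rw [h3, neg_sub, add_sub_cancel] at h2
      refine h2.trans (mul_le_mul_right (add_le_add le_rfl ?_) _)
      exact measure_mono (subset_univ _)
    refine h1.trans ?_
    gcongr
    refine hC (u j) (f j) hfc hfs huf (S n) A (hSm n) (1 / ((n : ℝ) + 1)) (by positivity)
      (hSthick n) _ (hfreq.mono fun k hk => ?_)
    set s := (1 / 2 : ℝ) ^ k with hs
    have hs0 : 0 < s := by positivity
    have h2 : ENNReal.ofReal (s ^ θ) ≠ 0 := by
      have := Real.rpow_pos_of_pos hs0 θ
      simpa using this
    have h3 : pOscillation m p s (f j) A ≤ t * (pOscillation m p s v.1 A +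
        pOscillation m p s (u j - v).1 univ) := by
      rw [pOscillation_congr (g := fun x => v.1 x + (u j - v).1 x)]
      · refine (pOscillation_add_le (by linarith) s (measurable_coe _) (measurable_coe _) A).trans ?_
        gcongr
        · exact le_rfl
        · exact pOscillation_mono (subset_univ _)
      · refine ae_restrict_of_ae ?_
        filter_upwards [huf, 𝓔.sub_ae (u j) v] with x h4 h5
        rw [h5, ← h4]; ring
    have h4 := hPI' s hs0 (u j - v) univ .univ
    calc _ ≤ (ENNReal.ofReal (s ^ θ))⁻¹ * (t * (pOscillation m p s v.1 A +
            C' * ENNReal.ofReal (s ^ θ) * 𝓔.Γ (u j - v) univ)) := by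
          gcongr
          refine h3.trans ?_
          gcongr
          refine h4.trans ?_
          gcongr
          exact subset_univ _
      _ = t * ((ENNReal.ofReal (s ^ θ))⁻¹ * pOscillation m p s v.1 A +
            ((ENNReal.ofReal (s ^ θ))⁻¹ * ENNReal.ofReal (s ^ θ)) *
              (C' * 𝓔.Γ (u j - v) univ)) := by ring
      _ ≤ _ := by
          rw [ENNReal.inv_mul_cancel h2 ENNReal.ofReal_ne_top, one_mul]
          gcongr
  have hlim' : Tendsto (fun j => t * (C * (t * (c + C' * 𝓔.Γ (u j - v) univ)) +
      𝓔.Γ (u j - v) univ)) atTop (𝓝 (t * (C * (t * (c + C' * 0)) + 0))) := by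
    refine ENNReal.Tendsto.const_mul (Tendsto.add ?_ hE) (Or.inr ENNReal.coe_ne_top)
    refine ENNReal.Tendsto.const_mul ?_ (Or.inr ENNReal.coe_ne_top)
    refine ENNReal.Tendsto.const_mul ?_ (Or.inr ENNReal.coe_ne_top)
    exact tendsto_const_nhds.add (ENNReal.Tendsto.const_mul hE (Or.inr ENNReal.coe_ne_top))
  refine (ge_of_tendsto' hlim' hbound).trans_eq ?_
  push_cast
  ring

end PEnergyFramework

/-! ### The double integral as a dyadic sum of oscillations -/

section Kernel

variable {X : Type*} [MetricSpace X] [MeasurableSpace X] {m : Measure X}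

/-- The double integral of the nonlocal energies, without the normalizing factor. -/
def nonlocalEnergy (m : Measure X) (p α : ℝ) (S : Set X) (f : X → ℝ) : ℝ≥0∞ :=
  ∫⁻ y in S, ∫⁻ x in S, ENNReal.ofReal (|f x - f y| ^ p) /
    (ENNReal.ofReal (dist x y ^ α) * m (Metric.ball y (dist x y))) ∂m ∂m

theorem bbmEnergy_eq (p θp θ : ℝ) (S : Set X) (f : X → ℝ) :
    bbmEnergy m p θp S f θ = ENNReal.ofReal (θp - θ) * nonlocalEnergy m p (p * θ) S f := rfl

theorem nonlocalEnergy_mono {p α : ℝ} {f : X → ℝ} {S T : Set X} (h : S ⊆ T) :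
    nonlocalEnergy m p α S f ≤ nonlocalEnergy m p α T f :=
  (lintegral_mono_set h).trans (lintegral_mono fun _ => lintegral_mono_set h)

theorem nonlocalEnergy_congr {p α : ℝ} {f g : X → ℝ} {S : Set X}
    (h : ∀ᵐ x ∂(m.restrict S), f x = g x) :
    nonlocalEnergy m p α S f = nonlocalEnergy m p α S g := by
  refine lintegral_congr_ae ?_
  filter_upwards [h] with y hy
  refine lintegral_congr_ae ?_
  filter_upwards [h] with x hx
  rw [hx, hy]

theorem inv_ofReal_rpow {s : ℝ} (hs : 0 < s) (α : ℝ) :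
    (ENNReal.ofReal (s ^ α))⁻¹ = ENNReal.ofReal ((s⁻¹) ^ α) := by
  rw [← ENNReal.ofReal_inv_of_pos (Real.rpow_pos_of_pos hs α), Real.inv_rpow hs.le]

theorem geom_sum_le_two_mul_pow {b : ℝ} (hb : 2 ≤ b) (n : ℕ) :
    ∑ k ∈ Finset.range (n + 1), b ^ k ≤ 2 * b ^ n := by
  induction n with
  | zero => simp
  | succ n ih =>
    rw [Finset.sum_range_succ]
    have : 2 * b ^ n ≤ b ^ (n + 1) := by
      rw [pow_succ']; gcongr
    linarith

/-- Only scales above `dist x y` contribute. Their weights grow geometrically with ratio `2 ^ α ≥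
2`, so the sum is at most twice the last one, whatever `α ≥ 1`; the volumes only help, by
monotonicity. -/
theorem sum_ballKernel_le {α : ℝ} (hα : 1 ≤ α) {x y : X} (hxy : 0 < dist x y)
    (hV : m (Metric.ball y (dist x y)) ≠ ∞) (n : ℕ) :
    ∑ k ∈ Finset.range n,
        (ENNReal.ofReal (((1 / 2 : ℝ) ^ k) ^ α))⁻¹ * ballKernel m ((1 / 2 : ℝ) ^ k) x y ≤
      2 * (ENNReal.ofReal (dist x y ^ α) * m (Metric.ball y (dist x y)))⁻¹ := by
  set d := dist x y with hd
  have hdα : 0 < d ^ α := Real.rpow_pos_of_pos hxy α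
  rw [ENNReal.mul_inv (Or.inr hV) (Or.inl ENNReal.ofReal_ne_top), inv_ofReal_rpow hxy]
  set W := (m (Metric.ball y d))⁻¹ with hW
  induction n with
  | zero => simp
  | succ n ih =>
    by_cases hn : d < (1 / 2 : ℝ) ^ n
    · have hterm : ∀ k, k ≤ n →
          (ENNReal.ofReal (((1 / 2 : ℝ) ^ k) ^ α))⁻¹ * ballKernel m ((1 / 2 : ℝ) ^ k) x y ≤
          ENNReal.ofReal (((2 : ℝ) ^ α) ^ k) * W := by
        intro k hk
        have hdk : d < (1 / 2 : ℝ) ^ k :=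
          hn.trans_le (pow_le_pow_of_le_one (by norm_num) (by norm_num) hk)
        rw [inv_ofReal_rpow (by positivity), ballKernel, if_pos hdk]
        refine mul_le_mul' (le_of_eq ?_) (ENNReal.inv_le_inv.mpr (measure_mono
          (Metric.ball_subset_ball hdk.le)))
        congr 1
        rw [← inv_pow, one_div, inv_inv, ← Real.rpow_natCast, ← Real.rpow_natCast,
          ← Real.rpow_mul (by norm_num), ← Real.rpow_mul (by norm_num), mul_comm]
      calc _ ≤ ∑ k ∈ Finset.range (n + 1), ENNReal.ofReal (((2 : ℝ) ^ α) ^ k) * W :=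
            Finset.sum_le_sum fun k hk => hterm k (by simpa [Nat.lt_succ_iff] using hk)
        _ = ENNReal.ofReal (∑ k ∈ Finset.range (n + 1), ((2 : ℝ) ^ α) ^ k) * W := by
            rw [ENNReal.ofReal_sum_of_nonneg fun _ _ => by positivity, Finset.sum_mul]
        _ ≤ ENNReal.ofReal (2 * (d⁻¹) ^ α) * W := by
            gcongr
            have h2 : (2 : ℝ) ≤ 2 ^ α := by
              simpa using Real.rpow_le_rpow_of_exponent_le (by norm_num : (1 : ℝ) ≤ 2) hα
            refine (geom_sum_le_two_mul_pow h2 n).trans ?_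
            gcongr
            rw [← Real.rpow_natCast, ← Real.rpow_mul (by norm_num), mul_comm α,
              Real.rpow_mul (by norm_num), Real.rpow_natCast]
            refine Real.rpow_le_rpow (by positivity) ?_ (by linarith)
            rw [le_inv_comm₀ (by positivity) hxy, ← inv_pow]
            simpa using hn.le
        _ = _ := by
            rw [ENNReal.ofReal_mul (by norm_num), ENNReal.ofReal_ofNat, mul_assoc]
    · rw [Finset.sum_range_succ, ballKernel, if_neg hn, mul_zero, add_zero]
      exact ih

/-- Conversely, a single scale between `dist x y` and its double already dominates the singular
kernel. The constant depends on the upper bound `β` only, since `α` is going to vary with `θ`. -/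
theorem inv_le_ballKernel (hD : VolumeDoubling m) (β : ℝ) : ∃ C : ℝ≥0, ∀ (α : ℝ), 0 ≤ α → α ≤ β →
    ∀ (x y : X) (s : ℝ), dist x y < s → s ≤ 2 * dist x y →
      (ENNReal.ofReal (dist x y ^ α) * m (Metric.ball y (dist x y)))⁻¹ ≤
        C * ((ENNReal.ofReal (s ^ α))⁻¹ * ballKernel m s x y) := by
  obtain ⟨c, hc, hD⟩ := hD
  refine ⟨(2 ^ β : ℝ).toNNReal * c, fun α hα hαβ x y s hs hs2 => ?_⟩
  have hd : 0 < dist x y := by linarith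
  set d := dist x y with hdd
  have hdα : 0 < d ^ α := Real.rpow_pos_of_pos hd α
  rw [ballKernel, if_pos hs]
  have h1 : (m (Metric.ball y d))⁻¹ ≤ c * (m (Metric.ball y s))⁻¹ :=
    ENNReal.inv_le_coe_mul_inv (zero_lt_one.trans_le hc).ne'
      ((measure_mono (Metric.ball_subset_ball hs2)).trans (hD y d hd))
  have h2 : (ENNReal.ofReal (d ^ α))⁻¹ ≤ ENNReal.ofReal (2 ^ β) * (ENNReal.ofReal (s ^ α))⁻¹ := by
    rw [inv_ofReal_rpow hd, inv_ofReal_rpow (hd.trans hs), ← ENNReal.ofReal_mul (by positivity)]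
    refine ENNReal.ofReal_le_ofReal ?_
    calc (d⁻¹) ^ α ≤ (2 * s⁻¹) ^ α := by
          refine Real.rpow_le_rpow (by positivity) ?_ hα
          rw [← div_eq_mul_inv, inv_eq_one_div, div_le_div_iff₀ hd (hd.trans hs)]
          linarith
      _ = 2 ^ α * (s⁻¹) ^ α := Real.mul_rpow (by norm_num) (by linarith [inv_pos.mpr (hd.trans hs)])
      _ ≤ 2 ^ β * (s⁻¹) ^ α := by
          have := inv_pos.mpr (hd.trans hs)
          gcongr
          norm_num
  by_cases hV : m (Metric.ball y d) = ∞
  · simp [hV, hdα]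
  · rw [ENNReal.mul_inv (Or.inr hV) (Or.inl ENNReal.ofReal_ne_top)]
    refine (mul_le_mul' h2 h1).trans_eq ?_
    rw [ENNReal.coe_mul]
    change _ = ENNReal.ofReal (2 ^ β) * _ * _
    ring

/-- The two alternatives separate scales up to `δ`, later handled by Poincaré, from those above `δ`,
handled by the `L^p` norm. -/
theorem exists_dyadic_scale {d δ : ℝ} (hd : 0 < d) (hδ : 0 < δ) :
    (∃ k : ℕ, d < δ * (1 / 2) ^ k ∧ δ * (1 / 2) ^ k ≤ 2 * d) ∨
      ∃ k : ℕ, d < δ * 2 ^ (k + 1) ∧ δ * 2 ^ (k + 1) ≤ 2 * d := by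
  obtain ⟨n, hn1, hn2⟩ := exists_mem_Ico_zpow (div_pos hd hδ) (one_lt_two (α := ℝ))
  rw [le_div_iff₀ hδ] at hn1
  rw [div_lt_iff₀ hδ] at hn2
  have h2 : (2 : ℝ) ^ (n + 1) = 2 * 2 ^ n := by rw [zpow_add₀ (by norm_num), zpow_one, mul_comm]
  rcases le_or_gt (n + 1) 0 with h | h
  · left
    obtain ⟨k, hk⟩ := Int.exists_eq_neg_ofNat h
    refine ⟨k, ?_⟩
    have h3 : (1 / 2 : ℝ) ^ k = 2 ^ (n + 1) := by
      rw [hk, zpow_neg, zpow_natCast, one_div, inv_pow]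
    rw [h3]
    constructor
    · linarith
    · rw [h2]; linarith
  · right
    obtain ⟨k, rfl⟩ := Int.eq_ofNat_of_zero_le (show 0 ≤ n by omega)
    refine ⟨k, ?_⟩
    have h3 : (2 : ℝ) ^ (k + 1) = 2 ^ ((k : ℤ) + 1) := by norm_cast
    rw [h3]
    constructor
    · linarith
    · rw [h2]; linarith

variable [BorelSpace X] [SecondCountableTopology X] [IsLocallyFiniteMeasure m]

theorem tsum_pOscillation_le_nonlocalEnergy (hD : VolumeDoubling m) {p α : ℝ} (hp : 0 < p)
    (hα : 1 ≤ α) {f : X → ℝ} (hf : Measurable f) (S : Set X) :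
    ∑' k : ℕ, (ENNReal.ofReal (((1 / 2 : ℝ) ^ k) ^ α))⁻¹ * pOscillation m p ((1 / 2 : ℝ) ^ k) f S ≤
      2 * nonlocalEnergy m p α S f := by
  refine ENNReal.tsum_le_of_sum_range_le fun n => ?_
  have hm : ∀ (k : ℕ) (y : X), Measurable fun x =>
      ENNReal.ofReal (|f x - f y| ^ p) * ballKernel m ((1 / 2 : ℝ) ^ k) x y := fun k y =>
    Measurable.mul (by fun_prop) (measurable_ballKernel_left _ y)
  have hm' : ∀ k : ℕ, Measurable fun y => ∫⁻ x in S,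
      ENNReal.ofReal (|f x - f y| ^ p) * ballKernel m ((1 / 2 : ℝ) ^ k) x y ∂m := fun k =>
    measurable_inner hf p _ S
  have h1 : ∑ k ∈ Finset.range n, (ENNReal.ofReal (((1 / 2 : ℝ) ^ k) ^ α))⁻¹ *
      pOscillation m p ((1 / 2 : ℝ) ^ k) f S = ∫⁻ y in S, ∫⁻ x in S, ∑ k ∈ Finset.range n,
      (ENNReal.ofReal (((1 / 2 : ℝ) ^ k) ^ α))⁻¹ * (ENNReal.ofReal (|f x - f y| ^ p) *
        ballKernel m ((1 / 2 : ℝ) ^ k) x y) ∂m ∂m := by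
    calc _ = ∑ k ∈ Finset.range n, ∫⁻ y in S, (ENNReal.ofReal (((1 / 2 : ℝ) ^ k) ^ α))⁻¹ *
          ∫⁻ x in S, ENNReal.ofReal (|f x - f y| ^ p) * ballKernel m ((1 / 2 : ℝ) ^ k) x y ∂m ∂m :=
          Finset.sum_congr rfl fun k _ => (lintegral_const_mul _ (hm' k)).symm
      _ = _ := by
          rw [← lintegral_finsetSum _ fun k _ => (hm' k).const_mul _]
          refine lintegral_congr fun y => ?_
          rw [lintegral_finsetSum _ fun k _ => (hm k y).const_mul _]
          exact Finset.sum_congr rfl fun k _ => (lintegral_const_mul _ (hm k y)).symm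
  rw [h1, nonlocalEnergy, ← lintegral_const_mul' _ _ (by norm_num)]
  refine lintegral_mono fun y => ?_
  rw [← lintegral_const_mul' _ _ (by norm_num)]
  refine lintegral_mono fun x => ?_
  rcases (dist_nonneg (x := x) (y := y)).eq_or_lt' with h | h
  · rw [dist_eq_zero] at h
    simp [h, Real.zero_rpow hp.ne']
  · calc _ = ENNReal.ofReal (|f x - f y| ^ p) * ∑ k ∈ Finset.range n,
          (ENNReal.ofReal (((1 / 2 : ℝ) ^ k) ^ α))⁻¹ * ballKernel m ((1 / 2 : ℝ) ^ k) x y := by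
          rw [Finset.mul_sum]
          exact Finset.sum_congr rfl fun k _ => by ring
      _ ≤ _ := by
          refine (mul_le_mul_right (sum_ballKernel_le hα h (hD.measure_ball_lt_top _ _).ne n)
            _).trans_eq ?_
          rw [ENNReal.div_eq_inv_mul]
          ring

theorem nonlocalEnergy_le_tsum_pOscillation (hD : VolumeDoubling m) {p : ℝ} (hp : 0 < p) (β : ℝ) :
    ∃ C : ℝ≥0, ∀ α : ℝ, 0 ≤ α → α ≤ β → ∀ δ : ℝ, 0 < δ → ∀ f : X → ℝ, Measurable f →
      ∀ S : Set X, nonlocalEnergy m p α S f ≤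
        C * (∑' k : ℕ, (ENNReal.ofReal ((δ * (1 / 2) ^ k) ^ α))⁻¹ *
          pOscillation m p (δ * (1 / 2) ^ k) f S +
        ∑' k : ℕ, (ENNReal.ofReal ((δ * 2 ^ (k + 1)) ^ α))⁻¹ *
          pOscillation m p (δ * 2 ^ (k + 1)) f S) := by
  obtain ⟨C, hC⟩ := inv_le_ballKernel hD β
  refine ⟨C, fun α hα hαβ δ hδ f hf S => ?_⟩
  let q : ℝ → X → X → ℝ≥0∞ := fun s x y => (ENNReal.ofReal (s ^ α))⁻¹ *
    (ENNReal.ofReal (|f x - f y| ^ p) * ballKernel m s x y)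
  have hm : ∀ (s : ℝ) (y : X), Measurable fun x =>
      ENNReal.ofReal (|f x - f y| ^ p) * ballKernel m s x y := fun s y =>
    Measurable.mul (by fun_prop) (measurable_ballKernel_left _ y)
  have hm' : ∀ s : ℝ, Measurable fun y => ∫⁻ x in S,
      ENNReal.ofReal (|f x - f y| ^ p) * ballKernel m s x y ∂m := fun s =>
    measurable_inner hf p s S
  have hq1 : ∀ s y, ∫⁻ x in S, q s x y ∂m = (ENNReal.ofReal (s ^ α))⁻¹ *
      ∫⁻ x in S, ENNReal.ofReal (|f x - f y| ^ p) * ballKernel m s x y ∂m := fun s y =>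
    lintegral_const_mul _ (hm s y)
  have hqm : ∀ s, Measurable fun y => ∫⁻ x in S, q s x y ∂m := fun s => by
    simp only [hq1]; exact (hm' s).const_mul _
  have hq2 : ∀ s, ∫⁻ y in S, ∫⁻ x in S, q s x y ∂m ∂m = (ENNReal.ofReal (s ^ α))⁻¹ *
      pOscillation m p s f S := fun s => by
    simp only [hq1]; exact lintegral_const_mul _ (hm' s)
  have hsum : ∀ σ : ℕ → ℝ, ∑' k, (ENNReal.ofReal (σ k ^ α))⁻¹ * pOscillation m p (σ k) f S =
      ∫⁻ y in S, ∫⁻ x in S, ∑' k, q (σ k) x y ∂m ∂m := by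
    intro σ
    simp only [← hq2]
    rw [← lintegral_tsum fun k => (hqm (σ k)).aemeasurable]
    exact lintegral_congr fun y =>
      (lintegral_tsum fun k => ((hm (σ k) y).const_mul _).aemeasurable).symm
  have hqs : ∀ σ : ℕ → ℝ, Measurable fun y => ∫⁻ x in S, ∑' k, q (σ k) x y ∂m := by
    intro σ
    have : (fun y => ∫⁻ x in S, ∑' k, q (σ k) x y ∂m) =
        fun y => ∑' k, ∫⁻ x in S, q (σ k) x y ∂m := funext fun y =>
      lintegral_tsum fun k => ((hm (σ k) y).const_mul _).aemeasurable
    rw [this]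
    exact Measurable.tsum fun k => hqm (σ k)
  rw [hsum, hsum, ← lintegral_add_left (hqs _), ← lintegral_const_mul' _ _ ENNReal.coe_ne_top]
  refine lintegral_mono fun y => ?_
  have hqs' : Measurable fun x => ∑' k : ℕ, q (δ * (1 / 2) ^ k) x y :=
    Measurable.tsum fun k => (hm _ y).const_mul _
  rw [← lintegral_add_left hqs', ← lintegral_const_mul' _ _ ENNReal.coe_ne_top]
  refine lintegral_mono fun x => ?_
  rcases (dist_nonneg (x := x) (y := y)).eq_or_lt' with h | h
  · rw [dist_eq_zero] at h
    simp [h, Real.zero_rpow hp.ne']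
  · have key : ∀ s, dist x y < s → s ≤ 2 * dist x y → ENNReal.ofReal (|f x - f y| ^ p) /
        (ENNReal.ofReal (dist x y ^ α) * m (Metric.ball y (dist x y))) ≤ C * q s x y := by
      intro s h1 h2
      rw [ENNReal.div_eq_inv_mul]
      refine (mul_le_mul_left (hC α hα hαβ x y s h1 h2) _).trans_eq ?_
      simp only [q]
      ring
    rcases exists_dyadic_scale h hδ with ⟨k, h1, h2⟩ | ⟨k, h1, h2⟩
    · refine (key _ h1 h2).trans (mul_le_mul_right ?_ _)
      exact (ENNReal.le_tsum k).trans le_self_add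
    · refine (key _ h1 h2).trans (mul_le_mul_right ?_ _)
      exact (ENNReal.le_tsum (f := fun k : ℕ => q (δ * 2 ^ (k + 1)) x y) k).trans le_add_self

end Kernel

/-! ### Geometric series and the factor `θp - θ` -/

theorem half_rpow_le {η : ℝ} (h0 : 0 ≤ η) (h1 : η ≤ 1) : (1 / 2 : ℝ) ^ η ≤ 1 - η / 2 := by
  have h := rpow_one_add_le_one_add_mul_self (s := -1 / 2) (by norm_num) h0 h1
  norm_num at h ⊢
  linarith

theorem one_sub_le_half_rpow {η : ℝ} (h0 : 0 ≤ η) : 1 - η ≤ (1 / 2 : ℝ) ^ η := by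
  rw [Real.rpow_def_of_pos (by norm_num)]
  have h1 := Real.add_one_le_exp (Real.log (1 / 2) * η)
  have h2 : -1 ≤ Real.log (1 / 2) := by
    have := Real.one_sub_inv_le_log_of_pos (x := 1 / 2) (by norm_num)
    norm_num at this ⊢
    linarith
  nlinarith

theorem tsum_half_rpow (η : ℝ) :
    ∑' k : ℕ, ENNReal.ofReal (((1 / 2 : ℝ) ^ k) ^ η) =
      (1 - ENNReal.ofReal ((1 / 2 : ℝ) ^ η))⁻¹ := by
  rw [← ENNReal.tsum_geometric]
  congr 1 with k
  rw [← ENNReal.ofReal_pow (by positivity), ← Real.rpow_natCast, ← Real.rpow_natCast,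
    ← Real.rpow_mul (by norm_num), ← Real.rpow_mul (by norm_num), mul_comm]

/-- The series sums to `1 / (1 - 2 ^ (-η))`, and Bernoulli's inequality bounds the denominator below
by `η / 2`. With the opposite estimate below it, this says that the normalized series stays between
`1` and `2`. -/
theorem ofReal_mul_tsum_half_rpow_le {η : ℝ} (h0 : 0 < η) (h1 : η ≤ 1) :
    ENNReal.ofReal η * ∑' k : ℕ, ENNReal.ofReal (((1 / 2 : ℝ) ^ k) ^ η) ≤ 2 := by
  rw [tsum_half_rpow, ← ENNReal.ofReal_one, ← ENNReal.ofReal_sub _ (by positivity),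
    ← div_eq_mul_inv]
  refine ENNReal.div_le_of_le_mul ?_
  rw [← ENNReal.ofReal_ofNat, ← ENNReal.ofReal_mul (by norm_num)]
  refine ENNReal.ofReal_le_ofReal ?_
  linarith [half_rpow_le h0.le h1]

theorem one_le_ofReal_mul_tsum_half_rpow {η : ℝ} (h0 : 0 < η) :
    1 ≤ ENNReal.ofReal η * ∑' k : ℕ, ENNReal.ofReal (((1 / 2 : ℝ) ^ k) ^ η) := by
  rw [tsum_half_rpow, ← ENNReal.ofReal_one, ← ENNReal.ofReal_sub _ (by positivity),
    ← div_eq_mul_inv]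
  rw [ENNReal.le_div_iff_mul_le (Or.inr (by simpa using h0)) (Or.inr ENNReal.ofReal_ne_top),
    ← ENNReal.ofReal_mul (by norm_num)]
  refine ENNReal.ofReal_le_ofReal ?_
  linarith [one_sub_le_half_rpow h0.le]

theorem eventually_one_le_mul {p θp : ℝ} (hp : 1 < p) (hθp : 1 ≤ θp) :
    ∀ᶠ θ in 𝓝[<] θp, 1 ≤ p * θ := by
  have h1 : Tendsto (fun θ => p * θ) (𝓝[<] θp) (𝓝 (p * θp)) :=
    ((continuous_const.mul continuous_id).tendsto θp).mono_left nhdsWithin_le_nhds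
  exact h1.eventually_const_le (by nlinarith)

theorem tendsto_mul_sub {θp : ℝ} (c : ℝ) :
    Tendsto (fun θ => c * (θp - θ)) (𝓝[<] θp) (𝓝 0) := by
  have h1 : Continuous fun θ : ℝ => c * (θp - θ) := by fun_prop
  have h2 := (h1.tendsto θp).mono_left (nhdsWithin_le_nhds (s := Iio θp))
  simpa using h2

/-! ### The bounds for the lower and upper limits -/

namespace PEnergyFramework

variable {X : Type*} [MetricSpace X] [MeasurableSpace X] {m : Measure X} {p : ℝ} [Fact (1 < p)]
  {𝓔 : PEnergyFramework m p}
  [BorelSpace X] [LocallyCompactSpace X] [SecondCountableTopology X]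

/-- Inner regularity: every compact subset of `Ω` lies in a relatively compact open one, on which
`F` itself is an admissible representative of `u`. -/
theorem Γ_le_ΓOn {Ω : Set X} (hΩ : IsOpen Ω) {u : X →ₘ[m.restrict Ω] ℝ} {F : 𝓔.dom}
    (hF : ∀ᵐ x ∂(m.restrict Ω), u x = F.1 x) : 𝓔.Γ F Ω ≤ 𝓔.ΓOn Ω u Ω := by
  rw [hΩ.measure_eq_iSup_isCompact]
  refine iSup_le fun K => iSup_le fun hKΩ => iSup_le fun hK => ?_
  obtain ⟨A, hA, hKA, hAΩ, hAc⟩ := exists_open_between_and_isCompact_closure hK hΩ hKΩ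
  have hAΩ' : A ⊆ Ω := subset_closure.trans hAΩ
  have h1 : 𝓔.Γ F (Ω ∩ A) ≤ 𝓔.ΓOn Ω u Ω :=
    le_iSup_of_le A (le_iSup_of_le F (le_iSup_of_le ⟨hA, hAc, hAΩ⟩
      (le_iSup_of_le (ae_restrict_of_ae_restrict_of_subset hAΩ' hF) le_rfl)))
  exact (measure_mono (subset_inter hKΩ hKA)).trans h1

variable [Nontrivial X] [IsLocallyFiniteMeasure m] [m.IsOpenPosMeasure]

/-- If the energy of `A` exceeds a suitable multiple of `c`, then `Γ_le_of_frequently` forces all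
sufficiently fine dyadic oscillations to exceed `c` after normalization. Summed with weights `2 ^
(-k * η)` and multiplied by `η`, they still give a multiple of `c`. -/
theorem Γ_le_liminf_bbmEnergy (hD : VolumeDoubling m) {θp : ℝ} (hθp : 1 ≤ θp)
    (hPI : 𝓔.Poincare fun r => r ^ (p * θp)) (hcap : 𝓔.CapUpper fun r => r ^ (p * θp)) :
    ∃ C : ℝ≥0, ∀ (v : 𝓔.dom) (A : Set X), IsOpen A →
      𝓔.Γ v A ≤ C * liminf (bbmEnergy m p θp A v.1) (𝓝[<] θp) := by
  have hp := exponent_gt_one p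
  obtain ⟨C, hC⟩ := Γ_le_of_frequently hD hPI hcap
  refine ⟨(C + 1) * (4 * p).toNNReal, fun v A hA => le_of_forall_lt fun b hb => ?_⟩
  obtain ⟨b', hbb', hb'⟩ := exists_between hb
  refine hbb'.trans_le ?_
  -- `C + 1` rather than `C`, to divide by something nonzero.
  set c := b' / ((C + 1 : ℝ≥0) : ℝ≥0∞) with hc
  have hC1 : ((C + 1 : ℝ≥0) : ℝ≥0∞) ≠ 0 := by simp
  have hcb : ((C + 1 : ℝ≥0) : ℝ≥0∞) * c = b' := ENNReal.mul_div_cancel hC1 ENNReal.coe_ne_top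
  have hnf : ¬ ∃ᶠ k : ℕ in atTop, (ENNReal.ofReal (((1 / 2 : ℝ) ^ k) ^ (p * θp)))⁻¹ *
      pOscillation m p ((1 / 2 : ℝ) ^ k) v.1 A ≤ c := by
    intro hf
    refine absurd ((hC v A hA c hf).trans ?_) (not_le.mpr hb')
    rw [← hcb]
    gcongr
    simp
  rw [not_frequently] at hnf
  obtain ⟨K, hK⟩ := eventually_atTop.mp hnf
  have hlower : ∀ᶠ θ in 𝓝[<] θp, c ≤ ENNReal.ofReal (4 * p) * bbmEnergy m p θp A v.1 θ := by
    -- Dropping the first `K` scales costs the factor `2 ^ (-K * η)`, which tends to one and is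
    -- eventually at least `1/2`. This `2`, the `2` of the dyadic comparison and `η = p * (θp - θ)`
    -- make up the constant `4 * p`.
    have hη : ∀ᶠ θ in 𝓝[<] θp, 1 / 2 ≤ ((1 / 2 : ℝ) ^ K) ^ (p * (θp - θ)) := by
      have h1 : Tendsto (fun θ => ((1 / 2 : ℝ) ^ K) ^ (p * (θp - θ))) (𝓝[<] θp) (𝓝 1) := by
        have h2 := ((Real.continuous_const_rpow (a := (1 / 2 : ℝ) ^ K)
          (by positivity)).tendsto 0).comp (tendsto_mul_sub (θp := θp) p)
        rwa [Real.rpow_zero] at h2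
      exact h1.eventually_const_le (by norm_num)
    filter_upwards [hη, eventually_one_le_mul hp hθp, self_mem_nhdsWithin] with θ h1 h2 h3
    have h3' : 0 < θp - θ := sub_pos.mpr h3
    set η := p * (θp - θ) with hηdef
    have hη0 : 0 < η := by positivity
    have hsum := tsum_pOscillation_le_nonlocalEnergy hD (by linarith : 0 < p) h2
      (measurable_coe v) A
    have hterm : ∀ k : ℕ, ENNReal.ofReal (1 / 2) * c *
        ENNReal.ofReal (((1 / 2 : ℝ) ^ k) ^ η) ≤
        (ENNReal.ofReal (((1 / 2 : ℝ) ^ (k + K)) ^ (p * θ)))⁻¹ *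
          pOscillation m p ((1 / 2 : ℝ) ^ (k + K)) v.1 A := by
      intro k
      have hs : 0 < (1 / 2 : ℝ) ^ (k + K) := by positivity
      have h4 := (not_le.mp (hK (k + K) (by omega))).le
      have h5 : (ENNReal.ofReal (((1 / 2 : ℝ) ^ (k + K)) ^ (p * θ)))⁻¹ =
          ENNReal.ofReal (((1 / 2 : ℝ) ^ (k + K)) ^ η) *
            (ENNReal.ofReal (((1 / 2 : ℝ) ^ (k + K)) ^ (p * θp)))⁻¹ := by
        rw [inv_ofReal_rpow hs, inv_ofReal_rpow hs, ← ENNReal.ofReal_mul (by positivity),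
          Real.inv_rpow hs.le, Real.inv_rpow hs.le, ← Real.rpow_neg hs.le, ← Real.rpow_neg hs.le,
          ← Real.rpow_add hs]
        congr 2
        rw [hηdef]; ring
      rw [h5, mul_assoc _ _ (pOscillation _ _ _ _ _), pow_add,
        Real.mul_rpow (by positivity) (by positivity), ENNReal.ofReal_mul (by positivity)]
      rw [pow_add] at h4
      calc _ = ENNReal.ofReal (((1 / 2 : ℝ) ^ k) ^ η) * ENNReal.ofReal (1 / 2) * c := by ring
        _ ≤ _ := by gcongr
    have h6 : ENNReal.ofReal (1 / 2) * c * ∑' k : ℕ, ENNReal.ofReal (((1 / 2 : ℝ) ^ k) ^ η) ≤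
        2 * nonlocalEnergy m p (p * θ) A v.1 := by
      rw [← ENNReal.tsum_mul_left]
      refine (ENNReal.tsum_le_tsum hterm).trans (le_trans ?_ hsum)
      exact ENNReal.tsum_comp_le_tsum_of_injective (add_left_injective K) (fun k : ℕ =>
        (ENNReal.ofReal (((1 / 2 : ℝ) ^ k) ^ (p * θ)))⁻¹ *
          pOscillation m p ((1 / 2 : ℝ) ^ k) v.1 A)
    have h7 : ENNReal.ofReal 2 * ENNReal.ofReal (1 / 2) = 1 := by
      rw [← ENNReal.ofReal_mul (by norm_num)]; norm_num
    calc c ≤ c * (ENNReal.ofReal η * ∑' k : ℕ, ENNReal.ofReal (((1 / 2 : ℝ) ^ k) ^ η)) :=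
          le_mul_of_one_le_right' (one_le_ofReal_mul_tsum_half_rpow hη0)
      _ = ENNReal.ofReal 2 * ENNReal.ofReal η * (ENNReal.ofReal (1 / 2) * c *
            ∑' k : ℕ, ENNReal.ofReal (((1 / 2 : ℝ) ^ k) ^ η)) := by
          rw [← one_mul (c * _), ← h7]; ring
      _ ≤ ENNReal.ofReal 2 * ENNReal.ofReal η * (2 * nonlocalEnergy m p (p * θ) A v.1) := by
          gcongr
      _ = _ := by
          rw [bbmEnergy_eq, hηdef, ENNReal.ofReal_mul (by linarith : 0 ≤ p),
            ENNReal.ofReal_mul (by norm_num : (0 : ℝ) ≤ 4), ENNReal.ofReal_ofNat,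
            ENNReal.ofReal_ofNat]
          ring
  have hpt : ENNReal.ofReal (4 * p) ≠ 0 := by simpa using by linarith
  have hlim : c / ENNReal.ofReal (4 * p) ≤ liminf (bbmEnergy m p θp A v.1) (𝓝[<] θp) := by
    refine le_liminf_of_le (by isBoundedDefault) (hlower.mono fun θ h => ?_)
    exact ENNReal.div_le_of_le_mul' h
  rw [← hcb, ENNReal.coe_mul, mul_assoc]
  gcongr
  rw [ENNReal.div_le_iff_le_mul (Or.inl hpt) (Or.inl ENNReal.ofReal_ne_top)] at hlim
  rw [mul_comm]
  exact hlim

/-- Scales are split at a fixed `δ`. Below it, Poincaré turns the sum into a geometric series times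
the energy of a neighbourhood of `Ω` of width proportional to `δ`; above it, the sum is finite and
disappears with `θp - θ`. Only afterwards does `δ` tend to zero, shrinking the neighbourhoods to the
closure. -/
theorem limsup_bbmEnergy_le (hD : VolumeDoubling m) {θp : ℝ} (hθp : 1 ≤ θp)
    (hPI : 𝓔.Poincare fun r => r ^ (p * θp)) :
    ∃ C : ℝ≥0, ∀ (F : 𝓔.dom) (Ω : Set X), MeasurableSet Ω →
      limsup (bbmEnergy m p θp Ω F.1) (𝓝[<] θp) ≤ C * 𝓔.Γ F (closure Ω) := by
  have hp := exponent_gt_one p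
  obtain ⟨C₁, L, hC₁⟩ := hPI.pOscillation_le hD
  obtain ⟨C₂, hC₂⟩ := pOscillation_le_lintegral hD (p := p) (by linarith)
  obtain ⟨C₃, hC₃⟩ := nonlocalEnergy_le_tsum_pOscillation hD (p := p) (by linarith) (p * θp)
  refine ⟨C₃ * (2 * C₁), fun F Ω hΩ => ?_⟩
  set N := ∫⁻ x in Ω, ENNReal.ofReal (|F.1 x| ^ p) ∂m with hN
  have hNt : N ≠ ∞ := by
    have h1 := (Lp.memLp F.1).eLpNorm_lt_top
    rw [eLpNorm_lt_top_iff_lintegral_rpow_enorm_lt_top (by simpa using by linarith)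
      ENNReal.ofReal_ne_top, ENNReal.toReal_ofReal (by linarith)] at h1
    refine ((setLIntegral_le_lintegral _ _).trans_lt (lt_of_eq_of_lt ?_ h1)).ne
    refine lintegral_congr fun x => ?_
    rw [← ENNReal.ofReal_rpow_of_nonneg (abs_nonneg _) (by linarith), ← Real.norm_eq_abs,
      ofReal_norm]
  have step : ∀ δ : ℝ, 0 < δ → δ ≤ 1 → ∀ᶠ θ in 𝓝[<] θp, bbmEnergy m p θp Ω F.1 θ ≤
      C₃ * (2 * C₁) * 𝓔.Γ F (Metric.thickening (|L| * δ) Ω) +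
        ENNReal.ofReal (1 * (θp - θ)) * (C₃ * (C₂ * ENNReal.ofReal ((δ⁻¹) ^ (p * θp)) * N)) := by
    intro δ hδ hδ1
    have hη1 : ∀ᶠ θ in 𝓝[<] θp, p * (θp - θ) ≤ 1 :=
      (tendsto_mul_sub p).eventually_le_const zero_lt_one
    filter_upwards [hη1, eventually_one_le_mul hp hθp, self_mem_nhdsWithin] with θ h1 h2 h3
    have h3' : 0 < θp - θ := sub_pos.mpr h3
    set η := p * (θp - θ) with hηdef
    have hη0 : 0 < η := by positivity
    set G := 𝓔.Γ F (Metric.thickening (|L| * δ) Ω) with hG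
    have hαβ : p * θ ≤ p * θp := by nlinarith
    have hnear : ∀ k : ℕ, (ENNReal.ofReal ((δ * (1 / 2) ^ k) ^ (p * θ)))⁻¹ *
        pOscillation m p (δ * (1 / 2) ^ k) F.1 Ω ≤
        C₁ * G * ENNReal.ofReal (((1 / 2 : ℝ) ^ k) ^ η) := by
      intro k
      set s := δ * (1 / 2 : ℝ) ^ k with hs
      have hs0 : 0 < s := by positivity
      have hsδ : s ≤ δ := mul_le_of_le_one_right hδ.le (pow_le_one₀ (by norm_num) (by norm_num))
      have h4 : pOscillation m p s F.1 Ω ≤ C₁ * ENNReal.ofReal (s ^ (p * θp)) * G := by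
        refine (hC₁ s hs0 F Ω hΩ).trans ?_
        gcongr
        refine measure_mono (Metric.thickening_mono ?_ _)
        exact (mul_le_mul_of_nonneg_right (le_abs_self L) hs0.le).trans
          (mul_le_mul_of_nonneg_left hsδ (abs_nonneg _))
      calc _ ≤ (ENNReal.ofReal (s ^ (p * θ)))⁻¹ * (C₁ * ENNReal.ofReal (s ^ (p * θp)) * G) := by
            gcongr
        _ = C₁ * G * ((ENNReal.ofReal (s ^ (p * θ)))⁻¹ * ENNReal.ofReal (s ^ (p * θp))) := by ring
        _ = C₁ * G * ENNReal.ofReal (s ^ η) := by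
            rw [inv_ofReal_rpow hs0, ← ENNReal.ofReal_mul (by positivity), Real.inv_rpow hs0.le,
              ← Real.rpow_neg hs0.le, ← Real.rpow_add hs0]
            congr 4
            rw [hηdef]; ring
        _ ≤ _ := by
            gcongr
            rw [hs]
            exact mul_le_of_le_one_left (by positivity) hδ1
    -- As `p * θ ≥ 1`, the weights decay at least like `2 ^ (-(k + 1))`, and `δ ≤ 1` allows the
    -- exponent of `δ⁻¹` to be raised to `p * θp`: the bound is independent of `θ`.
    have hfar : ∀ k : ℕ, (ENNReal.ofReal ((δ * 2 ^ (k + 1)) ^ (p * θ)))⁻¹ *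
        pOscillation m p (δ * 2 ^ (k + 1)) F.1 Ω ≤
        C₂ * ENNReal.ofReal ((δ⁻¹) ^ (p * θp)) * N * 2⁻¹ ^ (k + 1) := by
      intro k
      have hs0 : 0 < δ * 2 ^ (k + 1) := by positivity
      have h4 : (ENNReal.ofReal ((δ * 2 ^ (k + 1)) ^ (p * θ)))⁻¹ ≤
          ENNReal.ofReal ((δ⁻¹) ^ (p * θp)) * 2⁻¹ ^ (k + 1) := by
        have h5 : (2⁻¹ : ℝ≥0∞) ^ (k + 1) = ENNReal.ofReal ((2 ^ (k + 1))⁻¹) := by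
          rw [ENNReal.ofReal_inv_of_pos (by positivity), ENNReal.ofReal_pow (by norm_num),
            ENNReal.ofReal_ofNat, ENNReal.inv_pow]
        rw [h5, inv_ofReal_rpow hs0, ← ENNReal.ofReal_mul (by positivity), mul_inv,
          Real.mul_rpow (by positivity) (by positivity)]
        refine ENNReal.ofReal_le_ofReal ?_
        have h6 : 1 ≤ δ⁻¹ := (one_le_inv₀ hδ).mpr hδ1
        gcongr
        have h7 : ((2 : ℝ) ^ (k + 1))⁻¹ ≤ 1 := inv_le_one_of_one_le₀ (one_le_pow₀ (by norm_num))
        have h8 := Real.rpow_le_rpow_of_exponent_ge (by positivity) h7 h2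
        rwa [Real.rpow_one] at h8
      calc _ ≤ ENNReal.ofReal ((δ⁻¹) ^ (p * θp)) * 2⁻¹ ^ (k + 1) * (C₂ * N) :=
            mul_le_mul' h4 (hC₂ _ hs0 F.1 (measurable_coe F) Ω)
        _ = _ := by ring
    have hfarsum : ∑' k : ℕ, (2⁻¹ : ℝ≥0∞) ^ (k + 1) = 1 := by
      simp only [pow_succ]
      rw [ENNReal.tsum_mul_right, ENNReal.tsum_geometric, ENNReal.one_sub_inv_two, inv_inv]
      exact ENNReal.mul_inv_cancel (by norm_num) (by norm_num)
    have hle := hC₃ (p * θ) (by linarith) hαβ δ hδ F.1 (measurable_coe F) Ω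
    have hηle : ENNReal.ofReal (θp - θ) ≤ ENNReal.ofReal η :=
      ENNReal.ofReal_le_ofReal (by rw [hηdef]; nlinarith)
    calc bbmEnergy m p θp Ω F.1 θ
        ≤ ENNReal.ofReal (θp - θ) * (C₃ * (∑' k : ℕ, C₁ * G *
            ENNReal.ofReal (((1 / 2 : ℝ) ^ k) ^ η) +
            ∑' k : ℕ, C₂ * ENNReal.ofReal ((δ⁻¹) ^ (p * θp)) * N * 2⁻¹ ^ (k + 1))) := by
          rw [bbmEnergy_eq]
          refine mul_le_mul_right (hle.trans (mul_le_mul_right (add_le_add ?_ ?_) _)) _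
          · exact ENNReal.tsum_le_tsum hnear
          · exact ENNReal.tsum_le_tsum hfar
      _ = C₃ * C₁ * G * (ENNReal.ofReal (θp - θ) *
            ∑' k : ℕ, ENNReal.ofReal (((1 / 2 : ℝ) ^ k) ^ η)) +
          ENNReal.ofReal (1 * (θp - θ)) *
            (C₃ * (C₂ * ENNReal.ofReal ((δ⁻¹) ^ (p * θp)) * N)) := by
          rw [ENNReal.tsum_mul_left, ENNReal.tsum_mul_left, hfarsum, one_mul]
          ring
      _ ≤ C₃ * C₁ * G * 2 + ENNReal.ofReal (1 * (θp - θ)) *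
            (C₃ * (C₂ * ENNReal.ofReal ((δ⁻¹) ^ (p * θp)) * N)) := by
          gcongr
          exact (mul_le_mul_left hηle _).trans (ofReal_mul_tsum_half_rpow_le hη0 h1)
      _ = _ := by ring
  have step2 : ∀ δ : ℝ, 0 < δ → δ ≤ 1 → limsup (bbmEnergy m p θp Ω F.1) (𝓝[<] θp) ≤
      C₃ * (2 * C₁) * 𝓔.Γ F (Metric.thickening (|L| * δ) Ω) := by
    intro δ hδ hδ1
    have h1 : Tendsto (fun θ => C₃ * (2 * C₁) * 𝓔.Γ F (Metric.thickening (|L| * δ) Ω) +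
        ENNReal.ofReal (1 * (θp - θ)) * (C₃ * (C₂ * ENNReal.ofReal ((δ⁻¹) ^ (p * θp)) * N)))
        (𝓝[<] θp) (𝓝 (C₃ * (2 * C₁) * 𝓔.Γ F (Metric.thickening (|L| * δ) Ω) +
        ENNReal.ofReal 0 * (C₃ * (C₂ * ENNReal.ofReal ((δ⁻¹) ^ (p * θp)) * N)))) := by
      refine tendsto_const_nhds.add (ENNReal.Tendsto.mul_const ?_ (Or.inr ?_))
      · exact (ENNReal.continuous_ofReal.tendsto _).comp (tendsto_mul_sub 1)
      · exact ENNReal.mul_ne_top ENNReal.coe_ne_top (ENNReal.mul_ne_top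
          (ENNReal.mul_ne_top ENNReal.coe_ne_top ENNReal.ofReal_ne_top) hNt)
    rw [ENNReal.ofReal_zero, zero_mul, add_zero] at h1
    rw [← h1.limsup_eq]
    exact limsup_le_limsup (step δ hδ hδ1)
  have hthick : Tendsto (fun δ => C₃ * (2 * C₁) * 𝓔.Γ F (Metric.thickening δ Ω)) (𝓝[>] 0)
      (𝓝 (C₃ * (2 * C₁) * 𝓔.Γ F (closure Ω))) :=
    ENNReal.Tendsto.const_mul (tendsto_measure_thickening
      ⟨1, zero_lt_one, measure_ne_top _ _⟩) (Or.inr (by simp [ENNReal.mul_eq_top]))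
  have hfinal : limsup (bbmEnergy m p θp Ω F.1) (𝓝[<] θp) ≤
      C₃ * (2 * C₁) * 𝓔.Γ F (closure Ω) := by
    refine ge_of_tendsto hthick ?_
    filter_upwards [Ioo_mem_nhdsGT (show (0 : ℝ) < |L| + 1 by positivity)] with δ hδ
    have hδ0 : 0 < δ := hδ.1
    -- Division by `|L| + 1` keeps the neighbourhood within `δ` for any `L`, including zero.
    refine (step2 (δ / (|L| + 1)) (by positivity) ?_).trans ?_
    · rw [div_le_one (by positivity)]; exact hδ.2.le
    · gcongr
      rw [mul_div_assoc', div_le_iff₀ (by positivity)]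
      nlinarith [abs_nonneg L]
  refine hfinal.trans_eq ?_
  push_cast
  ring

end PEnergyFramework

end

/-! ### The characterization -/

theorem mainTheorem2 {X : Type*} [MetricSpace X] [CompleteSpace X] [TopologicalSpace.SeparableSpace X]
    [LocallyCompactSpace X] [Nontrivial X] [MeasurableSpace X] [BorelSpace X]
    (m : Measure X) [IsLocallyFiniteMeasure m] [m.IsOpenPosMeasure]
    (p : ℝ) [Fact (1 < p)] (𝓔 : PEnergyFramework m p)
    (θp : ℝ) (hθp : 1 ≤ θp)
    (hVD : VolumeDoubling m)
    (hPI : 𝓔.Poincare (fun r => r ^ (p * θp)))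
    (hcap : 𝓔.CapUpper (fun r => r ^ (p * θp))) :
    ∃ C : ℝ≥0, 1 ≤ C ∧ ∀ Ω : Set X, 𝓔.ExtensionProperty Ω → ∀ u ∈ 𝓔.FOn Ω,
      (C : ℝ≥0∞)⁻¹ * 𝓔.ΓOn Ω u Ω ≤ liminf (bbmEnergy m p θp Ω u) (𝓝[<] θp) ∧
      liminf (bbmEnergy m p θp Ω u) (𝓝[<] θp) ≤ limsup (bbmEnergy m p θp Ω u) (𝓝[<] θp) ∧
      limsup (bbmEnergy m p θp Ω u) (𝓝[<] θp) ≤ C * 𝓔.ΓOn Ω u Ω := by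
  have : SecondCountableTopology X := UniformSpace.secondCountable_of_separable X
  obtain ⟨C₁, hC₁⟩ := PEnergyFramework.Γ_le_liminf_bbmEnergy hVD hθp hPI hcap
  obtain ⟨C₂, hC₂⟩ := PEnergyFramework.limsup_bbmEnergy_le hVD hθp hPI
  refine ⟨C₁ + C₂ + 1, le_add_self, fun Ω hE u hu => ⟨?_, ?_, ?_⟩⟩
  · rw [← ENNReal.div_eq_inv_mul]
    refine ENNReal.div_le_of_le_mul' ?_
    -- It suffices to treat one relatively compact `A` and one representative `v`: the lower bound
    -- holds on `A` for `v`, and the double integral of `u` over `Ω` dominates that of `v` over `A`.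
    refine iSup_le fun A => iSup_le fun v => iSup_le fun hA => iSup_le fun hv => ?_
    have hAΩ : A ⊆ Ω := subset_closure.trans hA.2.2
    calc 𝓔.Γ v (Ω ∩ A) ≤ 𝓔.Γ v A := measure_mono inter_subset_right
      _ ≤ C₁ * liminf (bbmEnergy m p θp A v.1) (𝓝[<] θp) := hC₁ v A hA.1
      _ ≤ (C₁ + C₂ + 1 : ℝ≥0) * liminf (bbmEnergy m p θp Ω u) (𝓝[<] θp) := by
          refine mul_le_mul' ?_ (liminf_le_liminf (Eventually.of_forall fun θ => ?_))
          · rw [add_assoc]; exact ENNReal.coe_le_coe.mpr le_self_add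
          · rw [bbmEnergy_eq, bbmEnergy_eq, ← nonlocalEnergy_congr hv]
            gcongr
            exact nonlocalEnergy_mono hAΩ
  · exact liminf_le_limsup
  · obtain ⟨hΩ, -, hext⟩ := hE
    -- The extension has the same double integral over `Ω`, and since it does not charge the
    -- boundary, its energy on the closure is its energy on `Ω`.
    obtain ⟨F, hF, hF0⟩ := hext u hu
    have hbbm : bbmEnergy m p θp Ω u = bbmEnergy m p θp Ω F.1 := by
      ext θ
      rw [bbmEnergy_eq, bbmEnergy_eq, nonlocalEnergy_congr hF]
    calc limsup (bbmEnergy m p θp Ω u) (𝓝[<] θp) ≤ C₂ * 𝓔.Γ F (closure Ω) := by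
          rw [hbbm]; exact hC₂ F Ω hΩ.measurableSet
      _ ≤ C₂ * 𝓔.Γ F Ω := by
          rw [closure_eq_self_union_frontier]
          refine mul_le_mul_right ((measure_union_le _ _).trans ?_) _
          rw [hF0, add_zero]
      _ ≤ (C₁ + C₂ + 1 : ℝ≥0) * 𝓔.ΓOn Ω u Ω := by
          refine mul_le_mul' (ENNReal.coe_le_coe.mpr ?_) (PEnergyFramework.Γ_le_ΓOn hΩ hF)
          rw [add_comm C₁, add_assoc]
          exact le_self_add
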